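/- \textbf{Setting.} Let $d\ge1$, $0<s<1$, and let $\Omega\subset\mathbb R^d$ be a bounded open set. Let $g:\mathbb R^d\times\mathbb R^d\times(0,\infty)\to(0,\infty)$ be measurable and let $0<g_*\le g^*$, $0<k_*\le k^*$ be constants such that, for a.e. $(x,y)$, and also for a.e. $x$ with $y=x$: $r\mapsto g(x,y,r)$ is locally Lipschitz on $(0,\infty)$, $rg(x,y,r)\to0$ as $r\to0^+$, $rg(x,y,r)\to\infty$ as $r\to\infty$, $g_*\le \frac{r\,\partial_rg(x,y,r)}{g(x,y,r)}+1\le g^*$ for a.e. $r>0$, and $k_*\le g(x,y,1)\le k^*$. Put $G(x,y,r)=\int_0^r g(x,y,\rho)\rho\,d\rho$, $G^*(x,y,r)=\sup_{\rho>0}\{r\rho-G(x,y,\rho)\}$, $\hat G(x,r)=G(x,x,r)$, $\hat G^*(x,r)=G^*(x,x,r)$, $\delta^su(x,y)=\frac{u(x)-u(y)}{|x-y|^s}$, $$\Gamma_{\hat G}(u)=\int_{\mathbb R^d}\hat G(x,|u(x)|)\,dx,\qquad \Gamma_{s,G}(u)=\int_{\mathbb R^d}\int_{\mathbb R^d}G(x,y,|\delta^su(x,y)|)\frac{dx\,dy}{|x-y|^d}.$$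 $W^{s,G}(\mathbb R^d)$ is the space of measurable $u:\mathbb R^d\to\mathbb R$ with $\Gamma_{\hat G}(u)+\Gamma_{s,G}(u)<\infty$, normed by $\|u\|_{s,G}=\|u\|_{\hat G}+[u]_{s,G}$, where $\|u\|_{\hat G}=\inf\{\lambda>0:\Gamma_{\hat G}(u/\lambda)\le1\}$ and $[u]_{s,G}=\inf\{\lambda>0:\Gamma_{s,G}(u/\lambda)\le1\}$. For open $U\subset\mathbb R^d$, $W^{s,G}_0(U)$ is the closure of $C_c^\infty(U)$ in $W^{s,G}(\mathbb R^d)$. $L^{\hat G^*}(\Omega)$ is the space of measurable $f$ on $\Omega$ with $\int_\Omega\hat G^*(x,|f(x)|)\,dx<\infty$. The operator is $$\langle\mathcal L_g^su,v\rangle=\int_{\mathbb R^d}\int_{\mathbb R^d}g(x,y,|\delta^su|)\,\delta^su\,\delta^sv\,\frac{dx\,dy}{|x-y|^d}.$$ The dual $W^{-s,G^*}(\Omega)$ of $W^{s,G}_0(\Omega)$ is ordered by: $F\le H$ iff $\langle F,v\rangle\le\langle H,v\rangle$ for all $v\in W^{s,G}_0(\Omega)$ with $v\ge0$ a.e.;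 $F\vee H$ is the least upper bound in this order and $F^+=F\vee0$. A function $f\in L^{\hat G^*}(\Omega)$ is identified with the functional $v\mapsto\int_\Omega fv$. Let $\psi\in W^{s,G}_0(\mathbb R^d)$ with $\psi\le0$ a.e. in $\mathbb R^d\setminus\Omega$, and let $f\in L^{\hat G^*}(\Omega)$. Let $u$ be a solution of the one-obstacle problem $$u\in\mathbb K=\{v\in W^{s,G}_0(\Omega):v\ge\psi\text{ a.e. in }\Omega\},\qquad \langle\mathcal L_g^su,v-u\rangle-\int_\Omega f(v-u)\ge0\quad\forall v\in\mathbb K.$$ Let $\theta:\mathbb R\to[0,1]$ be nondecreasing and Lipschitz with $\theta(t)=0$ for $t\le0$, $\theta(t)\to1$ as $t\to+\infty$, and $[1-\theta(t)]t\le C_\theta$ for all $t>0$, for some constant $C_\theta>0$. For $\varepsilon>0$ consider, with $\zeta=(\mathcal L_g^s\psi-f)^+$, the penalised problem $$u_\varepsilon\in W^{s,G}_0(\Omega):\qquad\langle\mathcal L_g^su_\varepsilon,v\rangle+\int_\Omega\zeta\,\theta\!\left(\tfrac{u_\varepsilon-\psi}{\varepsilon}\right)v=\int_\Omega(f+\zeta)v\qquad\forall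 v\in W^{s,G}_0(\Omega).\tag{P}$$ \textbf{Theorem.} Assume that the positive part $(\mathcal L_g^s\psi-f)^+$ exists and belongs to $L^{\hat G^*}(\Omega)$. Then: (1) $\mathcal L_g^su$ and $f\vee\mathcal L_g^s\psi$ are (represented by) functions in $L^{\hat G^*}(\Omega)$, and $$f\le\mathcal L_g^su\le f\vee\mathcal L_g^s\psi\quad\text{a.e. in }\Omega.$$ (2) For every $\varepsilon>0$ problem (P) has at most one solution (up to null sets); it has one if the Poincaré inequality $\|v\|_{\hat G}\le C[v]_{s,G}$ holds for all $v\in W_0^{s,G}(\Omega)$ with some constant $C$. (3) If $u_\varepsilon$ solves (P) for each $\varepsilon>0$, then, as $\varepsilon\to0^+$, $u_\varepsilon\to u$ strongly in $W^{s,G}_0(\Omega)$, i.e. $\|u_\varepsilon-u\|_{s,G}\to0$; and if $s(g_*+1)<d$, then $u_\varepsilon,u\in L^q(\Omega)$ and $u_\varepsilon\to u$ strongly in $L^q(\Omega)$ for every real $q$ with $1\le q<\frac{d(g_*+1)}{d-s(g_*+1)}$. -/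

import Mathlib

open MeasureTheory Filter Topology Set
open scoped ENNReal NNReal ContDiff

noncomputable section

namespace FracOrlicz

/-- `ℝ^d` with the Euclidean norm. -/
abbrev E (d : ℕ) : Type := EuclideanSpace ℝ (Fin d)

/-- Structure conditions on `h = g(x,y,·)` for a fixed pair `(x,y)`: positive and locally Lipschitz
on `(0,∞)`, `r h(r) → 0` as `r → 0+`, `r h(r) → ∞` as `r → ∞`,
`g_* ≤ r h'(r) / h(r) + 1 ≤ g^*` (at almost every `r > 0`, as `h` is only Lipschitz), and the
normalisation `k_* ≤ h(1) ≤ k^*`. -/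
structure IsProfile (gl gu kl ku : ℝ) (h : ℝ → ℝ) : Prop where
  pos : ∀ r, 0 < r → 0 < h r
  lipschitz : LocallyLipschitzOn (Ioi 0) h
  tendsto_zero : Tendsto (fun r => r * h r) (𝓝[>] 0) (𝓝 0)
  tendsto_atTop : Tendsto (fun r => r * h r) atTop atTop
  growth : ∀ᵐ r ∂(volume.restrict (Ioi (0 : ℝ))),
    gl ≤ r * deriv h r / h r + 1 ∧ r * deriv h r / h r + 1 ≤ gu
  lower : kl ≤ h 1
  upper : h 1 ≤ ku

/-- Admissible nonlinearities `g(x,y,r)`: measurable, satisfying the structure conditions with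
uniform constants for a.e. `(x,y)` and also for a.e. `x` on the diagonal `y = x` (a null set of
pairs, which however determines `G(x,x,·)`). -/
structure IsAdmissible {d : ℕ} (gl gu kl ku : ℝ) (g : E d → E d → ℝ → ℝ) : Prop where
  gl_pos : 0 < gl
  gl_le : gl ≤ gu
  kl_pos : 0 < kl
  measurable : Measurable (fun p : E d × E d × ℝ => g p.1 p.2.1 p.2.2)
  profile : ∀ᵐ p : E d × E d, IsProfile gl gu kl ku (g p.1 p.2)
  profile_diag : ∀ᵐ x : E d, IsProfile gl gu kl ku (g x x)

variable {d : ℕ}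

/-- `G(x,y,r) = ∫_0^r g(x,y,ρ) ρ dρ`. -/
def primG (g : E d → E d → ℝ → ℝ) (x y : E d) (r : ℝ) : ℝ :=
  ∫ ρ in (0 : ℝ)..r, g x y ρ * ρ

/-- The conjugate `G^*(x,y,r) = sup_{ρ > 0} (r ρ - G(x,y,ρ))`, with values in `[0,∞]`
(the supremum is never negative, as one sees for `ρ → 0`). -/
def conjG (g : E d → E d → ℝ → ℝ) (x y : E d) (r : ℝ) : ℝ≥0∞ :=
  ⨆ (ρ : ℝ) (_ : 0 < ρ), ENNReal.ofReal (r * ρ - primG g x y ρ)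

/-- The difference quotient `δ^s u(x,y) = (u(x) - u(y)) / |x-y|^s`. -/
def delta (s : ℝ) (u : E d → ℝ) (x y : E d) : ℝ :=
  (u x - u y) / ‖x - y‖ ^ s

/-- The modular `∫ G(x,x,|u(x)|) dx`. -/
def modG (g : E d → E d → ℝ → ℝ) (u : E d → ℝ) : ℝ≥0∞ :=
  ∫⁻ x, ENNReal.ofReal (primG g x x |u x|)

/-- The modular `∬ G(x,y,|δ^s u(x,y)|) dx dy / |x-y|^d`. -/
def modS (g : E d → E d → ℝ → ℝ) (s : ℝ) (u : E d → ℝ) : ℝ≥0∞ :=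
  ∫⁻ p : E d × E d, ENNReal.ofReal (primG g p.1 p.2 |delta s u p.1 p.2| / ‖p.1 - p.2‖ ^ d)

/-- The Luxemburg functional `inf {l > 0 : m(u / l) ≤ 1}` of a modular `m`. -/
def luxemburg (m : (E d → ℝ) → ℝ≥0∞) (u : E d → ℝ) : ℝ≥0∞ :=
  ⨅ (l : ℝ) (_ : 0 < l) (_ : m (fun x => u x / l) ≤ 1), ENNReal.ofReal l

/-- The norm of `L^{Ĝ}(ℝ^d)`. -/
def normG (g : E d → E d → ℝ → ℝ) (u : E d → ℝ) : ℝ≥0∞ := luxemburg (modG g) u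

/-- The seminorm `[u]_{s,G}`. -/
def seminormS (g : E d → E d → ℝ → ℝ) (s : ℝ) (u : E d → ℝ) : ℝ≥0∞ := luxemburg (modS g s) u

/-- The norm `‖u‖_{s,G}` of `W^{s,G}(ℝ^d)`. -/
def normW (g : E d → E d → ℝ → ℝ) (s : ℝ) (u : E d → ℝ) : ℝ≥0∞ := normG g u + seminormS g s u

/-- `u ∈ W^{s,G}(ℝ^d)`. -/
def MemW (g : E d → E d → ℝ → ℝ) (s : ℝ) (u : E d → ℝ) : Prop :=
  AEMeasurable u ∧ modG g u < ⊤ ∧ modS g s u < ⊤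

/-- `u ∈ W^{s,G}_0(U)`: the closure of `C_c^∞(U)` in `W^{s,G}(ℝ^d)`. -/
def MemW0 (g : E d → E d → ℝ → ℝ) (s : ℝ) (U : Set (E d)) (u : E d → ℝ) : Prop :=
  MemW g s u ∧ ∀ η : ℝ≥0∞, 0 < η → ∃ φ : E d → ℝ,
    ContDiff ℝ ∞ φ ∧ HasCompactSupport φ ∧ tsupport φ ⊆ U ∧ normW g s (fun x => u x - φ x) < η

/-- `f ∈ L^{Ĝ^*}(Ω)`: measurable on `Ω` with `∫_Ω G^*(x,x,|f(x)|) dx < ∞`. -/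
def MemLstar (g : E d → E d → ℝ → ℝ) (Ω : Set (E d)) (f : E d → ℝ) : Prop :=
  AEMeasurable f (volume.restrict Ω) ∧ ∫⁻ x in Ω, conjG g x x |f x| < ⊤

/-- The operator `⟨L_g^s u, v⟩ = ∬ g(x,y,|δ^s u|) δ^s u δ^s v dx dy / |x-y|^d`. -/
def opL (g : E d → E d → ℝ → ℝ) (s : ℝ) (u v : E d → ℝ) : ℝ :=
  ∫ p : E d × E d, g p.1 p.2 |delta s u p.1 p.2| * delta s u p.1 p.2 * delta s v p.1 p.2
    / ‖p.1 - p.2‖ ^ d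

/-- The functional `v ↦ ∫_Ω f v` given by a function `f`. -/
def pairing (Ω : Set (E d)) (f v : E d → ℝ) : ℝ := ∫ x in Ω, f x * v x

/-- `F` is (the restriction to `W^{s,G}_0(Ω)` of) an element of the dual `W^{-s,G^*}(Ω)`:
linear and bounded on `W^{s,G}_0(Ω)`. -/
structure IsDual (g : E d → E d → ℝ → ℝ) (s : ℝ) (Ω : Set (E d)) (F : (E d → ℝ) → ℝ) : Prop where
  add : ∀ v w, MemW0 g s Ω v → MemW0 g s Ω w → F (fun x => v x + w x) = F v + F w
  smul : ∀ (c : ℝ) (v), MemW0 g s Ω v → F (fun x => c * v x) = c * F v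
  bounded : ∃ C : ℝ≥0, ∀ v, MemW0 g s Ω v → ENNReal.ofReal |F v| ≤ C * normW g s v

/-- The order of the dual: `F ≤ H` iff `⟨F,v⟩ ≤ ⟨H,v⟩` for all `v ≥ 0` in `W^{s,G}_0(Ω)`. -/
def DualLE (g : E d → E d → ℝ → ℝ) (s : ℝ) (Ω : Set (E d)) (F H : (E d → ℝ) → ℝ) : Prop :=
  ∀ v, MemW0 g s Ω v → (∀ᵐ x, 0 ≤ v x) → F v ≤ H v

/-- `S = F ∨ H` in the ordered dual space `W^{-s,G^*}(Ω)` (least upper bound). -/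
def IsDualSup (g : E d → E d → ℝ → ℝ) (s : ℝ) (Ω : Set (E d))
    (F H S : (E d → ℝ) → ℝ) : Prop :=
  IsDual g s Ω S ∧ DualLE g s Ω F S ∧ DualLE g s Ω H S ∧
    ∀ T, IsDual g s Ω T → DualLE g s Ω F T → DualLE g s Ω H T → DualLE g s Ω S T

/-- The convex set `{v ∈ W^{s,G}_0(Ω) : v ≥ ψ a.e. in Ω}`. -/
def MemK (g : E d → E d → ℝ → ℝ) (s : ℝ) (Ω : Set (E d)) (ψ v : E d → ℝ) : Prop :=
  MemW0 g s Ω v ∧ ∀ᵐ x ∂(volume.restrict Ω), ψ x ≤ v x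

/-- `u` solves the one-obstacle problem with datum `f` and obstacle `ψ`. -/
def IsObstacleSol (g : E d → E d → ℝ → ℝ) (s : ℝ) (Ω : Set (E d)) (f ψ u : E d → ℝ) : Prop :=
  MemK g s Ω ψ u ∧ ∀ v, MemK g s Ω ψ v →
    0 ≤ opL g s u (fun x => v x - u x) - pairing Ω f (fun x => v x - u x)

/-- Admissible penalisation profiles `θ`. -/
structure IsPenalisation (θ : ℝ → ℝ) : Prop where
  lipschitz : ∃ K : ℝ≥0, LipschitzWith K θ
  mono : Monotone θ
  mem_Icc : ∀ t, θ t ∈ Icc (0 : ℝ) 1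
  eq_zero : ∀ t, t ≤ 0 → θ t = 0
  tendsto_one : Tendsto θ atTop (𝓝 1)
  decay : ∃ C : ℝ, 0 < C ∧ ∀ t, 0 < t → (1 - θ t) * t ≤ C

/-- `w` solves the penalised problem with parameter `ε`: `w ∈ W^{s,G}_0(Ω)` and
`⟨L_g^s w, v⟩ + ∫_Ω ζ θ((w - ψ)/ε) v = ∫_Ω (f + ζ) v` for all `v ∈ W^{s,G}_0(Ω)`. -/
def IsPenalSol (g : E d → E d → ℝ → ℝ) (s : ℝ) (Ω : Set (E d)) (f ψ ζ : E d → ℝ) (θ : ℝ → ℝ)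
    (ε : ℝ) (w : E d → ℝ) : Prop :=
  MemW0 g s Ω w ∧ ∀ v, MemW0 g s Ω v →
    opL g s w v + pairing Ω (fun x => ζ x * θ ((w x - ψ x) / ε)) v
      = pairing Ω (fun x => f x + ζ x) v

/-- Poincaré inequality `‖v‖_{L^Ĝ} ≤ C [v]_{s,G}` on `W^{s,G}_0(Ω)`. -/
def HasPoincare (g : E d → E d → ℝ → ℝ) (s : ℝ) (Ω : Set (E d)) : Prop :=
  ∃ C : ℝ≥0, ∀ v, MemW0 g s Ω v → normG g v ≤ C * seminormS g s v

end FracOrlicz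

end

open FracOrlicz

/-!
The space `W^{s,G}` enters only through its two modulars, the integrals of the Young functions
`Ĝ(x, ·)` over `ℝ^d` and of `G(x, y, ·) / |x - y|^d` over pairs of points. Both are instances of
`YoungFamily`: the structure conditions on `g` say that `r ↦ r g(r)` lies between two powers
(`IsProfile.isYoung`), whence doubling, Young's inequality, and a quantitative strict monotonicity
`IsYoung.le_gap` that yields uniform convexity. With the power growth, smallness of the Luxemburg
norm and smallness of the modular are equivalent, so norms occur only where the definitions force
them to (`memW0_iff`, `tendsto_normW_of_modW`).

*Order.* `W^{s,G}_0(Ω)` is a vector lattice and an order ideal in `W^{s,G}_0(ℝ^d)`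
(`MemW0.lattice`, `MemW0.of_le`), and `⟨L a - L b, (a - b)^+⟩ ≤ 0` forces `a ≤ b` as soon as
`(a - b)^+` vanishes off a bounded set: the integrand is nonnegative and vanishes only where the
difference quotient of `(a - b)^+` does (`ae_le_of_opL_le`). All comparisons below are
instances of this principle.

*The bounds on `L u`.* The lower bound `f ≤ L u` is the variational inequality tested with `u + v`,
`v ≥ 0`. For the upper bound fix a test function `φ ≥ 0` and solve the variational inequality with
the larger datum `f + ζ` on the order interval `[u - φ, u]`. Since `L ψ ≤ f + ζ`, comparison shows
that its solution lies above `ψ`, hence competes with `u` in the obstacle problem, hence equals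
`u`; testing with `u - φ` gives `⟨L u, φ⟩ ≤ ∫ (f + ζ) φ` (`IsObstacleSol.opL_le_pairing`). On an
order interval the direct method needs no Poincaré inequality, because the interval itself bounds
the linear term and dominates minimising sequences. The functional `L u - f` now lies between `0`
and `ζ`, so that the Riesz representation theorem in `L²(ζ dx)` makes it a function
(`exists_density_of_order_bounded`, `exists_density_opL`).

*The penalised problem.* Solutions are obtained as minimisers of a uniformly convex energy,
which exist as soon as the Poincaré inequality makes the energy coercive (`exists_isPenalSol`).
Comparison shows that they lie above `ψ` and above `u` and increase with `ε`; uniqueness is the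
case of equal parameters. The bound `(1 - θ(t)) t ≤ C` gives
`⟨L u_ε - L u, u_ε - u⟩ ≤ ε C ∫ ζ` (`opL_gap_le`), and by quantitative monotonicity the Gagliardo
modular of `u_ε - u` tends to zero. This implies convergence almost everywhere along a sequence,
since all functions vanish off the bounded set `Ω`; monotonicity in `ε` and domination by `u_1 - u`
turn it into convergence in `L^Ĝ` and in `L^q`.

*The exponent `q`.* Let `μ(t)` be the measure of `{|w| > t}` and `p = g_* + 1`. Pairs of points
from `{|w| > 2t}` and `{|w| ≤ t}`, in a ball of twice the volume of `{|w| > t}`, contribute so much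
to the Gagliardo modular that `μ(2t) ≤ C t^{-p} μ(t)^{sp/d}` (`exists_meas_lt_le`). When `sp < d`,
iterating this bound from `μ ≤ |Ω|` gives `μ(t) ≤ C t^{-α}` for every `α < dp/(d - sp)`
(`exists_decay_of_recursive`), and thus integrability with every exponent below that value.
-/

noncomputable section

namespace FracOrlicz

/-! ### Young functions with power growth -/

/-- `Φ` is an even Young function with odd, strictly increasing derivative `φ`, and its growth lies
between the powers `p + 1` and `q + 1`. The fields `tangent` and `scale_le` to `deriv_scale` are the
consequences of convexity and of the growth of `φ` that the theory of modulars runs on. -/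
structure IsYoung (p q : ℝ) (Φ φ : ℝ → ℝ) : Prop where
  zero : Φ 0 = 0
  even : ∀ a, Φ (-a) = Φ a
  odd : ∀ a, φ (-a) = -φ a
  strictMono : StrictMono φ
  cont : Continuous Φ
  cont_deriv : Continuous φ
  tangent : ∀ a b, φ b * (a - b) ≤ Φ a - Φ b
  deriv_mul_le : ∀ a, φ a * a ≤ (q + 1) * Φ a
  scale_le : ∀ l a, 1 ≤ l → Φ (l * a) ≤ l ^ (q + 1) * Φ a
  le_scale : ∀ l a, 1 ≤ l → l ^ (p + 1) * Φ a ≤ Φ (l * a)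
  deriv_scale : ∀ t a, 0 ≤ t → t ≤ 1 → 0 ≤ a → φ (t * a) ≤ t ^ p * φ a

/-- The growth condition integrated: `h r * r ^ (1 - gl)` increases and `h r * r ^ (1 - gu)`
decreases. As `h` is only Lipschitz, monotonicity comes from the fundamental theorem of calculus
for absolutely continuous functions. -/
theorem IsProfile.rpow_mul_le {gl gu kl ku : ℝ} {h : ℝ → ℝ} (hh : IsProfile gl gu kl ku h)
    {a b : ℝ} (ha : 0 < a) (hab : a ≤ b) :
    h a * a ^ (1 - gl) ≤ h b * b ^ (1 - gl) ∧ h b * b ^ (1 - gu) ≤ h a * a ^ (1 - gu) := by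
  have hsub : uIcc a b ⊆ Ioi 0 := by
    rw [uIcc_of_le hab]; intro x hx; exact lt_of_lt_of_le ha hx.1
  obtain ⟨K, hK⟩ := (hh.lipschitz.mono hsub).exists_lipschitzOnWith_of_compact isCompact_uIcc
  have hac := hK.absolutelyContinuousOnInterval
  have hpow : ∀ c : ℝ, AbsolutelyContinuousOnInterval (fun x => x ^ c) a b := by
    intro c
    have h1 : ContDiffOn ℝ 1 (fun x : ℝ => x ^ c) (uIcc a b) := by
      intro x hx
      exact (Real.contDiffAt_rpow_const_of_ne (hsub hx).ne').contDiffWithinAt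
    obtain ⟨K', hK'⟩ := h1.exists_lipschitzOnWith one_ne_zero (convex_uIcc a b) isCompact_uIcc
    exact hK'.absolutelyContinuousOnInterval
  have hgr : ∀ᵐ r ∂volume, r ∈ Ioc a b →
      gl ≤ r * deriv h r / h r + 1 ∧ r * deriv h r / h r + 1 ≤ gu := by
    have := (ae_restrict_iff' measurableSet_Ioi).1 hh.growth
    filter_upwards [this] with r hr hr2
    exact hr (lt_trans ha hr2.1)
  have hform : ∀ c : ℝ, ∀ r, 0 < r → deriv h r * r ^ c + h r * deriv (fun x : ℝ => x ^ c) r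
      = r ^ (c - 1) * h r * (r * deriv h r / h r + c) := by
    intro c r hr
    have := (hh.pos r hr).ne'
    rw [Real.deriv_rpow_const]
    have h2 : r ^ c = r ^ (c - 1) * r := by
      rw [← Real.rpow_add_one hr.ne']; ring_nf
    rw [h2]; field_simp
  constructor
  · have h1 := AbsolutelyContinuousOnInterval.integral_deriv_mul_eq_sub hac (hpow (1 - gl))
    have h2 : 0 ≤ ∫ x in a..b, deriv h x * x ^ (1 - gl)
        + h x * deriv (fun x : ℝ => x ^ (1 - gl)) x := by
      rw [intervalIntegral.integral_of_le hab]
      apply setIntegral_nonneg_of_ae_restrict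
      rw [EventuallyLE, ae_restrict_iff' measurableSet_Ioc]
      filter_upwards [hgr] with r hr hrm
      have hr0 : 0 < r := lt_trans ha hrm.1
      simp only [Pi.zero_apply]
      rw [hform _ r hr0]
      have := hh.pos r hr0
      have := (hr hrm).1
      have : 0 ≤ r * deriv h r / h r + (1 - gl) := by linarith
      positivity
    linarith
  · have h1 := AbsolutelyContinuousOnInterval.integral_deriv_mul_eq_sub hac (hpow (1 - gu))
    have h2 : 0 ≤ -∫ x in a..b, deriv h x * x ^ (1 - gu)
        + h x * deriv (fun x : ℝ => x ^ (1 - gu)) x := by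
      rw [intervalIntegral.integral_of_le hab, ← integral_neg]
      apply setIntegral_nonneg_of_ae_restrict
      rw [EventuallyLE, ae_restrict_iff' measurableSet_Ioc]
      filter_upwards [hgr] with r hr hrm
      have hr0 : 0 < r := lt_trans ha hrm.1
      simp only [Pi.zero_apply]
      rw [hform _ r hr0]
      have := hh.pos r hr0
      have := (hr hrm).2
      have : 0 ≤ -(r * deriv h r / h r + (1 - gu)) := by linarith
      rw [← mul_neg]
      positivity
    linarith

/-- The derivative `r ↦ r h(r)` of the Young function, in the form of a two-sided power law. -/
theorem IsProfile.mul_scale {gl gu kl ku : ℝ} {h : ℝ → ℝ} (hh : IsProfile gl gu kl ku h)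
    {t r : ℝ} (ht : 0 < t) (ht1 : t ≤ 1) (hr : 0 < r) :
    h (t * r) * (t * r) ≤ t ^ gl * (h r * r) ∧ t ^ gu * (h r * r) ≤ h (t * r) * (t * r) := by
  have htr : 0 < t * r := by positivity
  have hle : t * r ≤ r := by nlinarith
  obtain ⟨h1, h2⟩ := hh.rpow_mul_le htr hle
  have key : ∀ c : ℝ, (t * r) ^ (1 - c) = t * r * (t ^ (-c) * r ^ (-c)) := by
    intro c
    rw [sub_eq_add_neg, Real.rpow_add htr, Real.rpow_one, Real.mul_rpow ht.le hr.le]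
  have key2 : ∀ c : ℝ, r ^ (1 - c) = r * r ^ (-c) := by
    intro c
    rw [sub_eq_add_neg, Real.rpow_add hr, Real.rpow_one]
  have ht2 : ∀ c : ℝ, t ^ c * t ^ (-c) = 1 := by
    intro c; rw [← Real.rpow_add ht]; simp
  have hrc : ∀ c : ℝ, 0 < r ^ (-c) := fun c => Real.rpow_pos_of_pos hr _
  have htc : ∀ c : ℝ, 0 < t ^ c := fun c => Real.rpow_pos_of_pos ht _
  rw [key, key2] at h1 h2
  constructor
  · have h3 : (h (t * r) * (t * r) * t ^ (-gl)) * r ^ (-gl) ≤ (h r * r) * r ^ (-gl) := by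
      linarith
    have h4 := le_of_mul_le_mul_right h3 (hrc gl)
    calc h (t * r) * (t * r) = (h (t * r) * (t * r) * t ^ (-gl)) * t ^ gl := by
          rw [mul_assoc _ (t ^ (-gl)), mul_comm (t ^ (-gl)), ht2, mul_one]
      _ ≤ (h r * r) * t ^ gl := by gcongr
      _ = _ := by ring
  · have h3 : (h r * r) * r ^ (-gu) ≤ (h (t * r) * (t * r) * t ^ (-gu)) * r ^ (-gu) := by
      linarith
    have h4 := le_of_mul_le_mul_right h3 (hrc gu)
    calc t ^ gu * (h r * r) ≤ t ^ gu * (h (t * r) * (t * r) * t ^ (-gu)) := by gcongr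
      _ = (t ^ gu * t ^ (-gu)) * (h (t * r) * (t * r)) := by ring
      _ = _ := by rw [ht2, one_mul]

section OfProfile

variable {gl gu kl ku : ℝ} {h : ℝ → ℝ}

theorem IsProfile.odd_strictMono (hh : IsProfile gl gu kl ku h) (hgl : 0 < gl) :
    StrictMono (fun a => h |a| * a) := by
  have hpos : ∀ a b : ℝ, 0 ≤ a → a < b → h |a| * a < h |b| * b := by
    intro a b ha hab
    have hb : 0 < b := lt_of_le_of_lt ha hab
    have hhb : 0 < h b * b := mul_pos (hh.pos b hb) hb
    rw [abs_of_nonneg ha, abs_of_pos hb]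
    rcases ha.eq_or_lt with rfl | ha
    · simpa using hhb
    have h1 := (hh.mul_scale (t := a / b) (by positivity) ((div_le_one hb).2 hab.le) hb).1
    rw [div_mul_cancel₀ _ hb.ne'] at h1
    have h2 : (a / b) ^ gl < 1 :=
      Real.rpow_lt_one (by positivity) ((div_lt_one hb).2 hab) hgl
    nlinarith
  intro a b hab
  rcases le_total 0 a with ha | ha
  · exact hpos a b ha hab
  rcases le_total 0 b with hb | hb
  · rcases ha.eq_or_lt with rfl | ha'
    · exact hpos 0 b le_rfl hab
    · have h1 := hpos 0 (-a) le_rfl (by linarith)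
      have h2 : 0 ≤ h |b| * b := by
        rcases hb.eq_or_lt with rfl | hb'
        · simp
        · rw [abs_of_pos hb']; exact (mul_pos (hh.pos b hb') hb').le
      simp only [abs_neg] at h1
      simp only
      linarith
  · have h1 := hpos (-b) (-a) (by linarith) (by linarith)
    simp only [abs_neg] at h1
    simp only
    linarith

theorem IsProfile.odd_continuous (hh : IsProfile gl gu kl ku h) :
    Continuous (fun a => h |a| * a) := by
  have hc : ContinuousOn h (Ioi 0) := hh.lipschitz.continuousOn
  rw [continuous_iff_continuousAt]
  intro a
  by_cases ha : a = 0
  · subst ha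
    have h1 : Tendsto (fun a : ℝ => |a|) (𝓝[≠] 0) (𝓝[>] 0) := tendsto_abs_nhdsNE_zero
    have h2 := hh.tendsto_zero.comp h1
    have h3 : Tendsto (fun a => h |a| * a) (𝓝[≠] 0) (𝓝 0) := by
      rw [tendsto_zero_iff_norm_tendsto_zero] at h2 ⊢
      refine h2.congr fun x => ?_
      simp [mul_comm]
    rw [continuousAt_iff_punctured_nhds]
    simpa using h3
  · have h1 : ContinuousAt h |a| := hc.continuousAt (Ioi_mem_nhds (abs_pos.2 ha))
    exact (ContinuousAt.comp' h1 continuous_abs.continuousAt).mul continuousAt_id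

/-- The primitive of `ρ ↦ h ρ * ρ` is a Young function. The scaling of the derivative passes to the
primitive by the substitution `ρ ↦ l ρ` under the integral. -/
theorem IsProfile.isYoung (hh : IsProfile gl gu kl ku h) (hgl : 0 < gl) (hgu : gl ≤ gu) :
    IsYoung gl gu (fun a => ∫ ρ in (0 : ℝ)..|a|, h ρ * ρ) (fun a => h |a| * a) := by
  set φ : ℝ → ℝ := fun a => h |a| * a with hφ
  set Φ : ℝ → ℝ := fun a => ∫ ρ in (0 : ℝ)..|a|, h ρ * ρ with hΦ
  have hcont : Continuous φ := hh.odd_continuous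
  have hmono : StrictMono φ := hh.odd_strictMono hgl
  have hodd : ∀ a, φ (-a) = -φ a := fun a => by simp [hφ]
  have hzero : φ 0 = 0 := by simp [hφ]
  have hnn : ∀ a, 0 ≤ a → 0 ≤ φ a := fun a ha => hzero ▸ hmono.monotone ha
  have hint : ∀ a b, IntervalIntegrable φ volume a b := fun a b => hcont.intervalIntegrable a b
  have hΦnn : ∀ a, 0 ≤ a → Φ a = ∫ ρ in (0 : ℝ)..a, φ ρ := by
    intro a ha
    simp only [hΦ, abs_of_nonneg ha]
    refine intervalIntegral.integral_congr fun ρ hρ => ?_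
    rw [uIcc_of_le ha] at hρ
    simp only [hφ, abs_of_nonneg hρ.1]
  have heven : ∀ a, Φ (-a) = Φ a := fun a => by simp [hΦ]
  have hΦ' : ∀ a, Φ a = ∫ ρ in (0 : ℝ)..a, φ ρ := by
    intro a
    rcases le_total 0 a with ha | ha
    · exact hΦnn a ha
    · rw [← heven, hΦnn (-a) (by linarith)]
      have := intervalIntegral.integral_comp_neg (a := 0) (b := a) φ
      rw [neg_zero] at this
      rw [intervalIntegral.integral_symm, ← this, ← intervalIntegral.integral_neg]
      simp [hodd]
  have hscale : ∀ t a, 0 ≤ t → t ≤ 1 → 0 ≤ a → φ (t * a) ≤ t ^ gl * φ a := by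
    intro t a ht ht1 ha
    rcases ht.eq_or_lt with rfl | ht
    · simp [hzero, Real.zero_rpow hgl.ne']
    rcases ha.eq_or_lt with rfl | ha
    · simp [hzero]
    have := (hh.mul_scale ht ht1 ha).1
    simpa only [hφ, abs_of_pos ha, abs_of_pos (mul_pos ht ha)] using this
  have hscale2 : ∀ t a, 0 ≤ t → t ≤ 1 → 0 ≤ a → t ^ gu * φ a ≤ φ (t * a) := by
    intro t a ht ht1 ha
    rcases ht.eq_or_lt with rfl | ht
    · simp [hzero, Real.zero_rpow (lt_of_lt_of_le hgl hgu).ne']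
    rcases ha.eq_or_lt with rfl | ha
    · simp [hzero]
    have := (hh.mul_scale ht ht1 ha).2
    simpa only [hφ, abs_of_pos ha, abs_of_pos (mul_pos ht ha)] using this
  have hsub : ∀ l a : ℝ, Φ (l * a) = l * ∫ ρ in (0 : ℝ)..a, φ (l * ρ) := by
    intro l a
    rw [hΦ' (l * a), intervalIntegral.mul_integral_comp_mul_left, mul_zero]
  have habs : ∀ a, Φ |a| = Φ a := fun a => by simp [hΦ]
  have hup : ∀ l a, 1 ≤ l → 0 ≤ a → Φ (l * a) ≤ l ^ (gu + 1) * Φ a := by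
    intro l a hl ha
    have hl0 : 0 < l := by linarith
    rw [hsub, hΦ' a, Real.rpow_add_one hl0.ne', mul_comm (l ^ gu), mul_assoc]
    gcongr
    rw [← intervalIntegral.integral_const_mul]
    refine intervalIntegral.integral_mono_on ha
      (Continuous.intervalIntegrable (by fun_prop) _ _)
      (Continuous.intervalIntegrable (by fun_prop) _ _) fun ρ hρ => ?_
    have h1 := hscale2 l⁻¹ (l * ρ) (by positivity) (inv_le_one_of_one_le₀ hl)
      (mul_nonneg hl0.le hρ.1)
    rw [inv_mul_cancel_left₀ hl0.ne', Real.inv_rpow hl0.le,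
      inv_mul_le_iff₀ (Real.rpow_pos_of_pos hl0 _)] at h1
    exact h1
  have hlow : ∀ l a, 1 ≤ l → 0 ≤ a → l ^ (gl + 1) * Φ a ≤ Φ (l * a) := by
    intro l a hl ha
    have hl0 : 0 < l := by linarith
    rw [hsub, hΦ' a, Real.rpow_add_one hl0.ne', mul_comm (l ^ gl), mul_assoc]
    gcongr
    rw [← intervalIntegral.integral_const_mul]
    refine intervalIntegral.integral_mono_on ha
      (Continuous.intervalIntegrable (by fun_prop) _ _)
      (Continuous.intervalIntegrable (by fun_prop) _ _) fun ρ hρ => ?_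
    have h1 := hscale l⁻¹ (l * ρ) (by positivity) (inv_le_one_of_one_le₀ hl)
      (mul_nonneg hl0.le hρ.1)
    rw [inv_mul_cancel_left₀ hl0.ne', Real.inv_rpow hl0.le,
      le_inv_mul_iff₀ (Real.rpow_pos_of_pos hl0 _)] at h1
    exact h1
  have hmul : ∀ a, 0 ≤ a → φ a * a ≤ (gu + 1) * Φ a := by
    intro a ha
    have h1 : Φ a = a * ∫ t in (0 : ℝ)..1, φ (t * a) := by
      have := hsub a 1
      rw [mul_one] at this
      simpa only [mul_comm] using this
    have h2 : ∫ t in (0 : ℝ)..1, t ^ gu * φ a = φ a / (gu + 1) := by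
      rw [intervalIntegral.integral_mul_const, integral_rpow (Or.inl (by linarith))]
      rw [Real.one_rpow, Real.zero_rpow (by linarith)]; ring
    have h3 : φ a / (gu + 1) ≤ ∫ t in (0 : ℝ)..1, φ (t * a) := by
      rw [← h2]
      refine intervalIntegral.integral_mono_on zero_le_one ?_
        (Continuous.intervalIntegrable (by fun_prop) _ _)
        fun t ht => hscale2 t a ht.1 ht.2 ha
      exact (intervalIntegral.intervalIntegrable_rpow' (by linarith)).mul_const _
    rw [div_le_iff₀ (by linarith)] at h3
    rw [h1]
    nlinarith
  have hl1 : ∀ l a : ℝ, 1 ≤ l → |l * a| = l * |a| := fun l a hl => by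
    rw [abs_mul, abs_of_nonneg (by linarith : (0 : ℝ) ≤ l)]
  refine ⟨by simp [hΦ], heven, hodd, hmono, ?_, hcont, ?_, ?_, ?_, ?_, hscale⟩
  · have : Φ = fun a => ∫ ρ in (0 : ℝ)..a, φ ρ := funext hΦ'
    rw [this]
    exact intervalIntegral.continuous_primitive hint 0
  · intro a b
    have h1 : Φ a - Φ b = ∫ ρ in b..a, φ ρ := by
      rw [hΦ' a, hΦ' b, intervalIntegral.integral_interval_sub_left (hint _ _) (hint _ _)]
    rw [h1]
    rcases le_total b a with hab | hab
    · have := intervalIntegral.integral_mono_on hab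
        (Continuous.intervalIntegrable (continuous_const (y := φ b)) _ _) (hint b a)
        fun ρ hρ => hmono.monotone hρ.1
      simpa [mul_comm] using this
    · have := intervalIntegral.integral_mono_on hab (hint a b)
        (Continuous.intervalIntegrable (continuous_const (y := φ b)) _ _)
        fun ρ hρ => hmono.monotone hρ.2
      rw [intervalIntegral.integral_symm]
      simp only [intervalIntegral.integral_const, smul_eq_mul] at this
      linarith
  · intro a
    have := hmul |a| (abs_nonneg a)
    rw [habs] at this
    have h2 : φ |a| * |a| = φ a * a := by
      simp only [hφ, abs_abs, mul_assoc, abs_mul_abs_self]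
    rwa [h2] at this
  · intro l a hl
    rw [← habs, hl1 l a hl, ← habs a]
    exact hup l |a| hl (abs_nonneg a)
  · intro l a hl
    rw [← habs (l * a), hl1 l a hl, ← habs a]
    exact hlow l |a| hl (abs_nonneg a)

end OfProfile

namespace IsYoung

variable {p q : ℝ} {Φ φ : ℝ → ℝ}

theorem deriv_zero (hY : IsYoung p q Φ φ) : φ 0 = 0 := by
  have := hY.odd 0
  rw [neg_zero] at this
  linarith

theorem nonneg (hY : IsYoung p q Φ φ) (a : ℝ) : 0 ≤ Φ a := by
  have := hY.tangent a 0
  rw [hY.deriv_zero, hY.zero] at this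
  linarith

theorem deriv_nonneg (hY : IsYoung p q Φ φ) {a : ℝ} (ha : 0 ≤ a) : 0 ≤ φ a :=
  hY.deriv_zero ▸ hY.strictMono.monotone ha

theorem abs_eq (hY : IsYoung p q Φ φ) (a : ℝ) : Φ |a| = Φ a := by
  rcases abs_choice a with h | h <;> rw [h]
  exact hY.even a

theorem mono (hY : IsYoung p q Φ φ) {a b : ℝ} (h : |a| ≤ |b|) : Φ a ≤ Φ b := by
  rw [← hY.abs_eq a, ← hY.abs_eq b]
  have := hY.tangent |b| |a|
  have := mul_nonneg (hY.deriv_nonneg (abs_nonneg a)) (sub_nonneg.2 h)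
  linarith

theorem pos (hY : IsYoung p q Φ φ) {a : ℝ} (ha : a ≠ 0) : 0 < Φ a := by
  rw [← hY.abs_eq a]
  have ha' : 0 < |a| := abs_pos.2 ha
  have h1 := hY.tangent |a| (|a| / 2)
  have h2 : 0 < φ (|a| / 2) := hY.deriv_zero ▸ hY.strictMono (by linarith : 0 < |a| / 2)
  have h3 := hY.nonneg (|a| / 2)
  nlinarith

theorem le_deriv_mul (hY : IsYoung p q Φ φ) (a : ℝ) : Φ a ≤ φ a * a := by
  have := hY.tangent 0 a
  rw [hY.zero] at this
  linarith

theorem add_le (hY : IsYoung p q Φ φ) (a b : ℝ) :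
    Φ (a + b) ≤ 2 ^ (q + 1) * (Φ a + Φ b) := by
  have h2 : (0 : ℝ) ≤ 2 ^ (q + 1) := by positivity
  have h3 := mul_nonneg h2 (hY.nonneg a)
  have h4 := mul_nonneg h2 (hY.nonneg b)
  rcases le_total |a| |b| with h | h
  · have h1 : Φ (a + b) ≤ Φ (2 * b) := hY.mono (by
      have := abs_add_le a b
      rw [abs_mul, abs_two]; linarith)
    have := hY.scale_le 2 b one_le_two
    rw [mul_add]; linarith
  · have h1 : Φ (a + b) ≤ Φ (2 * a) := hY.mono (by
      have := abs_add_le a b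
      rw [abs_mul, abs_two]; linarith)
    have := hY.scale_le 2 a one_le_two
    rw [mul_add]; linarith

theorem scale_small (hY : IsYoung p q Φ φ) (hp : 0 < p) {t : ℝ} (a : ℝ) (ht : 0 ≤ t)
    (ht1 : t ≤ 1) : Φ (t * a) ≤ t ^ (p + 1) * Φ a := by
  rcases ht.eq_or_lt with rfl | ht
  · rw [zero_mul, hY.zero, Real.zero_rpow (by linarith), zero_mul]
  · have := hY.le_scale t⁻¹ (t * a) ((one_le_inv₀ ht).2 ht1)
    rwa [inv_mul_cancel_left₀ ht.ne', Real.inv_rpow ht.le,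
      inv_mul_le_iff₀ (Real.rpow_pos_of_pos ht _)] at this

theorem scale_small' (hY : IsYoung p q Φ φ) (hp : 0 < p) {t : ℝ} (a : ℝ) (ht : 0 ≤ t)
    (ht1 : t ≤ 1) : Φ (t * a) ≤ t * Φ a := by
  refine (hY.scale_small hp a ht ht1).trans ?_
  have := Real.rpow_le_rpow_of_exponent_ge' ht ht1 zero_le_one (by linarith : (1 : ℝ) ≤ p + 1)
  rw [Real.rpow_one] at this
  exact mul_le_mul_of_nonneg_right this (hY.nonneg a)

theorem abs_deriv (hY : IsYoung p q Φ φ) (a : ℝ) : |φ a| = φ |a| := by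
  rcases le_total 0 a with h | h
  · rw [abs_of_nonneg h, abs_of_nonneg (hY.deriv_nonneg h)]
  · have := hY.deriv_nonneg (neg_nonneg.2 h)
    rw [hY.odd] at this
    rw [abs_of_nonpos h, hY.odd, abs_of_nonpos (by linarith)]

theorem abs_deriv_mul_le (hY : IsYoung p q Φ φ) (hq : 0 < q) (a b : ℝ) :
    |φ a * b| ≤ (q + 1) * (Φ a + Φ b) := by
  rw [abs_mul, hY.abs_deriv]
  have ha := hY.deriv_mul_le |a|
  have hb := hY.deriv_mul_le |b|
  rw [hY.abs_eq] at ha hb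
  have ha' := mul_nonneg (by linarith : 0 ≤ q + 1) (hY.nonneg a)
  have hb' := mul_nonneg (by linarith : 0 ≤ q + 1) (hY.nonneg b)
  rcases le_total |a| |b| with h | h
  · have h1 : φ |a| * |b| ≤ φ |b| * |b| :=
      mul_le_mul_of_nonneg_right (hY.strictMono.monotone h) (abs_nonneg b)
    rw [mul_add]; linarith
  · have h1 : φ |a| * |b| ≤ φ |a| * |a| :=
      mul_le_mul_of_nonneg_left h (hY.deriv_nonneg (abs_nonneg a))
    rw [mul_add]; linarith

theorem gap_nonneg (hY : IsYoung p q Φ φ) (a b : ℝ) : 0 ≤ (φ a - φ b) * (a - b) := by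
  rcases le_total a b with h | h
  · have := hY.strictMono.monotone h
    nlinarith
  · have := hY.strictMono.monotone h
    nlinarith

/-- The constant of `IsYoung.le_gap`. -/
def gapConst (p q η : ℝ) : ℝ := 2 ^ (q + 1) / ((1 - (1 - η) ^ p) * η)

theorem gapConst_nonneg (p q : ℝ) {η : ℝ} (hp : 0 < p) (hη : 0 < η) (hη1 : η ≤ 1) :
    0 ≤ gapConst p q η := by
  have : (1 - η) ^ p ≤ 1 := Real.rpow_le_one (by linarith) (by linarith) hp.le
  unfold gapConst
  have : 0 ≤ 1 - (1 - η) ^ p := by linarith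
  positivity

/-- Quantitative strict monotonicity of the derivative: if `a` and `b` differ by more than a small
fraction of their size, then the monotonicity gap is comparable with `Φ` of their size. -/
theorem le_gap (hY : IsYoung p q Φ φ) (hp : 0 < p) {η : ℝ} (hη : 0 < η)
    (hη1 : η ≤ 1) (a b : ℝ) :
    Φ (a - b) ≤ gapConst p q η * ((φ a - φ b) * (a - b)) + η * (Φ a + Φ b) := by
  wlog hab : |b| ≤ |a| generalizing a b
  · have := this b a (le_of_not_ge hab)
    rw [← neg_sub, hY.even] at this
    linarith
  wlog ha : 0 ≤ a generalizing a b
  · have := this (-a) (-b) (by simpa using hab) (by linarith)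
    rw [hY.odd, hY.odd, hY.even, hY.even, ← neg_sub', hY.even] at this
    linarith
  have hC := gapConst_nonneg p q hp hη hη1
  have hg := mul_nonneg hC (hY.gap_nonneg a b)
  have hΦa := hY.nonneg a
  have hΦb := hY.nonneg b
  rw [abs_of_nonneg ha] at hab
  obtain ⟨hab1, hab2⟩ := abs_le.1 hab
  -- Either `a - b` is small against `a`, and `Φ (a - b)` is a small multiple of `Φ a`, or
  -- `b ≤ (1 - η) a`, and the power law separates `φ b` from `φ a`.
  by_cases hcase : a - b ≤ η * a
  · have h1 : Φ (a - b) ≤ Φ (η * a) := hY.mono (by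
      rw [abs_of_nonneg (by linarith), abs_of_nonneg (by positivity)]; exact hcase)
    have h2 := hY.scale_small' hp a hη.le hη1
    nlinarith
  · push Not at hcase
    have ha0 : 0 < a := by
      rcases ha.eq_or_lt with rfl | h
      · exfalso; linarith
      · exact h
    have h1 : Φ (a - b) ≤ Φ (2 * a) := hY.mono (by
      rw [abs_of_nonneg (by linarith), abs_of_nonneg (by positivity)]; linarith)
    have h2 := hY.scale_le 2 a one_le_two
    have h3 := hY.le_deriv_mul a
    have h4 : φ b ≤ φ ((1 - η) * a) := hY.strictMono.monotone (by linarith)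
    have h5 := hY.deriv_scale (1 - η) a (by linarith) (by linarith) ha
    have h6 : 0 < φ a := hY.deriv_zero ▸ hY.strictMono ha0
    have h7 : (1 - η) ^ p < 1 := Real.rpow_lt_one (by linarith) (by linarith) hp
    have h8 : (1 - (1 - η) ^ p) * η * (φ a * a) ≤ (φ a - φ b) * (a - b) := by
      have h9 : (1 - (1 - η) ^ p) * φ a ≤ φ a - φ b := by linarith
      have h10 : 0 ≤ (1 - (1 - η) ^ p) * φ a := mul_nonneg (by linarith) h6.le
      calc (1 - (1 - η) ^ p) * η * (φ a * a) = ((1 - (1 - η) ^ p) * φ a) * (η * a) := by ring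
        _ ≤ (φ a - φ b) * (a - b) := mul_le_mul h9 hcase.le (by positivity) (by linarith)
    have h11 : 0 < (1 - (1 - η) ^ p) * η := mul_pos (by linarith) hη
    have h12 : 2 ^ (q + 1) * (φ a * a) ≤ gapConst p q η * ((φ a - φ b) * (a - b)) := by
      unfold gapConst
      rw [div_mul_eq_mul_div, le_div_iff₀ h11]
      have : (0 : ℝ) ≤ 2 ^ (q + 1) := by positivity
      nlinarith
    have h13 : 2 ^ (q + 1) * Φ a ≤ 2 ^ (q + 1) * (φ a * a) :=
      mul_le_mul_of_nonneg_left h3 (by positivity)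
    have h14 : 0 ≤ η * (Φ a + Φ b) := by positivity
    linarith

/-- Uniform convexity: the midpoint convexity gap controls `Φ (a - b)`, up to a small multiple of
`Φ a + Φ b`. The gap dominates the monotonicity gap between the quarter point `(3a + b)/4` and the
midpoint. -/
theorem le_midpoint_gap (hY : IsYoung p q Φ φ) (hp : 0 < p) {η : ℝ}
    (hη : 0 < η) (hη1 : η ≤ 1) (a b : ℝ) :
    Φ (a - b) ≤ 4 ^ (q + 1) * (gapConst p q η * (Φ a + Φ b - 2 * Φ ((a + b) / 2))
      + 2 * η * (Φ a + Φ b)) := by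
  set m := (a + b) / 2 with hm
  set c := (a + m) / 2 with hc
  have hC := gapConst_nonneg p q hp hη hη1
  have h1 := hY.tangent a c
  have h2 := hY.tangent c m
  have h3 := hY.tangent b m
  have hcm : c - m = (a - b) / 4 := by rw [hc, hm]; ring
  have hac : a - c = (a - b) / 4 := by rw [hc, hm]; ring
  have hbm : b - m = -((a - b) / 2) := by rw [hm]; ring
  have h4 : (φ c - φ m) * (c - m) ≤ Φ a + Φ b - 2 * Φ m := by
    rw [hac] at h1; rw [hbm] at h3; rw [hcm] at h2 ⊢
    linarith
  have h5 := hY.le_gap hp hη hη1 c m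
  have h6 := hY.scale_le 4 (c - m) (by norm_num)
  rw [hcm] at h6
  rw [show 4 * ((a - b) / 4) = a - b by ring, ← hcm] at h6
  have hmle : |m| ≤ max |a| |b| := by
    rw [hm, abs_div, abs_two]
    have := abs_add_le a b
    have := le_max_left |a| |b|
    have := le_max_right |a| |b|
    linarith
  have hcle : |c| ≤ max |a| |b| := by
    rw [hc, abs_div, abs_two]
    have := abs_add_le a m
    have := le_max_left |a| |b|
    linarith
  have hmax : ∀ z, |z| ≤ max |a| |b| → Φ z ≤ Φ a + Φ b := by
    intro z hz
    have := hY.nonneg a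
    have := hY.nonneg b
    rcases le_max_iff.1 hz with h | h
    · have := hY.mono h; linarith
    · have := hY.mono h; linarith
  have h7 := hmax c hcle
  have h8 := hmax m hmle
  refine h6.trans (mul_le_mul_of_nonneg_left ?_ (by positivity))
  refine h5.trans (add_le_add (mul_le_mul_of_nonneg_left h4 hC) ?_)
  nlinarith

theorem const_mul (hY : IsYoung p q Φ φ) {c : ℝ} (hc : 0 < c) :
    IsYoung p q (fun a => c * Φ a) (fun a => c * φ a) where
  zero := by simp [hY.zero]
  even a := by rw [hY.even]
  odd a := by rw [hY.odd]; ring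
  strictMono := hY.strictMono.const_mul hc
  cont := hY.cont.const_mul c
  cont_deriv := hY.cont_deriv.const_mul c
  tangent a b := by have := hY.tangent a b; nlinarith
  deriv_mul_le a := by have := hY.deriv_mul_le a; nlinarith
  scale_le l a hl := by have := hY.scale_le l a hl; nlinarith
  le_scale l a hl := by have := hY.le_scale l a hl; nlinarith
  deriv_scale t a h0 h1 ha := by have := hY.deriv_scale t a h0 h1 ha; nlinarith

end IsYoung

/-! ### Modulars of families of Young functions -/

/-- A measurable family of Young functions `Φ x` with derivatives `φ x` over a measure space. -/
structure YoungFamily {X : Type*} [MeasurableSpace X] (μ : Measure X) (p q : ℝ)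
    (Φ φ : X → ℝ → ℝ) : Prop where
  p_pos : 0 < p
  le : p ≤ q
  young : ∀ᵐ x ∂μ, IsYoung p q (Φ x) (φ x)
  measurable : Measurable (fun z : X × ℝ => Φ z.1 z.2)
  measurable_deriv : Measurable (fun z : X × ℝ => φ z.1 z.2)

/-- The modular `∫ Φ(x, z(x)) dμ(x)`. -/
def modular {X : Type*} [MeasurableSpace X] (μ : Measure X) (Φ : X → ℝ → ℝ) (z : X → ℝ) : ℝ≥0∞ :=
  ∫⁻ x, ENNReal.ofReal (Φ x (z x)) ∂μ

namespace YoungFamily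

variable {X : Type*} [MeasurableSpace X] {μ : Measure X} {p q : ℝ} {Φ φ : X → ℝ → ℝ}

theorem q_pos (F : YoungFamily μ p q Φ φ) : 0 < q := F.p_pos.trans_le F.le

theorem aemeasurable_comp (F : YoungFamily μ p q Φ φ) {z : X → ℝ} (hz : AEMeasurable z μ) :
    AEMeasurable (fun x => Φ x (z x)) μ :=
  F.measurable.comp_aemeasurable (aemeasurable_id.prodMk hz)

theorem aemeasurable_deriv_comp (F : YoungFamily μ p q Φ φ) {z : X → ℝ} (hz : AEMeasurable z μ) :
    AEMeasurable (fun x => φ x (z x)) μ :=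
  F.measurable_deriv.comp_aemeasurable (aemeasurable_id.prodMk hz)

theorem modular_mono (F : YoungFamily μ p q Φ φ) {z w : X → ℝ} (h : ∀ᵐ x ∂μ, |z x| ≤ |w x|) :
    modular μ Φ z ≤ modular μ Φ w := by
  apply lintegral_mono_ae
  filter_upwards [h, F.young] with x hx hY
  exact ENNReal.ofReal_le_ofReal (hY.mono hx)

theorem modular_congr (F : YoungFamily μ p q Φ φ) {z w : X → ℝ} (h : ∀ᵐ x ∂μ, z x = w x) :
    modular μ Φ z = modular μ Φ w :=
  le_antisymm (F.modular_mono (h.mono fun x hx => by rw [hx]))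
    (F.modular_mono (h.mono fun x hx => by rw [hx]))

theorem modular_add_le (F : YoungFamily μ p q Φ φ) {z : X → ℝ} (w : X → ℝ)
    (hz : AEMeasurable z μ) :
    modular μ Φ (fun x => z x + w x) ≤
      ENNReal.ofReal (2 ^ (q + 1)) * (modular μ Φ z + modular μ Φ w) := by
  unfold modular
  rw [← lintegral_add_left' (F.aemeasurable_comp hz).ennreal_ofReal,
    ← lintegral_const_mul' _ _ ENNReal.ofReal_ne_top]
  apply lintegral_mono_ae
  filter_upwards [F.young] with x hY
  rw [← ENNReal.ofReal_add (hY.nonneg _) (hY.nonneg _), ← ENNReal.ofReal_mul (by positivity)]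
  exact ENNReal.ofReal_le_ofReal (hY.add_le _ _)

theorem modular_scale_le (F : YoungFamily μ p q Φ φ) {l : ℝ} (hl : 1 ≤ l) (z : X → ℝ) :
    modular μ Φ (fun x => l * z x) ≤ ENNReal.ofReal (l ^ (q + 1)) * modular μ Φ z := by
  unfold modular
  rw [← lintegral_const_mul' _ _ ENNReal.ofReal_ne_top]
  apply lintegral_mono_ae
  filter_upwards [F.young] with x hY
  rw [← ENNReal.ofReal_mul (by positivity)]
  exact ENNReal.ofReal_le_ofReal (hY.scale_le l _ hl)

theorem modular_scale_small (F : YoungFamily μ p q Φ φ) {t : ℝ} (ht : 0 ≤ t) (ht1 : t ≤ 1)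
    (z : X → ℝ) :
    modular μ Φ (fun x => t * z x) ≤ ENNReal.ofReal (t ^ (p + 1)) * modular μ Φ z := by
  unfold modular
  rw [← lintegral_const_mul' _ _ ENNReal.ofReal_ne_top]
  apply lintegral_mono_ae
  filter_upwards [F.young] with x hY
  rw [← ENNReal.ofReal_mul (by positivity)]
  exact ENNReal.ofReal_le_ofReal (hY.scale_small F.p_pos _ ht ht1)

theorem modular_neg (F : YoungFamily μ p q Φ φ) (z : X → ℝ) :
    modular μ Φ (fun x => -z x) = modular μ Φ z :=
  le_antisymm (F.modular_mono (by simp)) (F.modular_mono (by simp))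

theorem modular_abs (F : YoungFamily μ p q Φ φ) (z : X → ℝ) :
    modular μ Φ (fun x => |z x|) = modular μ Φ z :=
  le_antisymm (F.modular_mono (by simp)) (F.modular_mono (by simp))

theorem modular_sub_le (F : YoungFamily μ p q Φ φ) {z : X → ℝ} (w : X → ℝ)
    (hz : AEMeasurable z μ) :
    modular μ Φ (fun x => z x - w x) ≤
      ENNReal.ofReal (2 ^ (q + 1)) * (modular μ Φ z + modular μ Φ w) := by
  have := F.modular_add_le (fun x => -w x) hz
  rw [F.modular_neg] at this
  exact this

theorem modular_add_lt_top (F : YoungFamily μ p q Φ φ) {z w : X → ℝ} (hz : AEMeasurable z μ)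
    (h1 : modular μ Φ z < ⊤) (h2 : modular μ Φ w < ⊤) :
    modular μ Φ (fun x => z x + w x) < ⊤ :=
  (F.modular_add_le w hz).trans_lt (ENNReal.mul_lt_top ENNReal.ofReal_lt_top
    (ENNReal.add_lt_top.2 ⟨h1, h2⟩))

theorem modular_sub_lt_top (F : YoungFamily μ p q Φ φ) {z w : X → ℝ} (hz : AEMeasurable z μ)
    (h1 : modular μ Φ z < ⊤) (h2 : modular μ Φ w < ⊤) :
    modular μ Φ (fun x => z x - w x) < ⊤ :=
  (F.modular_sub_le w hz).trans_lt (ENNReal.mul_lt_top ENNReal.ofReal_lt_top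
    (ENNReal.add_lt_top.2 ⟨h1, h2⟩))

theorem modular_const_mul_lt_top (F : YoungFamily μ p q Φ φ) {z : X → ℝ} (c : ℝ)
    (h1 : modular μ Φ z < ⊤) : modular μ Φ (fun x => c * z x) < ⊤ := by
  have h2 : modular μ Φ (fun x => c * z x) ≤ modular μ Φ (fun x => max 1 |c| * z x) := by
    apply F.modular_mono
    filter_upwards with x
    rw [abs_mul, abs_mul, abs_of_pos (lt_max_of_lt_left zero_lt_one)]
    gcongr
    exact le_max_right _ _
  exact (h2.trans (F.modular_scale_le (le_max_left _ _) z)).trans_lt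
    (ENNReal.mul_lt_top ENNReal.ofReal_lt_top h1)

/-- Dominated convergence in the modular, where the dominating functions `|y n| + |Y|` may vary as
long as the modular of the varying part tends to zero. -/
theorem tendsto_modular_zero (F : YoungFamily μ p q Φ φ) {w y : ℕ → X → ℝ} {Y : X → ℝ}
    (hw : ∀ n, AEMeasurable (w n) μ) (hy : ∀ n, AEMeasurable (y n) μ)
    (hlim : ∀ᵐ x ∂μ, Tendsto (fun n => w n x) atTop (𝓝 0))
    (hle : ∀ n, ∀ᵐ x ∂μ, |w n x| ≤ |y n x| + |Y x|)
    (hy0 : Tendsto (fun n => modular μ Φ (y n)) atTop (𝓝 0))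
    (hYfin : modular μ Φ Y < ⊤) :
    Tendsto (fun n => modular μ Φ (w n)) atTop (𝓝 0) := by
  set K := ENNReal.ofReal (2 ^ (q + 1)) with hK
  have hKt : K ≠ ⊤ := ENNReal.ofReal_ne_top
  set f : ℕ → X → ℝ≥0∞ := fun n x => ENNReal.ofReal (Φ x (w n x)) with hf
  set g : ℕ → X → ℝ≥0∞ := fun n x => K * ENNReal.ofReal (Φ x (y n x)) with hg
  set b : X → ℝ≥0∞ := fun x => K * ENNReal.ofReal (Φ x (Y x)) with hb
  have hfm : ∀ n, AEMeasurable (f n) μ := fun n => (F.aemeasurable_comp (hw n)).ennreal_ofReal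
  have hgm : ∀ n, AEMeasurable (g n) μ := fun n =>
    (F.aemeasurable_comp (hy n)).ennreal_ofReal.const_mul K
  have hfg : ∀ n, ∀ᵐ x ∂μ, f n x ≤ g n x + b x := by
    intro n
    filter_upwards [hle n, F.young] with x hx hY
    simp only [hf, hg, hb]
    rw [← mul_add, ← ENNReal.ofReal_add (hY.nonneg _) (hY.nonneg _), hK,
      ← ENNReal.ofReal_mul (by positivity)]
    apply ENNReal.ofReal_le_ofReal
    have h1 := hY.add_le |y n x| |Y x|
    rw [hY.abs_eq, hY.abs_eq] at h1
    refine le_trans (hY.mono ?_) h1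
    rwa [abs_of_nonneg (by positivity : 0 ≤ |y n x| + |Y x|)]
  -- The truncated difference `f n - g n` is dominated by the fixed function `b`.
  have h1 : Tendsto (fun n => ∫⁻ x, (f n x - g n x) ∂μ) atTop (𝓝 (∫⁻ _, 0 ∂μ)) := by
    refine tendsto_lintegral_of_dominated_convergence' b (fun n => (hfm n).sub (hgm n))
      (fun n => ?_) ?_ ?_
    · filter_upwards [hfg n] with x hx
      exact tsub_le_iff_left.2 hx
    · rw [lintegral_const_mul' _ _ hKt]
      exact (ENNReal.mul_lt_top hKt.lt_top hYfin).ne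
    · filter_upwards [hlim, F.young] with x hx hY
      have h2 : Tendsto (fun n => f n x) atTop (𝓝 0) := by
        have := (hY.cont.tendsto 0).comp hx
        rw [hY.zero] at this
        have := ENNReal.tendsto_ofReal this
        rwa [ENNReal.ofReal_zero] at this
      exact tendsto_of_tendsto_of_tendsto_of_le_of_le tendsto_const_nhds h2
        (fun n => zero_le) (fun n => tsub_le_self)
  rw [lintegral_zero] at h1
  have h2 : Tendsto (fun n => K * modular μ Φ (y n)) atTop (𝓝 0) := by
    have := ENNReal.Tendsto.const_mul hy0 (Or.inr hKt)
    rwa [mul_zero] at this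
  have h3 := h1.add h2
  rw [add_zero] at h3
  refine tendsto_of_tendsto_of_tendsto_of_le_of_le tendsto_const_nhds h3
    (fun n => zero_le) (fun n => ?_)
  simp only [modular]
  rw [← lintegral_const_mul' _ _ hKt, ← lintegral_add_right' _ (hgm n)]
  exact lintegral_mono fun x => le_tsub_add

/-- A rate of decay of the modular that forces convergence almost everywhere: even after scaling
by `2 ^ n` the modulars remain summable. -/
def rate (q : ℝ) (n : ℕ) : ℝ := ((2 : ℝ) ^ n) ^ (-(q + 1)) * (1 / 2) ^ n

theorem rate_pos (q : ℝ) (n : ℕ) : 0 < rate q n := by unfold rate; positivity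

/-- If the modulars of `z n` decay at the rate `rate q n`, then `z n` is eventually at most
`2 ^ (-n)`, almost everywhere. -/
theorem ae_eventually_le (F : YoungFamily μ p q Φ φ) {z : ℕ → X → ℝ}
    (hz : ∀ n, AEMeasurable (z n) μ)
    (h : ∀ n, modular μ Φ (z n) ≤ ENNReal.ofReal (rate q n)) :
    ∀ᵐ x ∂μ, ∀ᶠ n in atTop, |z n x| ≤ (1 / 2) ^ n := by
  have h1 : ∀ n, modular μ Φ (fun x => 2 ^ n * z n x) ≤ ENNReal.ofReal ((1 / 2) ^ n) := by
    intro n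
    refine (F.modular_scale_le (one_le_pow₀ one_le_two) (z n)).trans ?_
    refine (mul_le_mul_right (h n) _).trans ?_
    rw [← ENNReal.ofReal_mul (by positivity)]
    apply ENNReal.ofReal_le_ofReal
    unfold rate
    rw [← mul_assoc, ← Real.rpow_add (by positivity)]
    simp
  have hm : ∀ n, AEMeasurable (fun x => ENNReal.ofReal (Φ x (2 ^ n * z n x))) μ := fun n =>
    (F.aemeasurable_comp ((hz n).const_mul _)).ennreal_ofReal
  have h2 : ∫⁻ x, ∑' n, ENNReal.ofReal (Φ x (2 ^ n * z n x)) ∂μ ≠ ⊤ := by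
    rw [lintegral_tsum hm]
    refine ne_top_of_le_ne_top ?_ (ENNReal.tsum_le_tsum h1)
    rw [← ENNReal.ofReal_tsum_of_nonneg (fun n => by positivity) summable_geometric_two]
    exact ENNReal.ofReal_ne_top
  filter_upwards [ae_lt_top' (AEMeasurable.tsum hm) h2, F.young] with x hx hY
  have h3 := ENNReal.tendsto_atTop_zero_of_tsum_ne_top hx.ne
  have h4 : 0 < ENNReal.ofReal (Φ x 1) := ENNReal.ofReal_pos.2 (hY.pos one_ne_zero)
  filter_upwards [(tendsto_order.1 h3).2 _ h4] with n hn
  have h5 := (ENNReal.ofReal_lt_ofReal_iff (hY.pos one_ne_zero)).1 hn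
  by_contra hcon
  push Not at hcon
  refine absurd (hY.mono (a := 1) (b := 2 ^ n * z n x) ?_) (not_le.2 h5)
  rw [abs_one, abs_mul, abs_of_pos (by positivity : (0 : ℝ) < 2 ^ n)]
  calc (1 : ℝ) = 2 ^ n * (1 / 2) ^ n := by rw [← mul_pow]; norm_num
    _ ≤ 2 ^ n * |z n x| := by gcongr

theorem ae_tendsto_zero (F : YoungFamily μ p q Φ φ) {z : ℕ → X → ℝ}
    (hz : ∀ n, AEMeasurable (z n) μ)
    (h : ∀ n, modular μ Φ (z n) ≤ ENNReal.ofReal (rate q n)) :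
    ∀ᵐ x ∂μ, Tendsto (fun n => z n x) atTop (𝓝 0) := by
  filter_upwards [F.ae_eventually_le hz h] with x hx
  exact squeeze_zero_norm' hx
    (tendsto_pow_atTop_nhds_zero_of_lt_one (by norm_num) (by norm_num))

theorem integrable_comp (F : YoungFamily μ p q Φ φ) {z : X → ℝ} (hz : AEMeasurable z μ)
    (h : modular μ Φ z < ⊤) : Integrable (fun x => Φ x (z x)) μ := by
  refine ⟨(F.aemeasurable_comp hz).aestronglyMeasurable, ?_⟩
  rw [hasFiniteIntegral_iff_ofReal]
  · exact h
  · filter_upwards [F.young] with x hY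
    exact hY.nonneg _

theorem integral_comp (F : YoungFamily μ p q Φ φ) {z : X → ℝ} (hz : AEMeasurable z μ) :
    ∫ x, Φ x (z x) ∂μ = (modular μ Φ z).toReal := by
  rw [integral_eq_lintegral_of_nonneg_ae]
  · rfl
  · filter_upwards [F.young] with x hY
    exact hY.nonneg _
  · exact (F.aemeasurable_comp hz).aestronglyMeasurable

theorem integrable_deriv_mul (F : YoungFamily μ p q Φ φ) {a b : X → ℝ} (ha : AEMeasurable a μ)
    (hb : AEMeasurable b μ) (ha' : modular μ Φ a < ⊤) (hb' : modular μ Φ b < ⊤) :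
    Integrable (fun x => φ x (a x) * b x) μ := by
  refine Integrable.mono' (((F.integrable_comp ha ha').add (F.integrable_comp hb hb')).const_mul
    (q + 1)) ((F.aemeasurable_deriv_comp ha).mul hb).aestronglyMeasurable ?_
  filter_upwards [F.young] with x hY
  exact hY.abs_deriv_mul_le F.q_pos _ _

theorem abs_integral_deriv_mul_le (F : YoungFamily μ p q Φ φ) {a b : X → ℝ}
    (ha : AEMeasurable a μ)
    (hb : AEMeasurable b μ) (ha' : modular μ Φ a < ⊤) (hb' : modular μ Φ b < ⊤) :
    |∫ x, φ x (a x) * b x ∂μ| ≤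
      (q + 1) * ((modular μ Φ a).toReal + (modular μ Φ b).toReal) := by
  rw [← F.integral_comp ha, ← F.integral_comp hb,
    ← integral_add (F.integrable_comp ha ha') (F.integrable_comp hb hb'), ← integral_const_mul]
  rw [← Real.norm_eq_abs]
  refine norm_integral_le_of_norm_le (((F.integrable_comp ha ha').add
    (F.integrable_comp hb hb')).const_mul (q + 1)) ?_
  filter_upwards [F.young] with x hY
  exact hY.abs_deriv_mul_le F.q_pos _ _

/-- Convexity of the modular, in the form of the gradient inequality. -/
theorem tangent (F : YoungFamily μ p q Φ φ) {a b : X → ℝ} (ha : AEMeasurable a μ)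
    (hb : AEMeasurable b μ) (ha' : modular μ Φ a < ⊤) (hb' : modular μ Φ b < ⊤) :
    ∫ x, φ x (b x) * (a x - b x) ∂μ ≤ (modular μ Φ a).toReal - (modular μ Φ b).toReal := by
  rw [← F.integral_comp ha, ← F.integral_comp hb,
    ← integral_sub (F.integrable_comp ha ha') (F.integrable_comp hb hb')]
  refine integral_mono_ae (F.integrable_deriv_mul hb (ha.sub hb) hb'
    (F.modular_sub_lt_top ha ha' hb'))
    ((F.integrable_comp ha ha').sub (F.integrable_comp hb hb')) ?_
  filter_upwards [F.young] with x hY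
  exact hY.tangent _ _

theorem integrable_gap (F : YoungFamily μ p q Φ φ) {a b c : X → ℝ} (ha : AEMeasurable a μ)
    (hb : AEMeasurable b μ) (hc : AEMeasurable c μ) (ha' : modular μ Φ a < ⊤)
    (hb' : modular μ Φ b < ⊤) (hc' : modular μ Φ c < ⊤) :
    Integrable (fun x => (φ x (a x) - φ x (b x)) * c x) μ := by
  simp only [sub_mul]
  exact (F.integrable_deriv_mul ha hc ha' hc').sub (F.integrable_deriv_mul hb hc hb' hc')

/-- The monotonicity gap controls the modular of the difference, up to a small multiple of the
modulars. -/
theorem modular_sub_le_gap (F : YoungFamily μ p q Φ φ) {η : ℝ} (hη : 0 < η) (hη1 : η ≤ 1)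
    {a b : X → ℝ} (ha : AEMeasurable a μ)
    (hb : AEMeasurable b μ) (ha' : modular μ Φ a < ⊤) (hb' : modular μ Φ b < ⊤) :
    (modular μ Φ (fun x => a x - b x)).toReal ≤
      IsYoung.gapConst p q η * (∫ x, (φ x (a x) - φ x (b x)) * (a x - b x) ∂μ)
        + η * ((modular μ Φ a).toReal + (modular μ Φ b).toReal) := by
  have hs : AEMeasurable (fun x => a x - b x) μ := ha.sub hb
  have hi := F.integrable_gap ha hb hs ha' hb' (F.modular_sub_lt_top ha ha' hb')
  have iab : Integrable (fun x => Φ x (a x) + Φ x (b x)) μ :=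
    (F.integrable_comp ha ha').add (F.integrable_comp hb hb')
  rw [← F.integral_comp ha, ← F.integral_comp hb, ← F.integral_comp hs,
    ← integral_add (F.integrable_comp ha ha') (F.integrable_comp hb hb'), ← integral_const_mul,
    ← integral_const_mul, ← integral_add (hi.const_mul _) (iab.const_mul _)]
  refine integral_mono_ae (F.integrable_comp (ha.sub hb) (F.modular_sub_lt_top ha ha' hb'))
    ((hi.const_mul _).add (iab.const_mul _)) ?_
  filter_upwards [F.young] with x hY
  exact hY.le_gap F.p_pos hη hη1 _ _

/-- Uniform convexity of the modular. -/
theorem modular_sub_le_midpoint_gap (F : YoungFamily μ p q Φ φ) {η : ℝ} (hη : 0 < η) (hη1 : η ≤ 1)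
    {a b : X → ℝ} (ha : AEMeasurable a μ)
    (hb : AEMeasurable b μ) (ha' : modular μ Φ a < ⊤) (hb' : modular μ Φ b < ⊤) :
    (modular μ Φ (fun x => a x - b x)).toReal ≤
      4 ^ (q + 1) * (IsYoung.gapConst p q η * ((modular μ Φ a).toReal + (modular μ Φ b).toReal
          - 2 * (modular μ Φ (fun x => (a x + b x) / 2)).toReal)
        + 2 * η * ((modular μ Φ a).toReal + (modular μ Φ b).toReal)) := by
  have hm : AEMeasurable (fun x => (a x + b x) / 2) μ := (ha.add hb).div_const 2
  have hm' : modular μ Φ (fun x => (a x + b x) / 2) < ⊤ := by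
    have := F.modular_const_mul_lt_top (1 / 2) (F.modular_add_lt_top ha ha' hb')
    refine lt_of_eq_of_lt ?_ this
    congr 1; ext x; ring
  have ia := F.integrable_comp ha ha'
  have ib := F.integrable_comp hb hb'
  have im := F.integrable_comp hm hm'
  have hs : AEMeasurable (fun x => a x - b x) μ := ha.sub hb
  have is := F.integrable_comp hs (F.modular_sub_lt_top ha ha' hb')
  have iab : Integrable (fun x => Φ x (a x) + Φ x (b x)) μ := ia.add ib
  have iabm : Integrable (fun x => Φ x (a x) + Φ x (b x) - 2 * Φ x ((a x + b x) / 2)) μ :=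
    iab.sub (im.const_mul 2)
  rw [← F.integral_comp ha, ← F.integral_comp hb, ← F.integral_comp hm,
    ← F.integral_comp hs, ← integral_add ia ib,
    ← integral_const_mul 2, ← integral_sub iab (im.const_mul 2),
    ← integral_const_mul (IsYoung.gapConst p q η), ← integral_const_mul (2 * η),
    ← integral_add (iabm.const_mul _) (iab.const_mul _),
    ← integral_const_mul]
  refine integral_mono_ae is (((iabm.const_mul _).add (iab.const_mul _)).const_mul _) ?_
  filter_upwards [F.young] with x hY
  exact hY.le_midpoint_gap F.p_pos hη hη1 _ _

/-- `∫ φ(a + t b) b → ∫ φ(a) b` as `t → 0+`: the modular is differentiable along lines, with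
continuous derivative. -/
theorem tendsto_integral_deriv (F : YoungFamily μ p q Φ φ) {a b : X → ℝ} (ha : AEMeasurable a μ)
    (hb : AEMeasurable b μ) (ha' : modular μ Φ a < ⊤) (hb' : modular μ Φ b < ⊤) :
    Tendsto (fun t : ℝ => ∫ x, φ x (a x + t * b x) * b x ∂μ) (𝓝[>] 0)
      (𝓝 (∫ x, φ x (a x) * b x ∂μ)) := by
  set Y : X → ℝ := fun x => |a x| + |b x| with hYdef
  have hYm : AEMeasurable Y μ := ha.abs.add hb.abs
  have hY' : modular μ Φ Y < ⊤ := F.modular_add_lt_top ha.abs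
    ((F.modular_abs a).trans_lt ha') ((F.modular_abs b).trans_lt hb')
  refine tendsto_integral_filter_of_dominated_convergence
    (fun x => (q + 1) * (Φ x (Y x) + Φ x (b x))) ?_ ?_ ?_ ?_
  · filter_upwards with t
    exact ((F.aemeasurable_deriv_comp (ha.add (hb.const_mul t))).mul hb).aestronglyMeasurable
  · filter_upwards [Ioo_mem_nhdsGT (zero_lt_one' ℝ)] with t ht
    filter_upwards [F.young] with x hY
    refine (hY.abs_deriv_mul_le F.q_pos _ _).trans ?_
    have := F.q_pos
    gcongr
    apply hY.mono
    rw [abs_of_nonneg (by positivity : 0 ≤ Y x)]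
    refine (abs_add_le _ _).trans ?_
    refine add_le_add le_rfl ?_
    rw [abs_mul, abs_of_pos ht.1]
    exact mul_le_of_le_one_left (abs_nonneg _) ht.2.le
  · exact ((F.integrable_comp hYm hY').add (F.integrable_comp hb hb')).const_mul _
  · filter_upwards [F.young] with x hY
    refine Tendsto.mul_const _ ?_
    have h1 : Tendsto (fun t : ℝ => a x + t * b x) (𝓝[>] 0) (𝓝 (a x)) := by
      have : Tendsto (fun t : ℝ => a x + t * b x) (𝓝 0) (𝓝 (a x + 0 * b x)) :=
        (by fun_prop : Continuous (fun t : ℝ => a x + t * b x)).tendsto 0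
      simp only [zero_mul, add_zero] at this
      exact this.mono_left nhdsWithin_le_nhds
    exact (hY.cont_deriv.tendsto _).comp h1

/-- Scaling turns Young's inequality into a bound linear in the size of `b`. -/
theorem abs_integral_deriv_mul_le_of_scale (F : YoungFamily μ p q Φ φ) {a b : X → ℝ}
    (ha : AEMeasurable a μ) (hb : AEMeasurable b μ) (ha' : modular μ Φ a < ⊤) {l : ℝ}
    (hl : 0 < l) (hb' : modular μ Φ (fun x => b x / l) ≤ 1) :
    |∫ x, φ x (a x) * b x ∂μ| ≤ (q + 1) * ((modular μ Φ a).toReal + 1) * l := by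
  have h1 := F.abs_integral_deriv_mul_le ha (hb.div_const l) ha' (hb'.trans_lt ENNReal.one_lt_top)
  have h2 : ∫ x, φ x (a x) * b x ∂μ = l * ∫ x, φ x (a x) * (b x / l) ∂μ := by
    rw [← integral_const_mul]
    congr 1; ext x
    field_simp
  have h3 : (modular μ Φ (fun x => b x / l)).toReal ≤ 1 :=
    ENNReal.toReal_mono ENNReal.one_ne_top hb'
  rw [h2, abs_mul, abs_of_pos hl, mul_comm l]
  have := F.q_pos
  refine mul_le_mul_of_nonneg_right (h1.trans ?_) hl.le
  gcongr

end YoungFamily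

variable {d : ℕ} {gl gu kl ku s : ℝ} {g : E d → E d → ℝ → ℝ}

/-! ### The two modulars of `W^{s,G}` -/

/-- The Young functions `Ĝ(x, ·)`, extended evenly to `ℝ`. -/
def youngG (g : E d → E d → ℝ → ℝ) (x : E d) (a : ℝ) : ℝ := primG g x x |a|

/-- The derivatives of `youngG`. -/
def derivG (g : E d → E d → ℝ → ℝ) (x : E d) (a : ℝ) : ℝ := g x x |a| * a

/-- The Young functions `G(x, y, ·) / |x - y|^d` on pairs of points, extended evenly to `ℝ`; the
weight of the Gagliardo modular is absorbed into them. -/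
def youngS (g : E d → E d → ℝ → ℝ) (z : E d × E d) (a : ℝ) : ℝ :=
  primG g z.1 z.2 |a| / ‖z.1 - z.2‖ ^ d

/-- The derivatives of `youngS`. -/
def derivS (g : E d → E d → ℝ → ℝ) (z : E d × E d) (a : ℝ) : ℝ :=
  g z.1 z.2 |a| * a / ‖z.1 - z.2‖ ^ d

/-- The difference quotient as a function on pairs of points. -/
def quot (s : ℝ) (u : E d → ℝ) (z : E d × E d) : ℝ := delta s u z.1 z.2

theorem measurable_primG (hg : IsAdmissible gl gu kl ku g) :
    Measurable (fun p : E d × E d × ℝ => primG g p.1 p.2.1 |p.2.2|) := by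
  have h1 : ∀ p : E d × E d × ℝ, primG g p.1 p.2.1 |p.2.2| =
      ∫ ρ, (Ioc 0 |p.2.2|).indicator (fun ρ => g p.1 p.2.1 ρ * ρ) ρ := by
    intro p
    rw [primG, intervalIntegral.integral_of_le (abs_nonneg _),
      integral_indicator measurableSet_Ioc]
  simp only [h1]
  refine StronglyMeasurable.measurable ?_
  refine StronglyMeasurable.integral_prod_right
    (f := fun (p : E d × E d × ℝ) ρ => (Ioc 0 |p.2.2|).indicator (fun ρ => g p.1 p.2.1 ρ * ρ) ρ) ?_
  refine Measurable.stronglyMeasurable ?_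
  have h2 : Measurable (fun z : (E d × E d × ℝ) × ℝ => g z.1.1 z.1.2.1 z.2 * z.2) :=
    (hg.measurable.comp (f := fun z : (E d × E d × ℝ) × ℝ => (z.1.1, z.1.2.1, z.2))
      (by fun_prop)).mul measurable_snd
  have h3 : MeasurableSet {z : (E d × E d × ℝ) × ℝ | 0 < z.2 ∧ z.2 ≤ |z.1.2.2|} :=
    (measurableSet_lt measurable_const measurable_snd).inter
      (measurableSet_le measurable_snd (by fun_prop))
  exact h2.indicator h3

theorem ae_ne (hd : 0 < d) : ∀ᵐ z : E d × E d, z.1 ≠ z.2 := by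
  have : Nonempty (Fin d) := ⟨⟨0, hd⟩⟩
  have hm : MeasurableSet {z : E d × E d | ¬ z.1 ≠ z.2} := by
    simp only [not_not]
    exact measurableSet_eq_fun measurable_fst measurable_snd
  rw [ae_iff, Measure.volume_eq_prod, Measure.measure_prod_null hm]
  filter_upwards with x
  have : Prod.mk x ⁻¹' {z : E d × E d | ¬ z.1 ≠ z.2} = {x} := by
    ext y; simp [eq_comm]
  rw [this]
  simp

theorem IsAdmissible.famG (hg : IsAdmissible gl gu kl ku g) :
    YoungFamily volume gl gu (youngG g) (derivG g) where
  p_pos := hg.gl_pos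
  le := hg.gl_le
  young := hg.profile_diag.mono fun _ hx => hx.isYoung hg.gl_pos hg.gl_le
  measurable := (measurable_primG hg).comp (f := fun z : E d × ℝ => (z.1, z.1, z.2)) (by fun_prop)
  measurable_deriv :=
    (hg.measurable.comp (f := fun z : E d × ℝ => (z.1, z.1, |z.2|)) (by fun_prop)).mul
      measurable_snd

theorem IsAdmissible.famS (hd : 0 < d) (hg : IsAdmissible gl gu kl ku g) :
    YoungFamily volume gl gu (youngS g) (derivS g) where
  p_pos := hg.gl_pos
  le := hg.gl_le
  young := by
    filter_upwards [hg.profile, ae_ne hd] with z hz hne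
    have hpos : 0 < (‖z.1 - z.2‖ ^ d)⁻¹ :=
      inv_pos.2 (pow_pos (norm_pos_iff.2 (sub_ne_zero.2 hne)) _)
    have := (hz.isYoung hg.gl_pos hg.gl_le).const_mul hpos
    simp only [inv_mul_eq_div] at this
    exact this
  measurable := ((measurable_primG hg).comp
      (f := fun z : (E d × E d) × ℝ => (z.1.1, z.1.2, z.2)) (by fun_prop)).div (by fun_prop)
  measurable_deriv :=
    ((hg.measurable.comp (f := fun z : (E d × E d) × ℝ => (z.1.1, z.1.2, |z.2|))
      (by fun_prop)).mul measurable_snd).div (by fun_prop)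

theorem modG_eq (u : E d → ℝ) : modG g u = modular volume (youngG g) u := rfl

theorem modS_eq (u : E d → ℝ) : modS g s u = modular volume (youngS g) (quot s u) := rfl

theorem opL_eq (u v : E d → ℝ) : opL g s u v = ∫ z, derivS g z (quot s u z) * quot s v z := by
  unfold opL
  congr 1; ext z
  simp only [derivS, quot]
  ring

theorem aemeasurable_quot {u : E d → ℝ} (hu : AEMeasurable u) : AEMeasurable (quot s u) := by
  have h1 : AEMeasurable (fun z : E d × E d => u z.1) :=
    hu.comp_quasiMeasurePreserving Measure.quasiMeasurePreserving_fst
  have h2 : AEMeasurable (fun z : E d × E d => u z.2) :=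
    hu.comp_quasiMeasurePreserving Measure.quasiMeasurePreserving_snd
  exact (h1.sub h2).div (Measurable.aemeasurable (by fun_prop))

theorem quot_add (u v : E d → ℝ) :
    quot s (fun x => u x + v x) = fun z => quot s u z + quot s v z := by
  ext z; simp only [quot, delta]; ring

theorem quot_sub (u v : E d → ℝ) :
    quot s (fun x => u x - v x) = fun z => quot s u z - quot s v z := by
  ext z; simp only [quot, delta]; ring

theorem quot_mul (c : ℝ) (u : E d → ℝ) :
    quot s (fun x => c * u x) = fun z => c * quot s u z := by
  ext z; simp only [quot, delta]; ring

theorem quot_div (u : E d → ℝ) (l : ℝ) : quot s (fun x => u x / l) = fun z => quot s u z / l := by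
  ext z; simp only [quot, delta]; ring

theorem abs_quot_le_abs_quot {u v : E d → ℝ} {z : E d × E d}
    (h : |u z.1 - u z.2| ≤ |v z.1 - v z.2|) : |quot s u z| ≤ |quot s v z| := by
  simp only [quot, delta, abs_div]
  gcongr

/-- The modular of `W^{s,G}(ℝ^d)`, the sum of those of `L^Ĝ` and of the Gagliardo seminorm. -/
def modW (g : E d → E d → ℝ → ℝ) (s : ℝ) (u : E d → ℝ) : ℝ≥0∞ := modG g u + modS g s u

theorem memW_iff {u : E d → ℝ} : MemW g s u ↔ AEMeasurable u ∧ modW g s u < ⊤ := by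
  rw [MemW, modW, ENNReal.add_lt_top]

section Modulars

variable (hd : 0 < d) (hg : IsAdmissible gl gu kl ku g)
include hd hg

theorem modW_add_le {u v : E d → ℝ} (hu : AEMeasurable u) :
    modW g s (fun x => u x + v x) ≤
      ENNReal.ofReal (2 ^ (gu + 1)) * (modW g s u + modW g s v) := by
  have h1 := hg.famG.modular_add_le v hu
  have h2 := (hg.famS hd).modular_add_le (quot s v) (aemeasurable_quot (s := s) hu)
  rw [← quot_add] at h2
  refine (add_le_add h1 h2).trans (le_of_eq ?_)
  simp only [modW, modG_eq, modS_eq]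
  ring

theorem modW_sub_le {u v : E d → ℝ} (hu : AEMeasurable u) :
    modW g s (fun x => u x - v x) ≤
      ENNReal.ofReal (2 ^ (gu + 1)) * (modW g s u + modW g s v) := by
  have h1 := hg.famG.modular_sub_le v hu
  have h2 := (hg.famS hd).modular_sub_le (quot s v) (aemeasurable_quot (s := s) hu)
  rw [← quot_sub] at h2
  refine (add_le_add h1 h2).trans (le_of_eq ?_)
  simp only [modW, modG_eq, modS_eq]
  ring

theorem modW_const_mul_le (c : ℝ) (u : E d → ℝ) : modW g s (fun x => c * u x) ≤
    ENNReal.ofReal ((max 1 |c|) ^ (gu + 1)) * modW g s u := by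
  have hle : ∀ a : ℝ, |c * a| ≤ |max 1 |c| * a| := by
    intro a
    rw [abs_mul, abs_mul, abs_of_pos (lt_max_of_lt_left zero_lt_one)]
    gcongr
    exact le_max_right _ _
  have h1 : modG g (fun x => c * u x) ≤ modG g (fun x => max 1 |c| * u x) :=
    hg.famG.modular_mono (Eventually.of_forall fun x => hle (u x))
  have h2 : modS g s (fun x => c * u x) ≤ modS g s (fun x => max 1 |c| * u x) :=
    (hg.famS hd).modular_mono (Eventually.of_forall fun z => by
      change |quot s (fun x => c * u x) z| ≤ |quot s (fun x => max 1 |c| * u x) z|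
      rw [quot_mul, quot_mul]; exact hle _)
  have h3 := hg.famG.modular_scale_le (le_max_left 1 |c|) u
  have h4 := (hg.famS hd).modular_scale_le (le_max_left 1 |c|) (quot s u)
  rw [← quot_mul] at h4
  rw [modW, modW, mul_add]
  exact add_le_add (h1.trans h3) (h2.trans h4)

theorem MemW.add {u v : E d → ℝ} (hu : MemW g s u) (hv : MemW g s v) :
    MemW g s (fun x => u x + v x) := by
  rw [memW_iff] at *
  exact ⟨hu.1.add hv.1, (modW_add_le hd hg hu.1).trans_lt
    (ENNReal.mul_lt_top ENNReal.ofReal_lt_top (ENNReal.add_lt_top.2 ⟨hu.2, hv.2⟩))⟩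

theorem MemW.sub {u v : E d → ℝ} (hu : MemW g s u) (hv : MemW g s v) :
    MemW g s (fun x => u x - v x) := by
  rw [memW_iff] at *
  exact ⟨hu.1.sub hv.1, (modW_sub_le hd hg hu.1).trans_lt
    (ENNReal.mul_lt_top ENNReal.ofReal_lt_top (ENNReal.add_lt_top.2 ⟨hu.2, hv.2⟩))⟩

theorem MemW.const_mul {u : E d → ℝ} (c : ℝ) (hu : MemW g s u) :
    MemW g s (fun x => c * u x) := by
  rw [memW_iff] at *
  exact ⟨hu.1.const_mul c, (modW_const_mul_le hd hg c u).trans_lt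
    (ENNReal.mul_lt_top ENNReal.ofReal_lt_top hu.2)⟩

end Modulars

/-! ### Luxemburg functionals -/

theorem luxemburg_le {m : (E d → ℝ) → ℝ≥0∞} {u : E d → ℝ} {l : ℝ} (hl : 0 < l)
    (h : m (fun x => u x / l) ≤ 1) : luxemburg m u ≤ ENNReal.ofReal l :=
  iInf_le_of_le l (iInf_le_of_le hl (iInf_le_of_le h le_rfl))

theorem exists_of_luxemburg_lt {m : (E d → ℝ) → ℝ≥0∞} {u : E d → ℝ} {c : ℝ≥0∞}
    (h : luxemburg m u < c) : ∃ l : ℝ, 0 < l ∧ m (fun x => u x / l) ≤ 1 ∧ ENNReal.ofReal l < c := by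
  simp only [luxemburg, iInf_lt_iff] at h
  obtain ⟨l, hl, hm, hc⟩ := h
  exact ⟨l, hl, hm, hc⟩

/-- The scaling behaviour of a modular on functions on `ℝ^d`. -/
structure IsScaling (p q : ℝ) (m : (E d → ℝ) → ℝ≥0∞) : Prop where
  p_pos : 0 < p
  scale_le : ∀ (l : ℝ) (u), 1 ≤ l → m (fun x => l * u x) ≤ ENNReal.ofReal (l ^ (q + 1)) * m u
  scale_small : ∀ (t : ℝ) (u), 0 ≤ t → t ≤ 1 →
    m (fun x => t * u x) ≤ ENNReal.ofReal (t ^ (p + 1)) * m u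

theorem IsAdmissible.scalingG (hg : IsAdmissible gl gu kl ku g) : IsScaling gl gu (modG g) where
  p_pos := hg.gl_pos
  scale_le _ u hl := hg.famG.modular_scale_le hl u
  scale_small _ u ht ht1 := hg.famG.modular_scale_small ht ht1 u

theorem IsAdmissible.scalingS (hd : 0 < d) (hg : IsAdmissible gl gu kl ku g) :
    IsScaling gl gu (modS g s) where
  p_pos := hg.gl_pos
  scale_le _ u hl := by
    rw [modS_eq, quot_mul]; exact (hg.famS hd).modular_scale_le hl _
  scale_small _ u ht ht1 := by
    rw [modS_eq, quot_mul]; exact (hg.famS hd).modular_scale_small ht ht1 _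

namespace IsScaling

variable {p q : ℝ} {m : (E d → ℝ) → ℝ≥0∞}

/-- A Luxemburg functional below `t ≤ 1` bounds the modular. -/
theorem le_of_luxemburg_lt (hm : IsScaling p q m) {u : E d → ℝ} {t : ℝ} (ht : t ≤ 1)
    (h : luxemburg m u < ENNReal.ofReal t) : m u ≤ ENNReal.ofReal t := by
  obtain ⟨l, hl, hml, hlt⟩ := exists_of_luxemburg_lt h
  have hlt' : l < t := (ENNReal.ofReal_lt_ofReal_iff_of_nonneg hl.le).1 hlt
  have h1 := hm.scale_small l (fun x => u x / l) hl.le (by linarith)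
  have h2 : (fun x => l * (u x / l)) = u := by ext x; field_simp
  rw [h2] at h1
  refine h1.trans ((mul_le_of_le_one_right (zero_le) hml).trans (ENNReal.ofReal_le_ofReal ?_))
  have := Real.rpow_le_rpow_of_exponent_ge' hl.le (by linarith) zero_le_one
    (by linarith [hm.p_pos] : (1 : ℝ) ≤ p + 1)
  rw [Real.rpow_one] at this
  linarith

/-- A small modular bounds the Luxemburg functional: here the doubling property is needed. -/
theorem luxemburg_le_of_le (hm : IsScaling p q m) {u : E d → ℝ} {t : ℝ} (ht : 0 < t) (ht1 : t ≤ 1)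
    (h : m u ≤ ENNReal.ofReal (t ^ (q + 1))) : luxemburg m u ≤ ENNReal.ofReal t := by
  refine luxemburg_le ht ?_
  have h1 := hm.scale_le t⁻¹ u ((one_le_inv₀ ht).2 ht1)
  simp only [inv_mul_eq_div] at h1
  refine h1.trans ((mul_le_mul_right h _).trans ?_)
  rw [← ENNReal.ofReal_mul (by positivity), Real.inv_rpow ht.le,
    inv_mul_cancel₀ (Real.rpow_pos_of_pos ht _).ne', ENNReal.ofReal_one]

/-- Superlinearity of the modular with respect to the Luxemburg functional: up to a constant, the
latter is an arbitrarily small multiple of the modular, as `K ^ (-p)` is small for large `K`. -/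
theorem luxemburg_le_add (hm : IsScaling p q m) {u : E d → ℝ} (h : m u < ⊤) {K : ℝ} (hK : 1 ≤ K) :
    luxemburg m u ≤ ENNReal.ofReal (K + K ^ (-p) * (m u).toReal) := by
  have hK0 : 0 < K := by linarith
  have hp := hm.p_pos
  set J := (m u).toReal with hJ
  have hJ0 : 0 ≤ J := ENNReal.toReal_nonneg
  have hmJ : m u = ENNReal.ofReal J := (ENNReal.ofReal_toReal h.ne).symm
  have key : ∀ l : ℝ, K ≤ l → J ≤ l ^ (p + 1) → l ≤ K + K ^ (-p) * J →
      luxemburg m u ≤ ENNReal.ofReal (K + K ^ (-p) * J) := by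
    intro l hKl hJl hle
    have hl0 : 0 < l := by linarith
    refine (luxemburg_le hl0 ?_).trans (ENNReal.ofReal_le_ofReal hle)
    have h1 := hm.scale_small l⁻¹ u (by positivity) (inv_le_one_of_one_le₀ (by linarith))
    simp only [inv_mul_eq_div] at h1
    refine h1.trans ?_
    rw [hmJ, ← ENNReal.ofReal_mul (by positivity), ← ENNReal.ofReal_one]
    apply ENNReal.ofReal_le_ofReal
    rw [Real.inv_rpow hl0.le, inv_mul_le_iff₀ (Real.rpow_pos_of_pos hl0 _), mul_one]
    exact hJl
  by_cases hc : J ≤ K ^ (p + 1)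
  · exact key K le_rfl hc (by have := Real.rpow_pos_of_pos hK0 (-p); nlinarith)
  · push Not at hc
    have hKp : 0 < K ^ (p + 1) := Real.rpow_pos_of_pos hK0 _
    have hJ1 : 0 < J := hKp.trans hc
    -- The value of `l` for which `l⁻¹ ^ (p + 1) * m u = 1`.
    set l := J ^ (p + 1)⁻¹ with hl
    have hl0 : 0 < l := Real.rpow_pos_of_pos hJ1 _
    have hlp : l ^ (p + 1) = J := by
      rw [hl, ← Real.rpow_mul hJ0, inv_mul_cancel₀ (by linarith), Real.rpow_one]
    have hKl : K ≤ l := by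
      by_contra hcon
      push Not at hcon
      have := Real.rpow_lt_rpow hl0.le hcon (by linarith : 0 < p + 1)
      rw [hlp] at this
      linarith
    refine key l hKl hlp.ge ?_
    have h1 : K ^ (-p) * J = l * ((l / K) ^ p) := by
      rw [← hlp, Real.rpow_add_one hl0.ne', Real.div_rpow hl0.le hK0.le, Real.rpow_neg hK0.le]
      ring
    have h2 : 1 ≤ (l / K) ^ p := Real.one_le_rpow ((one_le_div hK0).2 hKl) hp.le
    rw [h1]
    nlinarith

end IsScaling

theorem exists_real_small {ε : ℝ≥0∞} (hε : 0 < ε) :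
    ∃ t : ℝ, 0 < t ∧ t ≤ 1 ∧ ENNReal.ofReal (2 * t) ≤ ε := by
  rcases eq_or_ne ε ⊤ with rfl | hne
  · exact ⟨1, one_pos, le_rfl, le_top⟩
  · have h0 : 0 < ε.toReal := ENNReal.toReal_pos hε.ne' hne
    refine ⟨min 1 (ε.toReal / 2), by positivity, min_le_left _ _, ?_⟩
    rw [ENNReal.ofReal_le_iff_le_toReal hne]
    have := min_le_right 1 (ε.toReal / 2)
    linarith

section Norm

variable (hd : 0 < d) (hg : IsAdmissible gl gu kl ku g)
include hd hg

/-- Convergence to zero in the modular implies convergence to zero in norm. -/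
theorem exists_normW_le {ε : ℝ≥0∞} (hε : 0 < ε) :
    ∃ δ : ℝ≥0∞, 0 < δ ∧ ∀ u : E d → ℝ, modW g s u ≤ δ → normW g s u ≤ ε := by
  obtain ⟨t, ht, ht1, hte⟩ := exists_real_small hε
  refine ⟨ENNReal.ofReal (t ^ (gu + 1)), by positivity, fun u hu => ?_⟩
  have h1 := hg.scalingG.luxemburg_le_of_le ht ht1 (le_self_add.trans hu)
  have h2 := (hg.scalingS hd).luxemburg_le_of_le ht ht1 (le_add_self.trans hu)
  refine (add_le_add h1 h2).trans (le_trans (le_of_eq ?_) hte)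
  rw [← ENNReal.ofReal_add ht.le ht.le, two_mul]

/-- Convergence to zero in norm implies convergence to zero in the modular. -/
theorem exists_modW_le {ε : ℝ≥0∞} (hε : 0 < ε) :
    ∃ δ : ℝ≥0∞, 0 < δ ∧ ∀ u : E d → ℝ, normW g s u < δ → modW g s u ≤ ε := by
  obtain ⟨t, ht, ht1, hte⟩ := exists_real_small hε
  refine ⟨ENNReal.ofReal t, by positivity, fun u hu => ?_⟩
  have h1 := hg.scalingG.le_of_luxemburg_lt ht1 (lt_of_le_of_lt le_self_add hu)
  have h2 := (hg.scalingS hd).le_of_luxemburg_lt ht1 (lt_of_le_of_lt le_add_self hu)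
  refine (add_le_add h1 h2).trans (le_trans (le_of_eq ?_) hte)
  rw [← ENNReal.ofReal_add ht.le ht.le, two_mul]

theorem tendsto_normW_of_modW {ι : Type*} {l : Filter ι} {u : ι → E d → ℝ}
    (h : Tendsto (fun i => modW g s (u i)) l (𝓝 0)) :
    Tendsto (fun i => normW g s (u i)) l (𝓝 0) := by
  rw [ENNReal.tendsto_nhds_zero] at h ⊢
  intro ε hε
  obtain ⟨δ, hδ, H⟩ := exists_normW_le (s := s) hd hg hε
  exact (h δ hδ).mono fun i hi => H _ hi

/-- Test functions in `U`. -/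
def IsTest (U : Set (E d)) (φ : E d → ℝ) : Prop :=
  ContDiff ℝ ∞ φ ∧ HasCompactSupport φ ∧ tsupport φ ⊆ U

/-- The closure of the test functions may be taken in the sense of the modular. -/
theorem memW0_iff {U : Set (E d)} {u : E d → ℝ} : MemW0 g s U u ↔ MemW g s u ∧
    ∀ η : ℝ≥0∞, 0 < η → ∃ φ, IsTest U φ ∧ modW g s (fun x => u x - φ x) ≤ η := by
  constructor
  · rintro ⟨h1, h2⟩
    refine ⟨h1, fun η hη => ?_⟩
    obtain ⟨δ, hδ, H⟩ := exists_modW_le (s := s) hd hg hη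
    obtain ⟨φ, ha, hb, hc, h⟩ := h2 δ hδ
    exact ⟨φ, ⟨ha, hb, hc⟩, H _ h⟩
  · rintro ⟨h1, h2⟩
    refine ⟨h1, fun η hη => ?_⟩
    obtain ⟨η', hη', hlt⟩ := exists_between hη
    obtain ⟨δ, hδ, H⟩ := exists_normW_le (s := s) hd hg hη'
    obtain ⟨φ, ⟨ha, hb, hc⟩, h⟩ := h2 δ hδ
    exact ⟨φ, ha, hb, hc, (H _ h).trans_lt hlt⟩

end Norm

/-! ### Test functions have finite modular -/

/-- The radial kernel that dominates the Gagliardo modular of a test function. A bounded Lipschitz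
function has `|φ x - φ y| ≤ N min (|x - y|) 1`; the first argument of the minimum makes the kernel
integrable at `0` as `s < 1`, the second one at infinity as `s > 0`. -/
def kernelBound (d : ℕ) (p s r : ℝ) : ℝ := (min r 1 / r ^ s) ^ (p + 1) / r ^ d

theorem integrable_kernelBound (hd : 0 < d) (hs0 : 0 < s) (hs1 : s < 1) {p : ℝ} (hp : 0 < p) :
    Integrable (fun x : E d => kernelBound d p s ‖x‖) := by
  have : Nonempty (Fin d) := ⟨⟨0, hd⟩⟩
  rw [integrable_fun_norm_addHaar, finrank_euclideanSpace_fin]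
  have hform : ∀ r : ℝ, 0 < r →
      r ^ (d - 1) • kernelBound d p s r = (min r 1 / r ^ s) ^ (p + 1) / r := by
    intro r hr
    obtain ⟨n, rfl⟩ : ∃ n, d = n + 1 := ⟨d - 1, by omega⟩
    simp only [kernelBound, smul_eq_mul, Nat.add_sub_cancel, pow_succ]
    field_simp
  rw [← Ioc_union_Ioi_eq_Ioi (zero_le_one' ℝ), integrableOn_union]
  constructor
  · have h1 : IntegrableOn (fun r : ℝ => r ^ ((1 - s) * (p + 1) - 1)) (Ioc 0 1) := by
      have : (-1 : ℝ) < (1 - s) * (p + 1) - 1 := by nlinarith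
      exact (intervalIntegrable_iff_integrableOn_Ioc_of_le zero_le_one).1
        (intervalIntegral.intervalIntegrable_rpow' this)
    refine h1.congr_fun (fun r hr => ?_) measurableSet_Ioc
    simp only
    rw [hform r hr.1, min_eq_left hr.2, Real.rpow_sub_one hr.1.ne', Real.rpow_mul hr.1.le,
      Real.rpow_sub hr.1, Real.rpow_one]
  · have h1 : IntegrableOn (fun r : ℝ => r ^ ((-s) * (p + 1) - 1)) (Ioi 1) :=
      integrableOn_Ioi_rpow_of_lt (by nlinarith) zero_lt_one
    refine h1.congr_fun (fun r hr => ?_) measurableSet_Ioi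
    have hr1 : (1 : ℝ) < r := hr
    have hr0 : 0 < r := by linarith
    simp only
    rw [hform r hr0, min_eq_right hr1.le, Real.rpow_sub_one hr0.ne', Real.rpow_mul hr0.le,
      Real.rpow_neg hr0.le, one_div]

theorem IsProfile.primitive_one_le {h : ℝ → ℝ} (hh : IsProfile gl gu kl ku h) (hgl : 0 < gl)
    (hgu : gl ≤ gu) : (∫ ρ in (0 : ℝ)..|1|, h ρ * ρ) ≤ ku := by
  have := (hh.isYoung hgl hgu).le_deriv_mul 1
  simp only [abs_one, mul_one] at this ⊢
  exact this.trans hh.upper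

/-- Pointwise bound of the Gagliardo density of a bounded Lipschitz function. -/
theorem youngS_quot_le (hg : IsAdmissible gl gu kl ku g) (hs0 : 0 < s) (hs1 : s < 1) {x y : E d}
    (hxy : x ≠ y) (hh : IsProfile gl gu kl ku (g x y)) {φ : E d → ℝ} {N : ℝ} (hN : 1 ≤ N)
    (hφ : |φ x - φ y| ≤ N * min ‖x - y‖ 1) :
    youngS g (x, y) (quot s φ (x, y)) ≤ N ^ (gu + 1) * ku * kernelBound d gl s ‖x - y‖ := by
  set r := ‖x - y‖ with hr
  have hr0 : 0 < r := norm_pos_iff.2 (sub_ne_zero.2 hxy)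
  have hY := hh.isYoung hg.gl_pos hg.gl_le
  have hrs : 0 < r ^ s := Real.rpow_pos_of_pos hr0 s
  set w := min r 1 / r ^ s with hw
  have hw0 : 0 ≤ w := by positivity
  have hw1 : w ≤ 1 := by
    rw [hw, div_le_one hrs]
    rcases le_total r 1 with h | h
    · rw [min_eq_left h]
      have := Real.rpow_le_rpow_of_exponent_ge hr0 h hs1.le
      rwa [Real.rpow_one] at this
    · rw [min_eq_right h]
      exact Real.one_le_rpow h hs0.le
  have h1 : |quot s φ (x, y)| ≤ N * w := by
    simp only [quot, delta, abs_div, abs_of_pos hrs, hw, ← hr]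
    rw [← mul_div_assoc]
    gcongr
  have h2 : primG g x y |quot s φ (x, y)| ≤ N ^ (gu + 1) * (w ^ (gl + 1) * ku) := by
    have h3 := hY.mono (a := quot s φ (x, y)) (b := N * (w * 1))
      (by rw [abs_of_nonneg (by positivity : 0 ≤ N * (w * 1)), mul_one]; exact h1)
    have h4 := hY.scale_le N (w * 1) hN
    have h5 := hY.scale_small hg.gl_pos 1 hw0 hw1
    have h6 := hh.primitive_one_le hg.gl_pos hg.gl_le
    unfold primG
    refine h3.trans (h4.trans ?_)
    gcongr
    refine h5.trans ?_
    gcongr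
  have h7 : 0 < r ^ d := pow_pos hr0 d
  simp only [youngS, kernelBound, ← hr, ← hw]
  rw [← mul_div_assoc]
  gcongr
  linarith

/-- The product of a set of finite measure with an integrable kernel is integrable. -/
theorem lintegral_indicator_kernel_lt_top {S : Set (E d)} (hS : MeasurableSet S)
    (hSf : volume S < ⊤) {k : E d → ℝ≥0∞} (hk : Measurable k) (hkf : ∫⁻ x, k x < ⊤) :
    ∫⁻ z : E d × E d, S.indicator 1 z.1 * k (z.1 - z.2) < ⊤ ∧
    ∫⁻ z : E d × E d, S.indicator 1 z.2 * k (z.1 - z.2) < ⊤ := by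
  have hm : Measurable (S.indicator (1 : E d → ℝ≥0∞)) := measurable_one.indicator hS
  have hfin : ∀ C : ℝ≥0∞, C < ⊤ → ∫⁻ x, S.indicator (1 : E d → ℝ≥0∞) x * C < ⊤ := by
    intro C hC
    rw [lintegral_mul_const _ hm, lintegral_indicator_one hS]
    exact ENNReal.mul_lt_top hSf hC
  constructor
  · rw [Measure.volume_eq_prod, lintegral_prod _ (by fun_prop)]
    have : ∀ x : E d, ∫⁻ y, S.indicator (1 : E d → ℝ≥0∞) x * k (x - y) =
        S.indicator 1 x * ∫⁻ y, k y := by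
      intro x
      rw [lintegral_const_mul _ (by fun_prop), lintegral_sub_left_eq_self k x]
    simp only [this]
    exact hfin _ hkf
  · rw [Measure.volume_eq_prod, lintegral_prod_symm _ (by fun_prop)]
    have : ∀ y : E d, ∫⁻ x, S.indicator (1 : E d → ℝ≥0∞) y * k (x - y) =
        S.indicator 1 y * ∫⁻ y, k y := by
      intro y
      rw [lintegral_const_mul _ (by fun_prop), lintegral_sub_right_eq_self k y]
    simp only [this]
    exact hfin _ hkf

section Test

variable (hd : 0 < d) (hg : IsAdmissible gl gu kl ku g)
include hd hg

/-- Test functions are in `W^{s,G}`: the Gagliardo density vanishes unless one of the two points is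
in the support, which has finite measure. -/
theorem IsTest.memW (hs0 : 0 < s) (hs1 : s < 1) {U : Set (E d)} {φ : E d → ℝ} (h : IsTest U φ) :
    MemW g s φ := by
  obtain ⟨hC, hK, -⟩ := h
  have hcont := hC.continuous
  obtain ⟨B, hB⟩ := hK.exists_bound_of_continuous hcont
  obtain ⟨L, hL⟩ := ContDiff.lipschitzWith_of_hasCompactSupport hK hC (by simp)
  set N : ℝ := max 1 (max (2 * B) L) with hN
  have hN1 : 1 ≤ N := le_max_left _ _
  have hNB : 2 * B ≤ N := (le_max_left _ _).trans (le_max_right _ _)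
  have hNL : (L : ℝ) ≤ N := (le_max_right _ _).trans (le_max_right _ _)
  set S := tsupport φ with hS
  have hSm : MeasurableSet S := (isClosed_tsupport φ).measurableSet
  have hSf : volume S < ⊤ := hK.isCompact.measure_lt_top
  have hφN : ∀ x, |φ x| ≤ N := fun x => by
    have := hB x
    rw [Real.norm_eq_abs] at this
    have := abs_nonneg (φ x)
    linarith
  refine ⟨hcont.aemeasurable, ?_, ?_⟩
  · have hfin : ∫⁻ x, S.indicator (1 : E d → ℝ≥0∞) x * ENNReal.ofReal (N ^ (gu + 1) * ku) < ⊤ := by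
      rw [lintegral_mul_const _ (measurable_one.indicator hSm), lintegral_indicator_one hSm]
      exact ENNReal.mul_lt_top hSf ENNReal.ofReal_lt_top
    refine lt_of_le_of_lt (lintegral_mono_ae ?_) hfin
    filter_upwards [hg.profile_diag] with x hx
    have hY := hx.isYoung hg.gl_pos hg.gl_le
    by_cases hxS : x ∈ S
    · rw [indicator_of_mem hxS, Pi.one_apply, one_mul]
      apply ENNReal.ofReal_le_ofReal
      have h1 := hY.mono (a := φ x) (b := N * 1) (by
        rw [mul_one, abs_of_pos (by linarith : 0 < N)]; exact hφN x)
      refine h1.trans ((hY.scale_le N 1 hN1).trans ?_)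
      gcongr
      exact hx.primitive_one_le hg.gl_pos hg.gl_le
    · rw [image_eq_zero_of_notMem_tsupport hxS, abs_zero]
      simp [primG]
  · set C := N ^ (gu + 1) * ku with hCdef
    set k : E d → ℝ≥0∞ := fun x => ENNReal.ofReal (C * kernelBound d gl s ‖x‖) with hk
    have hki : Integrable (fun x : E d => C * kernelBound d gl s ‖x‖) :=
      (integrable_kernelBound hd hs0 hs1 hg.gl_pos).const_mul C
    have hkf : ∫⁻ x, k x < ⊤ := hki.lintegral_lt_top
    have hkm : Measurable k := by
      simp only [hk, kernelBound]
      fun_prop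
    obtain ⟨h1, h2⟩ := lintegral_indicator_kernel_lt_top hSm hSf hkm hkf
    have hm1 : Measurable fun z : E d × E d => S.indicator (1 : E d → ℝ≥0∞) z.1 * k (z.1 - z.2) :=
      ((measurable_one.indicator hSm).comp measurable_fst).mul (by fun_prop)
    refine lt_of_le_of_lt ?_ (ENNReal.add_lt_top.2 ⟨h1, h2⟩)
    rw [← lintegral_add_left hm1, modS_eq]
    apply lintegral_mono_ae
    filter_upwards [hg.profile, ae_ne hd] with z hz hne
    by_cases hzS : z.1 ∈ S ∨ z.2 ∈ S
    · have h3 : ENNReal.ofReal (youngS g z (quot s φ z)) ≤ k (z.1 - z.2) := by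
        apply ENNReal.ofReal_le_ofReal
        refine youngS_quot_le hg hs0 hs1 hne hz hN1 ?_
        rcases le_total ‖z.1 - z.2‖ 1 with h | h
        · rw [min_eq_left h]
          have := hL.dist_le_mul z.1 z.2
          rw [Real.dist_eq, dist_eq_norm] at this
          exact this.trans (by gcongr)
        · rw [min_eq_right h, mul_one]
          have h4 := hB z.1
          have h5 := hB z.2
          rw [Real.norm_eq_abs] at h4 h5
          have := abs_sub (φ z.1) (φ z.2)
          linarith
      refine h3.trans ?_
      rcases hzS with h | h
      · rw [indicator_of_mem h, Pi.one_apply, one_mul]; exact le_self_add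
      · rw [indicator_of_mem h (f := (1 : E d → ℝ≥0∞)), Pi.one_apply, one_mul]; exact le_add_self
    · push Not at hzS
      have h0 : quot s φ z = 0 := by
        simp [quot, delta, image_eq_zero_of_notMem_tsupport hzS.1,
          image_eq_zero_of_notMem_tsupport hzS.2]
      rw [h0]
      simp [youngS, primG]

theorem IsTest.memW0 (hs0 : 0 < s) (hs1 : s < 1) {U : Set (E d)} {φ : E d → ℝ} (h : IsTest U φ) :
    MemW0 g s U φ := by
  rw [memW0_iff hd hg]
  refine ⟨h.memW hd hg hs0 hs1, fun η hη => ⟨φ, h, ?_⟩⟩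
  have : modW g s (fun x => φ x - φ x) = 0 := by
    simp [modW, modG, modS, delta, primG]
  rw [this]
  exact zero_le

end Test

/-! ### The space `W^{s,G}_0(U)` -/

theorem IsTest.add {U : Set (E d)} {φ χ : E d → ℝ} (h1 : IsTest U φ) (h2 : IsTest U χ) :
    IsTest U (fun x => φ x + χ x) :=
  ⟨h1.1.add h2.1, h1.2.1.add h2.2.1, (tsupport_add φ χ).trans (union_subset h1.2.2 h2.2.2)⟩

theorem IsTest.const_mul {U : Set (E d)} {φ : E d → ℝ} (c : ℝ) (h1 : IsTest U φ) :
    IsTest U (fun x => c * φ x) :=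
  ⟨contDiff_const.mul h1.1, h1.2.1.mul_left, (tsupport_mul_subset_right (f := fun _ => c)).trans
    h1.2.2⟩

theorem exists_pos_mul_add_le {K η : ℝ≥0∞} (hK : K ≠ ⊤) (hη : 0 < η) :
    ∃ δ : ℝ≥0∞, 0 < δ ∧ K * (δ + δ) ≤ η := by
  obtain ⟨n, hn, h⟩ := ENNReal.exists_nnreal_pos_mul_lt (a := 2 * K) (b := η)
    (ENNReal.mul_ne_top (by simp) hK) hη.ne'
  refine ⟨n, by exact_mod_cast hn, le_trans (le_of_eq ?_) h.le⟩
  ring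

theorem MemW0.mono {U V : Set (E d)} {u : E d → ℝ} (h : MemW0 g s U u) (hUV : U ⊆ V) :
    MemW0 g s V u :=
  ⟨h.1, fun η hη => by
    obtain ⟨φ, a, b, c, e⟩ := h.2 η hη
    exact ⟨φ, a, b, c.trans hUV, e⟩⟩

theorem ae_pair {P : E d → Prop} (h : ∀ᵐ x, P x) : ∀ᵐ z : E d × E d, P z.1 ∧ P z.2 :=
  (Measure.quasiMeasurePreserving_fst.ae h).and (Measure.quasiMeasurePreserving_snd.ae h)

section Space

variable (hd : 0 < d) (hg : IsAdmissible gl gu kl ku g)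
include hd hg

theorem MemW0.add {U : Set (E d)} {u v : E d → ℝ} (hu : MemW0 g s U u) (hv : MemW0 g s U v) :
    MemW0 g s U (fun x => u x + v x) := by
  rw [memW0_iff hd hg] at *
  refine ⟨hu.1.add hd hg hv.1, fun η hη => ?_⟩
  obtain ⟨δ, hδ, hle⟩ := exists_pos_mul_add_le
    (ENNReal.ofReal_ne_top (r := (2 : ℝ) ^ (gu + 1))) hη
  obtain ⟨φ, hφ, h1⟩ := hu.2 δ hδ
  obtain ⟨χ, hχ, h2⟩ := hv.2 δ hδ
  refine ⟨_, hφ.add hχ, ?_⟩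
  have h3 := modW_add_le (s := s) (u := fun x => u x - φ x) (v := fun x => v x - χ x) hd hg
    (hu.1.1.sub hφ.1.continuous.aemeasurable)
  have h4 : (fun x => u x + v x - (φ x + χ x)) = fun x => (u x - φ x) + (v x - χ x) := by
    ext x; ring
  rw [h4]
  exact h3.trans (le_trans (by gcongr) hle)

theorem MemW0.const_mul {U : Set (E d)} {u : E d → ℝ} (c : ℝ) (hu : MemW0 g s U u) :
    MemW0 g s U (fun x => c * u x) := by
  rw [memW0_iff hd hg] at *
  refine ⟨hu.1.const_mul hd hg c, fun η hη => ?_⟩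
  obtain ⟨δ, hδ, hle⟩ := exists_pos_mul_add_le
    (ENNReal.ofReal_ne_top (r := (max 1 |c|) ^ (gu + 1))) hη
  obtain ⟨φ, hφ, h1⟩ := hu.2 δ hδ
  refine ⟨_, hφ.const_mul c, ?_⟩
  have h3 := modW_const_mul_le (s := s) hd hg c (fun x => u x - φ x)
  have h4 : (fun x => c * u x - c * φ x) = fun x => c * (u x - φ x) := by
    ext x; ring
  rw [h4]
  exact h3.trans (le_trans (by gcongr; exact h1.trans le_self_add) hle)

theorem MemW0.neg {U : Set (E d)} {u : E d → ℝ} (hu : MemW0 g s U u) :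
    MemW0 g s U (fun x => -u x) := by
  have := hu.const_mul hd hg (-1)
  simpa only [neg_one_mul] using this

theorem MemW0.sub {U : Set (E d)} {u v : E d → ℝ} (hu : MemW0 g s U u) (hv : MemW0 g s U v) :
    MemW0 g s U (fun x => u x - v x) := by
  have := hu.add hd hg (hv.neg hd hg)
  simpa only [← sub_eq_add_neg] using this

/-- `W^{s,G}_0(U)` is closed under convergence in the modular. -/
theorem memW0_of_approx {U : Set (E d)} {u : E d → ℝ} (hu : MemW g s u)
    (h : ∀ η : ℝ≥0∞, 0 < η → ∃ v, MemW0 g s U v ∧ modW g s (fun x => u x - v x) ≤ η) :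
    MemW0 g s U u := by
  rw [memW0_iff hd hg]
  refine ⟨hu, fun η hη => ?_⟩
  obtain ⟨δ, hδ, hle⟩ := exists_pos_mul_add_le
    (ENNReal.ofReal_ne_top (r := (2 : ℝ) ^ (gu + 1))) hη
  obtain ⟨v, hv, h1⟩ := h δ hδ
  obtain ⟨φ, hφ, h2⟩ := ((memW0_iff hd hg).1 hv).2 δ hδ
  refine ⟨φ, hφ, ?_⟩
  have h3 := modW_add_le (s := s) (u := fun x => u x - v x) (v := fun x => v x - φ x) hd hg
    (hu.1.sub hv.1.1)
  have h4 : (fun x => u x - φ x) = fun x => (u x - v x) + (v x - φ x) := by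
    ext x; ring
  rw [h4]
  exact h3.trans (le_trans (by gcongr) hle)

/-- Elements of `W^{s,G}_0(U)` vanish off `U`: there the approximating test functions do not
contribute to `u - φ`, so that the modular of `u` is arbitrarily small. -/
theorem MemW0.ae_eq_zero {U : Set (E d)} (hU : MeasurableSet U) {u : E d → ℝ}
    (hu : MemW0 g s U u) : ∀ᵐ x, x ∉ U → u x = 0 := by
  rw [memW0_iff hd hg] at hu
  have h1 : ∫⁻ x in Uᶜ, ENNReal.ofReal (youngG g x (u x)) = 0 := by
    refine le_antisymm (le_of_forall_gt fun η hη => ?_) zero_le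
    obtain ⟨δ, hδ, hδη⟩ := exists_between hη
    obtain ⟨φ, hφ, h2⟩ := hu.2 δ hδ
    refine lt_of_le_of_lt ?_ hδη
    refine le_trans ?_ ((le_self_add : modG g _ ≤ _).trans h2)
    rw [modG_eq]
    refine le_trans (le_of_eq ?_) (setLIntegral_le_lintegral Uᶜ _)
    refine setLIntegral_congr_fun hU.compl fun x hx => ?_
    have : φ x = 0 := image_eq_zero_of_notMem_tsupport fun hc => hx (hφ.2.2 hc)
    simp only [this, sub_zero]
  have hm := (hg.famG.aemeasurable_comp hu.1.1).ennreal_ofReal.restrict (s := Uᶜ)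
  rw [lintegral_eq_zero_iff' hm, EventuallyEq, ae_restrict_iff' hU.compl] at h1
  filter_upwards [h1, hg.famG.young] with x hx hY hxU
  have h2 := hx hxU
  by_contra hne
  have := hY.pos hne
  simp only [Pi.zero_apply, ENNReal.ofReal_eq_zero] at h2
  linarith

theorem MemW0.exists_seq {U : Set (E d)} {u : E d → ℝ} (hu : MemW0 g s U u) :
    ∃ φ : ℕ → E d → ℝ, (∀ n, IsTest U (φ n)) ∧
      ∀ n, modW g s (fun x => u x - φ n x) ≤ ENNReal.ofReal (YoungFamily.rate gu n) := by
  rw [memW0_iff hd hg] at hu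
  have := fun n => hu.2 _ (ENNReal.ofReal_pos.2 (YoungFamily.rate_pos gu n))
  choose φ h1 h2 using this
  exact ⟨φ, h1, h2⟩

/-- Dominated convergence in `W^{s,G}`. -/
theorem tendsto_modW_zero {w y : ℕ → E d → ℝ} {Y : E d → ℝ}
    (hw : ∀ n, AEMeasurable (w n)) (hy : ∀ n, AEMeasurable (y n))
    (hlim : ∀ᵐ x, Tendsto (fun n => w n x) atTop (𝓝 0))
    (hle : ∀ n x, |w n x| ≤ |y n x| + |Y x|)
    (hle' : ∀ n x x', |w n x - w n x'| ≤ |y n x - y n x'| + |Y x - Y x'|)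
    (hy0 : Tendsto (fun n => modW g s (y n)) atTop (𝓝 0)) (hY : MemW g s Y) :
    Tendsto (fun n => modW g s (w n)) atTop (𝓝 0) := by
  have hyG : Tendsto (fun n => modG g (y n)) atTop (𝓝 0) :=
    tendsto_of_tendsto_of_tendsto_of_le_of_le tendsto_const_nhds hy0 (fun _ => zero_le)
      (fun _ => le_self_add)
  have hyS : Tendsto (fun n => modS g s (y n)) atTop (𝓝 0) :=
    tendsto_of_tendsto_of_tendsto_of_le_of_le tendsto_const_nhds hy0 (fun _ => zero_le)
      (fun _ => le_add_self)
  have h1 : Tendsto (fun n => modG g (w n)) atTop (𝓝 0) :=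
    hg.famG.tendsto_modular_zero hw hy hlim (fun n => Eventually.of_forall (hle n)) hyG hY.2.1
  have h2 : Tendsto (fun n => modS g s (w n)) atTop (𝓝 0) := by
    refine (hg.famS hd).tendsto_modular_zero (fun n => aemeasurable_quot (hw n))
      (fun n => aemeasurable_quot (hy n)) ?_ (fun n => Eventually.of_forall fun z => ?_) hyS hY.2.2
    · filter_upwards [ae_pair hlim] with z hz
      have := (hz.1.sub hz.2).div_const (‖z.1 - z.2‖ ^ s)
      rw [sub_zero, zero_div] at this
      exact this
    · simp only [quot, delta, abs_div]
      rw [← add_div]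
      gcongr
      exact hle' n _ _
  have := h1.add h2
  rwa [add_zero] at this

end Space

/-! ### Lattice operations -/

/-- A smooth approximation of `|t|`, vanishing at `0`. -/
def softAbs (ε t : ℝ) : ℝ := √(t ^ 2 + ε ^ 2) - ε

theorem softAbs_zero {ε : ℝ} (hε : 0 ≤ ε) : softAbs ε 0 = 0 := by
  simp [softAbs, Real.sqrt_sq hε]

theorem abs_softAbs_sub_le (ε a b : ℝ) : |softAbs ε a - softAbs ε b| ≤ |a - b| := by
  set A := √(a ^ 2 + ε ^ 2) with hA
  set B := √(b ^ 2 + ε ^ 2) with hB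
  have hAa : |a| ≤ A := Real.abs_le_sqrt (by nlinarith [sq_nonneg ε])
  have hBb : |b| ≤ B := Real.abs_le_sqrt (by nlinarith [sq_nonneg ε])
  have hA2 : A ^ 2 = a ^ 2 + ε ^ 2 := Real.sq_sqrt (by positivity)
  have hB2 : B ^ 2 = b ^ 2 + ε ^ 2 := Real.sq_sqrt (by positivity)
  have h1 : softAbs ε a - softAbs ε b = A - B := by simp only [softAbs, ← hA, ← hB]; ring
  rw [h1]
  have hA0 : 0 ≤ A := Real.sqrt_nonneg _
  have hB0 : 0 ≤ B := Real.sqrt_nonneg _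
  rcases (add_nonneg hA0 hB0).eq_or_lt with h0 | h0
  · have hA' : A = 0 := by linarith
    have hB' : B = 0 := by linarith
    rw [hA', hB', sub_self, abs_zero]
    exact abs_nonneg _
  · refine le_of_mul_le_mul_right ?_ h0
    calc |A - B| * (A + B) = |(A - B) * (A + B)| := by rw [abs_mul, abs_of_pos h0]
      _ = |(a - b) * (a + b)| := by congr 1; nlinarith
      _ = |a - b| * |a + b| := abs_mul _ _
      _ ≤ |a - b| * (A + B) := by
        gcongr
        exact (abs_add_le a b).trans (add_le_add hAa hBb)

theorem abs_softAbs_le {ε : ℝ} (hε : 0 ≤ ε) (a : ℝ) : |softAbs ε a| ≤ |a| := by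
  have := abs_softAbs_sub_le ε a 0
  rwa [softAbs_zero hε, sub_zero, sub_zero] at this

theorem contDiff_softAbs {ε : ℝ} (hε : 0 < ε) : ContDiff ℝ ∞ (softAbs ε) := by
  unfold softAbs
  refine ContDiff.sub (ContDiff.sqrt (by fun_prop) fun t => ?_) contDiff_const
  positivity

theorem continuous_softAbs : Continuous (fun z : ℝ × ℝ => softAbs z.1 z.2) := by
  unfold softAbs
  fun_prop

theorem IsTest.lattice {U V : Set (E d)} {φ χ : E d → ℝ} {ε : ℝ} (hε : 0 < ε) (h1 : IsTest V φ)
    (h2 : IsTest U χ) :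
    IsTest U (fun x => softAbs ε (φ x) + softAbs ε (χ x) - softAbs ε (φ x - χ x)) := by
  have hsub : Function.support
      (fun x => softAbs ε (φ x) + softAbs ε (χ x) - softAbs ε (φ x - χ x)) ⊆
      Function.support χ := by
    intro x hx hc
    apply hx
    simp only
    rw [hc, sub_zero, softAbs_zero hε.le]
    ring
  refine ⟨?_, h2.2.1.mono hsub, (closure_mono hsub).trans h2.2.2⟩
  have := contDiff_softAbs hε
  exact ((this.comp h1.1).add (this.comp h2.1)).sub (this.comp (h1.1.sub h2.1))

theorem max_zero_eq (a : ℝ) : max a 0 = 1 / 2 * (a + |a|) := by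
  rcases le_total 0 a with h | h
  · rw [max_eq_left h, abs_of_nonneg h]; ring
  · rw [max_eq_right h, abs_of_nonpos h]; ring

theorem tendsto_rate (hq : 0 < gu) :
    Tendsto (fun n => ENNReal.ofReal (YoungFamily.rate gu n)) atTop (𝓝 0) := by
  rw [← ENNReal.ofReal_zero]
  refine ENNReal.tendsto_ofReal ?_
  refine squeeze_zero (fun n => (YoungFamily.rate_pos gu n).le) (fun n => ?_)
    (tendsto_pow_atTop_nhds_zero_of_lt_one (r := (1 / 2 : ℝ)) (by norm_num) (by norm_num))
  unfold YoungFamily.rate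
  refine mul_le_of_le_one_left (by positivity) ?_
  exact Real.rpow_le_one_of_one_le_of_nonpos (one_le_pow₀ one_le_two) (by linarith)

section Lattice

variable (hd : 0 < d) (hg : IsAdmissible gl gu kl ku g)
include hd hg

theorem modW_le_of_contraction {u v : E d → ℝ} (h1 : ∀ x, |u x| ≤ |v x|)
    (h2 : ∀ x y, |u x - u y| ≤ |v x - v y|) : modW g s u ≤ modW g s v :=
  add_le_add (hg.famG.modular_mono (Eventually.of_forall h1))
    ((hg.famS hd).modular_mono (Eventually.of_forall fun _ => abs_quot_le_abs_quot (h2 _ _)))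

theorem MemW.abs {u : E d → ℝ} (hu : MemW g s u) : MemW g s (fun x => |u x|) := by
  rw [memW_iff] at *
  exact ⟨hu.1.abs, (modW_le_of_contraction hd hg (by simp)
    (fun x y => abs_abs_sub_abs_le _ _)).trans_lt hu.2⟩

theorem MemW.posPart {u : E d → ℝ} (hu : MemW g s u) : MemW g s (fun x => max (u x) 0) := by
  simp only [max_zero_eq]
  exact (hu.add hd hg (hu.abs hd hg)).const_mul hd hg _

theorem modW_congr {u v : E d → ℝ} (h : ∀ᵐ x, u x = v x) : modW g s u = modW g s v := by
  unfold modW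
  congr 1
  · exact hg.famG.modular_congr h
  · refine (hg.famS hd).modular_congr ?_
    filter_upwards [ae_pair h] with z hz
    simp only [delta, hz.1, hz.2]

theorem MemW0.congr {U : Set (E d)} {u v : E d → ℝ} (hu : MemW0 g s U u) (h : ∀ᵐ x, u x = v x) :
    MemW0 g s U v := by
  rw [memW0_iff hd hg, memW_iff] at *
  refine ⟨⟨hu.1.1.congr h, (modW_congr hd hg h) ▸ hu.1.2⟩, fun η hη => ?_⟩
  obtain ⟨φ, hφ, h1⟩ := hu.2 η hη
  refine ⟨φ, hφ, ?_⟩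
  rwa [modW_congr hd hg (v := fun x => u x - φ x)]
  filter_upwards [h] with x hx
  rw [hx]

/-- The map `v ↦ |v|` and its smooth approximations are jointly continuous along sequences that
converge both in the modular and almost everywhere. -/
theorem tendsto_modW_softAbs {v : E d → ℝ} {φ : ℕ → E d → ℝ} {ε : ℕ → ℝ} (hv : MemW g s v)
    (hφ : ∀ n, AEMeasurable (φ n)) (hε : ∀ n, 0 ≤ ε n) (hε0 : Tendsto ε atTop (𝓝 0))
    (hae : ∀ᵐ x, Tendsto (fun n => v x - φ n x) atTop (𝓝 0))
    (h0 : Tendsto (fun n => modW g s (fun x => v x - φ n x)) atTop (𝓝 0)) :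
    Tendsto (fun n => modW g s (fun x => |v x| - softAbs (ε n) (φ n x))) atTop (𝓝 0) := by
  refine tendsto_modW_zero hd hg (y := fun n x => v x - φ n x) (Y := fun x => 2 * v x)
    (fun n => ?_) (fun n => hv.1.sub (hφ n)) ?_ ?_ ?_ h0 (hv.const_mul hd hg 2)
  · refine hv.1.abs.sub ?_
    exact (continuous_softAbs.comp (by fun_prop :
      Continuous fun t : ℝ => (ε n, t))).measurable.comp_aemeasurable (hφ n)
  · filter_upwards [hae] with x hx
    have h1 : Tendsto (fun n => φ n x) atTop (𝓝 (v x)) := by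
      have := (tendsto_const_nhds (x := v x)).sub hx
      simpa using this
    have h2 := (continuous_softAbs.tendsto (0, v x)).comp (hε0.prodMk_nhds h1)
    have h3 : softAbs 0 (v x) = |v x| := by simp [softAbs, Real.sqrt_sq_eq_abs]
    have h4 := (tendsto_const_nhds (x := |v x|)).sub h2
    simp only [h3, sub_self] at h4
    exact h4
  · intro n x
    have h1 := abs_softAbs_le (hε n) (φ n x)
    have h2 := abs_sub (|v x|) (softAbs (ε n) (φ n x))
    have h3 := abs_sub_abs_le_abs_sub (φ n x) (v x)
    rw [abs_sub_comm] at h3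
    rw [abs_abs] at h2
    rw [abs_mul, abs_two]
    linarith
  · intro n x x'
    have h1 := abs_softAbs_sub_le (ε n) (φ n x) (φ n x')
    have h2 := abs_sub (|v x| - |v x'|) (softAbs (ε n) (φ n x) - softAbs (ε n) (φ n x'))
    have h3 := abs_abs_sub_abs_le (v x) (v x')
    have h4 := abs_sub_abs_le_abs_sub (φ n x - φ n x') (v x - v x')
    rw [abs_sub_comm (φ n x - φ n x')] at h4
    have h5 : |v x| - softAbs (ε n) (φ n x) - (|v x'| - softAbs (ε n) (φ n x')) =
      (|v x| - |v x'|) - (softAbs (ε n) (φ n x) - softAbs (ε n) (φ n x')) := by ring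
    have h6 : v x - φ n x - (v x' - φ n x') = v x - v x' - (φ n x - φ n x') := by ring
    rw [h5, h6, ← mul_sub, abs_mul, abs_two]
    linarith

/-- The combination `|v| + |z| - |v - z|` of a function `v` of the whole space with `z` from
`W^{s,G}_0(U)` stays in `W^{s,G}_0(U)`: its smooth version vanishes wherever the approximant of
`z` does. -/
theorem MemW0.lattice {U : Set (E d)} {v z : E d → ℝ} (hv : MemW0 g s univ v)
    (hz : MemW0 g s U z) : MemW0 g s U (fun x => |v x| + |z x| - |v x - z x|) := by
  obtain ⟨φ, hφ, hφ1⟩ := hv.exists_seq hd hg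
  obtain ⟨χ, hχ, hχ1⟩ := hz.exists_seq hd hg
  have hφm : ∀ n, AEMeasurable (φ n) := fun n => (hφ n).1.continuous.aemeasurable
  have hχm : ∀ n, AEMeasurable (χ n) := fun n => (hχ n).1.continuous.aemeasurable
  have hr := tendsto_rate hg.famG.q_pos
  have lim : ∀ {a : E d → ℝ} {b : ℕ → E d → ℝ},
      (∀ n, modW g s (fun x => a x - b n x) ≤ ENNReal.ofReal (YoungFamily.rate gu n)) →
      Tendsto (fun n => modW g s (fun x => a x - b n x)) atTop (𝓝 0) := fun h =>
    tendsto_of_tendsto_of_tendsto_of_le_of_le tendsto_const_nhds hr (fun _ => zero_le) h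
  have aφ := hg.famG.ae_tendsto_zero (z := fun n x => v x - φ n x)
    (fun n => hv.1.1.sub (hφm n)) (fun n => le_self_add.trans (hφ1 n))
  have aχ := hg.famG.ae_tendsto_zero (z := fun n x => z x - χ n x)
    (fun n => hz.1.1.sub (hχm n)) (fun n => le_self_add.trans (hχ1 n))
  set ε : ℕ → ℝ := fun n => 1 / ((n : ℝ) + 1) with hε
  have hε0 : ∀ n, 0 < ε n := fun n => by simp only [hε]; positivity
  have hεl : Tendsto ε atTop (𝓝 0) := tendsto_one_div_add_atTop_nhds_zero_nat
  have T1 := tendsto_modW_softAbs hd hg hv.1 hφm (fun n => (hε0 n).le) hεl aφ (lim hφ1)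
  have T2 := tendsto_modW_softAbs hd hg hz.1 hχm (fun n => (hε0 n).le) hεl aχ (lim hχ1)
  set K := ENNReal.ofReal ((2 : ℝ) ^ (gu + 1)) with hK
  have hKt : K ≠ ⊤ := ENNReal.ofReal_ne_top
  have T3 : Tendsto (fun n => modW g s (fun x => |v x - z x| - softAbs (ε n) (φ n x - χ n x)))
      atTop (𝓝 0) := by
    refine tendsto_modW_softAbs hd hg (hv.1.sub hd hg hz.1) (fun n => (hφm n).sub (hχm n))
      (fun n => (hε0 n).le) hεl ?_ ?_
    · filter_upwards [aφ, aχ] with x h1 h2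
      have := h1.sub h2
      rw [sub_zero] at this
      refine this.congr fun n => ?_
      ring
    · have h1 := ENNReal.Tendsto.const_mul ((lim hφ1).add (lim hχ1)) (Or.inr hKt)
      rw [add_zero, mul_zero] at h1
      refine tendsto_of_tendsto_of_tendsto_of_le_of_le tendsto_const_nhds h1 (fun _ => zero_le)
        fun n => ?_
      have h2 := modW_sub_le (s := s) hd hg (u := fun x => v x - φ n x)
        (v := fun x => z x - χ n x) (hv.1.1.sub (hφm n))
      refine le_trans (le_of_eq ?_) h2
      congr 1; ext x; ring
  have hS : ∀ n, AEMeasurable (fun x => softAbs (ε n) (φ n x)) := fun n =>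
    (((contDiff_softAbs (hε0 n)).continuous).comp (hφ n).1.continuous).aemeasurable
  have hS' : ∀ n, AEMeasurable (fun x => softAbs (ε n) (χ n x)) := fun n =>
    (((contDiff_softAbs (hε0 n)).continuous).comp (hχ n).1.continuous).aemeasurable
  have T4 := ENNReal.Tendsto.const_mul ((ENNReal.Tendsto.const_mul (T1.add T2)
    (Or.inr hKt)).add T3) (Or.inr hKt)
  simp only [add_zero, mul_zero] at T4
  rw [memW0_iff hd hg]
  refine ⟨((hv.1.abs hd hg).add hd hg (hz.1.abs hd hg)).sub hd hg
    ((hv.1.sub hd hg hz.1).abs hd hg), fun η hη => ?_⟩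
  obtain ⟨n, hn⟩ := ((ENNReal.tendsto_nhds_zero.1 T4) η hη).exists
  refine ⟨_, (hφ n).lattice (hε0 n) (hχ n), le_trans ?_ hn⟩
  have m1 : AEMeasurable (fun x => |v x| - softAbs (ε n) (φ n x)) := hv.1.1.abs.sub (hS n)
  have m2 : AEMeasurable (fun x => |z x| - softAbs (ε n) (χ n x)) := hz.1.1.abs.sub (hS' n)
  have h1 := modW_add_le (s := s) hd hg (v := fun x => |z x| - softAbs (ε n) (χ n x)) m1
  have h2 := modW_sub_le (s := s) hd hg
    (u := fun x => (|v x| - softAbs (ε n) (φ n x)) + (|z x| - softAbs (ε n) (χ n x)))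
    (v := fun x => |v x - z x| - softAbs (ε n) (φ n x - χ n x)) (m1.add m2)
  refine le_trans (le_of_eq ?_) (h2.trans ?_)
  · congr 1; ext x; ring
  · rw [← hK] at h1 ⊢
    gcongr

theorem MemW0.abs {U : Set (E d)} {v : E d → ℝ} (hv : MemW0 g s U v) :
    MemW0 g s U (fun x => |v x|) := by
  have := ((hv.mono (subset_univ U)).lattice hd hg hv).const_mul hd hg (1 / 2)
  refine this.congr hd hg (Eventually.of_forall fun x => ?_)
  simp only [sub_self, abs_zero]
  ring

theorem MemW0.posPart {U : Set (E d)} {v : E d → ℝ} (hv : MemW0 g s U v) :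
    MemW0 g s U (fun x => max (v x) 0) := by
  simp only [max_zero_eq]
  exact (hv.add hd hg (hv.abs hd hg)).const_mul hd hg _

/-- `W^{s,G}_0(U)` is an order ideal of `W^{s,G}_0(ℝ^d)`. -/
theorem MemW0.of_le {U : Set (E d)} {v z : E d → ℝ} (hv : MemW0 g s univ v)
    (hz : MemW0 g s U z) (h0 : ∀ᵐ x, 0 ≤ v x) (hle : ∀ᵐ x, v x ≤ z x) : MemW0 g s U v := by
  refine ((hv.lattice hd hg hz).const_mul hd hg (1 / 2)).congr hd hg ?_
  filter_upwards [h0, hle] with x h1 h2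
  rw [abs_of_nonneg h1, abs_of_nonneg (h1.trans h2), abs_of_nonpos (by linarith)]
  ring

end Lattice

/-! ### Comparison -/

/-- A property of almost all pairs holds for some base point `y` off a bounded set and almost all
`x`. Functions that vanish off the set are recovered from their difference quotients with base
point `y`. -/
theorem exists_notMem_of_ae (hd : 0 < d) {Ω : Set (E d)} (hΩb : Bornology.IsBounded Ω)
    {Q : E d × E d → Prop} (hQ : ∀ᵐ z, Q z) {R : E d → Prop} (hR : ∀ᵐ y, R y) :
    ∃ y, y ∉ Ω ∧ R y ∧ ∀ᵐ x, Q (x, y) := by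
  have : Nonempty (Fin d) := ⟨⟨0, hd⟩⟩
  have h1 : ∀ᵐ z : E d × E d, Q z.swap :=
    (Measure.measurePreserving_swap (μ := (volume : Measure (E d)))
      (ν := (volume : Measure (E d)))).quasiMeasurePreserving.ae hQ
  have h2 : ∀ᵐ y : E d, ∀ᵐ x : E d, Q (x, y) := Measure.ae_ae_of_ae_prod h1
  by_contra hcon
  push Not at hcon
  have h3 : ∀ᵐ y : E d, y ∈ Ω := by
    filter_upwards [h2, hR] with y hy hRy
    by_contra hyΩ
    exact hcon y hyΩ hRy (hy.mono fun x hx => not_not.2 hx)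
  have h4 : volume (univ : Set (E d)) ≤ volume Ω := measure_mono_ae (h3.mono fun x hx _ => hx)
  rw [measure_univ_of_isAddLeftInvariant, top_le_iff] at h4
  exact hΩb.measure_lt_top.ne h4

/-- A function that vanishes off a bounded set and has vanishing difference quotients is zero. -/
theorem ae_eq_zero_of_quot (hd : 0 < d) {Ω : Set (E d)} (hΩb : Bornology.IsBounded Ω)
    {w : E d → ℝ} (hw : ∀ᵐ x, x ∉ Ω → w x = 0) (hq : ∀ᵐ z, quot s w z = 0) :
    ∀ᵐ x, w x = 0 := by
  have hQ : ∀ᵐ z : E d × E d, quot s w z = 0 ∧ z.1 ≠ z.2 := hq.and (ae_ne hd)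
  obtain ⟨y, hy, hwy, h⟩ := exists_notMem_of_ae hd hΩb hQ hw
  filter_upwards [h] with x hx
  have h1 : 0 < ‖x - y‖ ^ s := Real.rpow_pos_of_pos (norm_pos_iff.2 (sub_ne_zero.2 hx.2)) s
  have h2 := hx.1
  simp only [quot, delta] at h2
  rw [div_eq_zero_iff, hwy hy, sub_zero] at h2
  exact h2.resolve_right h1.ne'

/-- Monotonicity of `φ` against an increment `e` that has the sign of `a - b` and is no larger. -/
theorem IsYoung.gap_mul_nonneg {p q : ℝ} {Φ φ : ℝ → ℝ} (hY : IsYoung p q Φ φ) {a b e : ℝ}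
    (h1 : |e| ≤ |a - b|) (h2 : 0 ≤ e * (a - b)) :
    0 ≤ (φ a - φ b) * e ∧ ((φ a - φ b) * e = 0 → e = 0) := by
  rcases lt_trichotomy a b with h | h | h
  · have h3 := hY.strictMono h
    have h4 : e ≤ 0 := by
      by_contra hc
      push Not at hc
      nlinarith
    refine ⟨by nlinarith, fun h0 => ?_⟩
    exact (mul_eq_zero.1 h0).resolve_left (by linarith)
  · rw [h, sub_self, abs_zero] at h1
    have : e = 0 := abs_nonpos_iff.1 h1
    simp [this]
  · have h3 := hY.strictMono h
    have h4 : 0 ≤ e := by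
      by_contra hc
      push Not at hc
      nlinarith
    refine ⟨by nlinarith, fun h0 => ?_⟩
    exact (mul_eq_zero.1 h0).resolve_left (by linarith)

section Comparison

variable (hd : 0 < d) (hg : IsAdmissible gl gu kl ku g)
include hd hg

theorem integrable_opL {u v : E d → ℝ} (hu : MemW g s u) (hv : MemW g s v) :
    Integrable (fun z => derivS g z (quot s u z) * quot s v z) :=
  (hg.famS hd).integrable_deriv_mul (aemeasurable_quot hu.1) (aemeasurable_quot hv.1) hu.2.2 hv.2.2

theorem opL_add {u v w : E d → ℝ} (hu : MemW g s u) (hv : MemW g s v) (hw : MemW g s w) :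
    opL g s u (fun x => v x + w x) = opL g s u v + opL g s u w := by
  rw [opL_eq, opL_eq, opL_eq, ← integral_add (integrable_opL hd hg hu hv)
    (integrable_opL hd hg hu hw), quot_add]
  congr 1; ext z; ring

omit hd hg in
theorem opL_const_mul (u : E d → ℝ) (c : ℝ) (v : E d → ℝ) :
    opL g s u (fun x => c * v x) = c * opL g s u v := by
  rw [opL_eq, opL_eq, ← integral_const_mul, quot_mul]
  congr 1; ext z; ring

theorem opL_sub {u v w : E d → ℝ} (hu : MemW g s u) (hv : MemW g s v) (hw : MemW g s w) :
    opL g s u (fun x => v x - w x) = opL g s u v - opL g s u w := by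
  have := opL_add hd hg hu hv (hw.const_mul hd hg (-1))
  rw [opL_const_mul] at this
  simpa only [neg_one_mul, ← sub_eq_add_neg] using this

omit hd hg in
theorem opL_congr (u : E d → ℝ) {v w : E d → ℝ} (h : ∀ᵐ x, v x = w x) :
    opL g s u v = opL g s u w := by
  rw [opL_eq, opL_eq]
  refine integral_congr_ae ?_
  filter_upwards [ae_pair h] with z hz
  simp only [quot, delta, hz.1, hz.2]

/-- Comparison principle, from the T-monotonicity of the operator. -/
theorem ae_le_of_opL_le {Ω : Set (E d)} (hΩb : Bornology.IsBounded Ω) {a b : E d → ℝ}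
    (ha : MemW g s a) (hb : MemW g s b) (h0 : ∀ᵐ x, x ∉ Ω → max (a x - b x) 0 = 0)
    (h : opL g s a (fun x => max (a x - b x) 0) ≤ opL g s b (fun x => max (a x - b x) 0)) :
    ∀ᵐ x, a x ≤ b x := by
  set k : E d → ℝ := fun x => max (a x - b x) 0 with hk
  have hkW : MemW g s k := (ha.sub hd hg hb).posPart hd hg
  have hgap : ∀ᵐ z, 0 ≤ (derivS g z (quot s a z) - derivS g z (quot s b z)) * quot s k z ∧
      ((derivS g z (quot s a z) - derivS g z (quot s b z)) * quot s k z = 0 →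
        quot s k z = 0) := by
    filter_upwards [(hg.famS hd).young] with z hY
    have hpt : ∀ p q : ℝ, |max p 0 - max q 0| ≤ |p - q| ∧ 0 ≤ (max p 0 - max q 0) * (p - q) := by
      intro p q
      refine ⟨abs_max_sub_max_le_abs p q 0, ?_⟩
      rcases le_total p q with h | h
      · have := max_le_max_right 0 h
        nlinarith
      · have := max_le_max_right 0 h
        nlinarith
    have hq : quot s a z - quot s b z = quot s (fun x => a x - b x) z := by rw [quot_sub]
    refine hY.gap_mul_nonneg ?_ ?_
    · rw [hq]
      exact abs_quot_le_abs_quot (hpt _ _).1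
    · rw [hq]
      simp only [quot, delta, hk]
      rw [div_mul_div_comm]
      exact div_nonneg (hpt _ _).2 (mul_self_nonneg _)
  have hi := (hg.famS hd).integrable_gap (aemeasurable_quot (s := s) ha.1) (aemeasurable_quot hb.1)
    (aemeasurable_quot hkW.1) ha.2.2 hb.2.2 hkW.2.2
  have h1 : ∫ z, (derivS g z (quot s a z) - derivS g z (quot s b z)) * quot s k z ≤ 0 := by
    simp only [sub_mul]
    rw [integral_sub (integrable_opL hd hg ha hkW) (integrable_opL hd hg hb hkW), ← opL_eq,
      ← opL_eq]
    linarith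
  have h2 := le_antisymm h1 (integral_nonneg_of_ae (hgap.mono fun z hz => hz.1))
  rw [integral_eq_zero_iff_of_nonneg_ae (hgap.mono fun z hz => hz.1) hi] at h2
  have h3 : ∀ᵐ z, quot s k z = 0 := by
    filter_upwards [h2, hgap] with z hz1 hz2
    exact hz2.2 hz1
  filter_upwards [ae_eq_zero_of_quot hd hΩb h0 h3] with x hx
  have := le_max_left (a x - b x) 0
  have hx' : max (a x - b x) 0 = 0 := hx
  linarith

end Comparison

variable {Ω : Set (E d)}

/-! ### The pairing with `L^{Ĝ^*}(Ω)` -/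

theorem conjG_mono {x y : E d} {r r' : ℝ} (h : r ≤ r') : conjG g x y r ≤ conjG g x y r' := by
  refine iSup₂_mono fun ρ hρ => ENNReal.ofReal_le_ofReal ?_
  have := mul_le_mul_of_nonneg_right h hρ.le
  linarith

/-- Young's inequality. -/
theorem ofReal_mul_le_conjG_add (x y : E d) (r ρ : ℝ) (hρ : 0 ≤ ρ) :
    ENNReal.ofReal (r * ρ) ≤ conjG g x y r + ENNReal.ofReal (primG g x y ρ) := by
  rcases hρ.eq_or_lt with rfl | hρ
  · simp
  · have h1 : ENNReal.ofReal (r * ρ - primG g x y ρ) ≤ conjG g x y r :=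
      le_iSup₂ (f := fun (ρ : ℝ) (_ : 0 < ρ) => ENNReal.ofReal (r * ρ - primG g x y ρ)) ρ hρ
    calc ENNReal.ofReal (r * ρ) = ENNReal.ofReal ((r * ρ - primG g x y ρ) + primG g x y ρ) := by
          rw [sub_add_cancel]
      _ ≤ _ := ENNReal.ofReal_add_le.trans (add_le_add_left h1 _)

/-- The conjugate inherits the doubling property from the lower growth exponent. -/
theorem conjG_two_mul_le {x y : E d} (hh : IsProfile gl gu kl ku (g x y)) (hgl : 0 < gl)
    (hgu : gl ≤ gu) (r : ℝ) :
    conjG g x y (2 * r) ≤ ENNReal.ofReal ((2 ^ gl⁻¹) ^ (gl + 1)) * conjG g x y r := by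
  have hY := hh.isYoung hgl hgu
  -- As `l ^ gl = 2`, the choice `ρ = l σ` gives `2 r ρ - G(ρ) ≤ l ^ (gl + 1) (r σ - G(σ))`.
  set l : ℝ := 2 ^ gl⁻¹ with hl
  have hl1 : 1 ≤ l := Real.one_le_rpow one_le_two (by positivity)
  have hl0 : 0 < l := by linarith
  have hlg : l ^ gl = 2 := by
    rw [hl, ← Real.rpow_mul zero_le_two, inv_mul_cancel₀ hgl.ne', Real.rpow_one]
  refine iSup₂_le fun ρ hρ => ?_
  have hσ : 0 < ρ / l := by positivity
  have h1 : ENNReal.ofReal (r * (ρ / l) - primG g x y (ρ / l)) ≤ conjG g x y r :=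
    le_iSup₂ (f := fun (ρ : ℝ) (_ : 0 < ρ) => ENNReal.ofReal (r * ρ - primG g x y ρ)) _ hσ
  refine le_trans ?_ (mul_le_mul_right h1 _)
  rw [← ENNReal.ofReal_mul (by positivity)]
  apply ENNReal.ofReal_le_ofReal
  have h2 := hY.le_scale l (ρ / l) hl1
  rw [mul_div_cancel₀ _ hl0.ne', abs_of_pos hσ, abs_of_pos hρ] at h2
  have h3 : l ^ (gl + 1) * (r * (ρ / l)) = 2 * r * ρ := by
    rw [Real.rpow_add_one hl0.ne', hlg]
    field_simp
  unfold primG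
  rw [mul_sub, h3]
  linarith

theorem MemLstar.mono {f h : E d → ℝ} (hh : MemLstar g Ω h)
    (hf : AEMeasurable f (volume.restrict Ω))
    (hle : ∀ᵐ x ∂(volume.restrict Ω), |f x| ≤ |h x|) : MemLstar g Ω f :=
  ⟨hf, (lintegral_mono_ae (hle.mono fun _ hx => conjG_mono hx)).trans_lt hh.2⟩

/-- Splitting `Ω` according to which of `|f|` and `|h|` is the larger reduces the claim to the
doubling property, and needs no measurability of the conjugate function. -/
theorem MemLstar.add (hg : IsAdmissible gl gu kl ku g) {f h : E d → ℝ} (hf : MemLstar g Ω f)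
    (hh : MemLstar g Ω h) : MemLstar g Ω (fun x => f x + h x) := by
  refine ⟨hf.1.add hh.1, ?_⟩
  set A : Set (E d) := {x | |h x| ≤ |f x|} with hA
  have hAm : NullMeasurableSet A (volume.restrict Ω) := nullMeasurableSet_le hh.1.abs hf.1.abs
  set C := ENNReal.ofReal ((2 ^ gl⁻¹) ^ (gl + 1)) with hC
  have hCt : C ≠ ⊤ := ENNReal.ofReal_ne_top
  have hsplit : volume.restrict Ω =
      (volume.restrict Ω).restrict A + (volume.restrict Ω).restrict Aᶜ := by
    rw [← Measure.restrict_union₀ disjoint_compl_right.aedisjoint hAm.compl, union_compl_self,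
      Measure.restrict_univ]
  rw [hsplit, lintegral_add_measure, ENNReal.add_lt_top]
  have hprof : ∀ᵐ x ∂(volume.restrict Ω), IsProfile gl gu kl ku (g x x) :=
    ae_restrict_of_ae hg.profile_diag
  have key : ∀ (B : Set (E d)) (k : E d → ℝ), NullMeasurableSet B (volume.restrict Ω) →
      MemLstar g Ω k → (∀ x ∈ B, |f x + h x| ≤ 2 * |k x|) →
      ∫⁻ x in B, conjG g x x |f x + h x| ∂(volume.restrict Ω) < ⊤ := by
    intro B k hB hk hle
    have h1 : ∫⁻ x in B, conjG g x x |f x + h x| ∂(volume.restrict Ω) ≤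
        ∫⁻ x in B, C * conjG g x x |k x| ∂(volume.restrict Ω) := by
      apply lintegral_mono_ae
      filter_upwards [ae_restrict_of_ae hprof, ae_restrict_mem₀ hB] with x hx hxB
      exact (conjG_mono (hle x hxB)).trans (conjG_two_mul_le hx hg.gl_pos hg.gl_le _)
    refine h1.trans_lt (((setLIntegral_le_lintegral _ _).trans_eq
      (lintegral_const_mul' _ _ hCt)).trans_lt (ENNReal.mul_lt_top hCt.lt_top hk.2))
  constructor
  · refine key A f hAm hf fun x hx => ?_
    have h1 : |h x| ≤ |f x| := hx
    have := abs_add_le (f x) (h x)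
    linarith
  · refine key Aᶜ h hAm.compl hh fun x hx => ?_
    have h1 : |f x| < |h x| := not_le.1 hx
    have := abs_add_le (f x) (h x)
    linarith

/-- The modular of the conjugate function. -/
def modStar (g : E d → E d → ℝ → ℝ) (Ω : Set (E d)) (f : E d → ℝ) : ℝ≥0∞ :=
  ∫⁻ x in Ω, conjG g x x |f x|

section Pairing

variable (hg : IsAdmissible gl gu kl ku g)
include hg

theorem lintegral_mul_le {f v : E d → ℝ} (hv : AEMeasurable v) :
    ∫⁻ x in Ω, ENNReal.ofReal (|f x| * |v x|) ≤ modStar g Ω f + modG g v := by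
  have h1 : ∫⁻ x in Ω, ENNReal.ofReal (|f x| * |v x|) ≤
      ∫⁻ x in Ω, (conjG g x x |f x| + ENNReal.ofReal (youngG g x (v x))) :=
    lintegral_mono fun x => ofReal_mul_le_conjG_add x x _ _ (abs_nonneg _)
  rw [lintegral_add_right' _ (hg.famG.aemeasurable_comp hv).ennreal_ofReal.restrict] at h1
  exact h1.trans (add_le_add le_rfl (setLIntegral_le_lintegral _ _))

theorem integrable_pairing {f v : E d → ℝ} (hf : MemLstar g Ω f) (hv : AEMeasurable v)
    (hv' : modG g v < ⊤) : Integrable (fun x => f x * v x) (volume.restrict Ω) := by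
  refine ⟨(hf.1.mul hv.restrict).aestronglyMeasurable, ?_⟩
  rw [hasFiniteIntegral_iff_norm]
  simp only [norm_mul, Real.norm_eq_abs]
  exact (lintegral_mul_le hg hv).trans_lt (ENNReal.add_lt_top.2 ⟨hf.2, hv'⟩)

theorem abs_pairing_le {f v : E d → ℝ} (hf : MemLstar g Ω f) (hv : AEMeasurable v)
    {l : ℝ} (hl : 0 < l) (h : modG g (fun x => v x / l) ≤ 1) :
    |pairing Ω f v| ≤ ((modStar g Ω f).toReal + 1) * l := by
  have hi := integrable_pairing hg hf (hv.div_const l) (h.trans_lt ENNReal.one_lt_top)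
  have h1 : pairing Ω f v = l * ∫ x in Ω, f x * (v x / l) := by
    rw [pairing, ← integral_const_mul]
    congr 1; ext x; field_simp
  have h2 : |∫ x in Ω, f x * (v x / l)| ≤ (modStar g Ω f).toReal + 1 := by
    rw [← Real.norm_eq_abs]
    refine (norm_integral_le_integral_norm _).trans ?_
    rw [integral_norm_eq_lintegral_enorm hi.1]
    have h3 : ∫⁻ x in Ω, ‖f x * (v x / l)‖ₑ ≤ modStar g Ω f + 1 := by
      refine le_trans (le_of_eq ?_) ((lintegral_mul_le (Ω := Ω) (f := f) hg (hv.div_const l)).trans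
        (add_le_add le_rfl h))
      congr 1; ext x
      rw [← ofReal_norm, norm_mul, Real.norm_eq_abs, Real.norm_eq_abs]
    have h4 : modStar g Ω f + 1 ≠ ⊤ := ENNReal.add_ne_top.2 ⟨hf.2.ne, ENNReal.one_ne_top⟩
    refine (ENNReal.toReal_mono h4 h3).trans (le_of_eq ?_)
    have hfin : modStar g Ω f ≠ ⊤ := hf.2.ne
    rw [ENNReal.toReal_add hfin ENNReal.one_ne_top, ENNReal.toReal_one]
  rw [h1, abs_mul, abs_of_pos hl, mul_comm]
  gcongr

theorem pairing_add {f v w : E d → ℝ} (hf : MemLstar g Ω f) (hv : MemW g s v) (hw : MemW g s w) :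
    pairing Ω f (fun x => v x + w x) = pairing Ω f v + pairing Ω f w := by
  unfold pairing
  rw [← integral_add (integrable_pairing hg hf hv.1 hv.2.1) (integrable_pairing hg hf hw.1 hw.2.1)]
  congr 1; ext x; ring

theorem pairing_sub {f v w : E d → ℝ} (hf : MemLstar g Ω f) (hv : MemW g s v) (hw : MemW g s w) :
    pairing Ω f (fun x => v x - w x) = pairing Ω f v - pairing Ω f w := by
  unfold pairing
  rw [← integral_sub (integrable_pairing hg hf hv.1 hv.2.1) (integrable_pairing hg hf hw.1 hw.2.1)]
  congr 1; ext x; ring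

omit hg in
theorem pairing_const_mul (f : E d → ℝ) (c : ℝ) (v : E d → ℝ) :
    pairing Ω f (fun x => c * v x) = c * pairing Ω f v := by
  unfold pairing
  rw [← integral_const_mul]
  congr 1; ext x; ring

theorem pairing_add_left {f h v : E d → ℝ} (hf : MemLstar g Ω f) (hh : MemLstar g Ω h)
    (hv : MemW g s v) : pairing Ω (fun x => f x + h x) v = pairing Ω f v + pairing Ω h v := by
  unfold pairing
  rw [← integral_add (integrable_pairing hg hf hv.1 hv.2.1) (integrable_pairing hg hh hv.1 hv.2.1)]
  congr 1; ext x; ring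

theorem pairing_mono_left {f h v : E d → ℝ} (hf : MemLstar g Ω f) (hh : MemLstar g Ω h)
    (hv : MemW g s v) (hle : ∀ᵐ x ∂(volume.restrict Ω), f x * v x ≤ h x * v x) :
    pairing Ω f v ≤ pairing Ω h v :=
  integral_mono_ae (integrable_pairing hg hf hv.1 hv.2.1) (integrable_pairing hg hh hv.1 hv.2.1) hle

omit hg in
theorem pairing_congr (f : E d → ℝ) {v w : E d → ℝ} (h : ∀ᵐ x, v x = w x) :
    pairing Ω f v = pairing Ω f w :=
  integral_congr_ae (ae_restrict_of_ae (h.mono fun x hx => by simp only [hx]))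

/-- Hölder's inequality for the pairing of `L^{Ĝ^*}(Ω)` with `L^Ĝ`. -/
theorem ofReal_abs_pairing_le {f v : E d → ℝ} (hf : MemLstar g Ω f) (hv : AEMeasurable v) :
    ENNReal.ofReal |pairing Ω f v| ≤ ENNReal.ofReal ((modStar g Ω f).toReal + 1) * normG g v := by
  refine ENNReal.le_of_forall_pos_le_add fun ε hε hfin => ?_
  by_cases htop : normG g v = ⊤
  · rw [htop, ENNReal.mul_top, top_add]
    · exact le_top
    · rw [ENNReal.ofReal_ne_zero_iff]; positivity
  set C : ℝ := (modStar g Ω f).toReal + 1 with hC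
  have hC0 : 0 < C := by positivity
  have h1 : normG g v < normG g v + ENNReal.ofReal (ε / C) :=
    ENNReal.lt_add_right htop (by rw [ENNReal.ofReal_ne_zero_iff]; positivity)
  obtain ⟨l, hl, hml, hlt⟩ := exists_of_luxemburg_lt h1
  have h2 := abs_pairing_le hg hf hv hl hml
  calc ENNReal.ofReal |pairing Ω f v| ≤ ENNReal.ofReal (C * l) := ENNReal.ofReal_le_ofReal h2
    _ = ENNReal.ofReal C * ENNReal.ofReal l := ENNReal.ofReal_mul hC0.le
    _ ≤ ENNReal.ofReal C * (normG g v + ENNReal.ofReal (ε / C)) := by gcongr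
    _ = ENNReal.ofReal C * normG g v + ε := by
      rw [mul_add, ← ENNReal.ofReal_mul hC0.le, mul_div_cancel₀ _ hC0.ne',
        ENNReal.ofReal_coe_nnreal]

theorem isDual_pairing {f : E d → ℝ} (hf : MemLstar g Ω f) : IsDual g s Ω (pairing Ω f) where
  add v w hv hw := pairing_add hg hf hv.1 hw.1
  smul c v _ := pairing_const_mul f c v
  bounded := by
    refine ⟨Real.toNNReal ((modStar g Ω f).toReal + 1), fun v hv => ?_⟩
    refine (ofReal_abs_pairing_le hg hf hv.1.1).trans ?_
    exact mul_le_mul_right le_self_add _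

theorem tendsto_pairing_zero {ι : Type*} {L : Filter ι} {f : E d → ℝ} (hf : MemLstar g Ω f)
    {v : ι → E d → ℝ} (hv : ∀ i, AEMeasurable (v i))
    (h : Tendsto (fun i => modG g (v i)) L (𝓝 0)) :
    Tendsto (fun i => pairing Ω f (v i)) L (𝓝 0) := by
  have hq := hg.famG.q_pos
  rw [Metric.tendsto_nhds]
  intro ε hε
  set C : ℝ := (modStar g Ω f).toReal + 1 with hC
  have hC0 : 0 < C := by positivity
  set t : ℝ := min 1 (ε / (2 * C)) with ht
  have ht0 : 0 < t := by positivity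
  have ht1 : t ≤ 1 := min_le_left _ _
  have hδ : 0 < ENNReal.ofReal (t ^ (gu + 1)) := by positivity
  filter_upwards [(ENNReal.tendsto_nhds_zero.1 h) _ hδ] with i hi
  have h1 := hg.scalingG.scale_le t⁻¹ (v i) ((one_le_inv₀ ht0).2 ht1)
  simp only [inv_mul_eq_div] at h1
  have h2 : modG g (fun x => v i x / t) ≤ 1 := by
    refine h1.trans ((mul_le_mul_right hi _).trans ?_)
    rw [← ENNReal.ofReal_mul (by positivity), Real.inv_rpow ht0.le,
      inv_mul_cancel₀ (Real.rpow_pos_of_pos ht0 _).ne', ENNReal.ofReal_one]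
  have h3 := abs_pairing_le hg hf (hv i) ht0 h2
  rw [Real.dist_eq, sub_zero]
  refine h3.trans_lt ?_
  have h4 : t ≤ ε / (2 * C) := min_le_right _ _
  rw [le_div_iff₀ (by positivity)] at h4
  rw [← hC]
  nlinarith

theorem tendsto_opL_zero (hd : 0 < d) {ι : Type*} {L : Filter ι} {u : E d → ℝ} (hu : MemW g s u)
    {v : ι → E d → ℝ} (hv : ∀ i, AEMeasurable (v i))
    (h : Tendsto (fun i => modS g s (v i)) L (𝓝 0)) :
    Tendsto (fun i => opL g s u (v i)) L (𝓝 0) := by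
  have hq := hg.famG.q_pos
  rw [Metric.tendsto_nhds]
  intro ε hε
  set C : ℝ := (gu + 1) * ((modS g s u).toReal + 1) with hC
  have hC0 : 0 < C := by positivity
  set t : ℝ := min 1 (ε / (2 * C)) with ht
  have ht0 : 0 < t := by positivity
  have ht1 : t ≤ 1 := min_le_left _ _
  have hδ : 0 < ENNReal.ofReal (t ^ (gu + 1)) := by positivity
  filter_upwards [(ENNReal.tendsto_nhds_zero.1 h) _ hδ] with i hi
  have h1 := (hg.scalingS (s := s) hd).scale_le t⁻¹ (v i) ((one_le_inv₀ ht0).2 ht1)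
  simp only [inv_mul_eq_div] at h1
  have h2 : modS g s (fun x => v i x / t) ≤ 1 := by
    refine h1.trans ((mul_le_mul_right hi _).trans ?_)
    rw [← ENNReal.ofReal_mul (by positivity), Real.inv_rpow ht0.le,
      inv_mul_cancel₀ (Real.rpow_pos_of_pos ht0 _).ne', ENNReal.ofReal_one]
  rw [modS_eq, quot_div] at h2
  have h3 := (hg.famS hd).abs_integral_deriv_mul_le_of_scale (aemeasurable_quot hu.1)
    (aemeasurable_quot (hv i)) hu.2.2 ht0 h2
  rw [Real.dist_eq, sub_zero, opL_eq]
  refine h3.trans_lt ?_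
  have h4 : t ≤ ε / (2 * C) := min_le_right _ _
  rw [le_div_iff₀ (by positivity)] at h4
  rw [← modS_eq, ← hC]
  nlinarith

/-- `L^{Ĝ^*}(Ω)` is contained in `L¹(Ω)`, by Young's inequality with the constant function `1`. -/
theorem MemLstar.integrable (hΩb : Bornology.IsBounded Ω) {f : E d → ℝ} (hf : MemLstar g Ω f) :
    Integrable f (volume.restrict Ω) := by
  refine ⟨hf.1.aestronglyMeasurable, ?_⟩
  rw [hasFiniteIntegral_iff_norm]
  have h1 : ∫⁻ x in Ω, ENNReal.ofReal ‖f x‖ ≤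
      ∫⁻ x in Ω, (conjG g x x |f x| + ENNReal.ofReal ku) := by
    apply lintegral_mono_ae
    filter_upwards [ae_restrict_of_ae hg.profile_diag] with x hx
    have h2 := ofReal_mul_le_conjG_add (g := g) x x |f x| 1 zero_le_one
    rw [mul_one] at h2
    refine h2.trans (add_le_add le_rfl (ENNReal.ofReal_le_ofReal ?_))
    have := hx.primitive_one_le hg.gl_pos hg.gl_le
    rwa [abs_one] at this
  refine h1.trans_lt ?_
  rw [lintegral_add_right _ measurable_const, setLIntegral_const]
  exact ENNReal.add_lt_top.2 ⟨hf.2, ENNReal.mul_lt_top ENNReal.ofReal_lt_top hΩb.measure_lt_top⟩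

end Pairing

/-! ### Representation of order-bounded functionals -/

/-- A linear functional bounded by the `L¹` norm of a finite measure is given by a density: it is
bounded in `L²` as well, and the Riesz representation theorem applies to an extension. The
functional need not respect almost everywhere equality by assumption; the bound ensures this. -/
theorem exists_density_of_le_integral {X : Type*} [MeasurableSpace X] {μ : Measure X}
    [IsFiniteMeasure μ] (V : Submodule ℝ (X → ℝ)) (hV : ∀ v ∈ V, MemLp v 2 μ) (F : V →ₗ[ℝ] ℝ)
    (hF : ∀ v : V, |F v| ≤ ∫ x, |v.1 x| ∂μ) :
    ∃ h : X → ℝ, MemLp h 2 μ ∧ ∀ v : V, F v = ∫ x, h x * v.1 x ∂μ := by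
  let T : V →ₗ[ℝ] Lp ℝ 2 μ :=
    { toFun := fun v => (hV v.1 v.2).toLp v.1
      map_add' := fun v w => MemLp.toLp_add (hV v.1 v.2) (hV w.1 w.2)
      map_smul' := fun c v => MemLp.toLp_const_smul c (hV v.1 v.2) }
  have hbd : ∃ C : ℝ, ∀ v : V, ‖F v‖ ≤ C * ‖T v‖ := by
    refine ⟨(μ univ ^ (1 / (1 : ℝ≥0∞).toReal - 1 / (2 : ℝ≥0∞).toReal)).toReal, fun v => ?_⟩
    have hm := hV v.1 v.2
    refine (hF v).trans ?_
    have h1 : ∫ x, |v.1 x| ∂μ = (eLpNorm v.1 1 μ).toReal := by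
      rw [eLpNorm_one_eq_lintegral_enorm, ← integral_norm_eq_lintegral_enorm hm.1]
      rfl
    have h2 : ‖T v‖ = (eLpNorm v.1 2 μ).toReal := Lp.norm_toLp _ hm
    rw [h1, h2, ← ENNReal.toReal_mul, mul_comm]
    refine ENNReal.toReal_mono (ENNReal.mul_ne_top hm.2.ne ?_)
      (eLpNorm_le_eLpNorm_mul_rpow_measure_univ one_le_two hm.1)
    exact ENNReal.rpow_ne_top_of_nonneg (by norm_num) (measure_ne_top μ univ)
  obtain ⟨G, hG, -⟩ := exists_extension_norm_eq (LinearMap.range T) (F.compLeftInverse T)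
  set h := (InnerProductSpace.toDual ℝ (Lp ℝ 2 μ)).symm G with hh
  refine ⟨h, Lp.memLp h, fun v => ?_⟩
  have h1 : F v = G (T v) := by
    rw [hG ⟨T v, LinearMap.mem_range_self T v⟩]
    exact (LinearMap.compLeftInverse_apply_of_bdd F T hbd v (T v) rfl).symm
  rw [h1, ← InnerProductSpace.toDual_symm_apply, L2.inner_def]
  refine integral_congr_ae ?_
  filter_upwards [MemLp.coeFn_toLp (hV v.1 v.2)] with x hx
  have h2 : (T v : X → ℝ) x = v.1 x := hx
  rw [h2]
  simp [hh, mul_comm]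

/-- A function with nonnegative integrals against all nonnegative test functions is nonnegative. -/
theorem ae_nonneg_of_forall_test (hΩ : IsOpen Ω) (hΩb : Bornology.IsBounded Ω) {F : E d → ℝ}
    (hF : Integrable F (volume.restrict Ω))
    (h : ∀ v : E d → ℝ, IsTest Ω v → (∀ x, 0 ≤ v x) → 0 ≤ ∫ x in Ω, F x * v x) :
    ∀ᵐ x ∂(volume.restrict Ω), 0 ≤ F x := by
  -- Compact sets are reached by bump functions that decrease to their indicators.
  have hK : ∀ K : Set (E d), IsCompact K → K ⊆ Ω → 0 ≤ ∫ x in K, F x := by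
    intro K hK hKΩ
    obtain ⟨δ, hδ, hδΩ⟩ := hK.exists_cthickening_subset_open hΩ hKΩ
    obtain ⟨u, -, hu, hul⟩ : ∃ u : ℕ → ℝ, StrictAnti u ∧ (∀ n, u n ∈ Ioo 0 δ) ∧
        Tendsto u atTop (𝓝 0) := exists_seq_strictAnti_tendsto' hδ
    have hbump : ∀ n, ∃ b : E d → ℝ, Function.support b = Metric.thickening (u n) K ∧
        ContDiff ℝ ∞ b ∧ range b ⊆ Icc 0 1 ∧ ∀ x ∈ K, b x = 1 := by
      intro n
      obtain ⟨b, b1, b2, b3, b4⟩ := exists_contMDiff_support_eq_eq_one_iff (n := ⊤)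
        (modelWithCornersSelf ℝ (E d)) (Metric.isOpen_thickening (δ := u n) (E := K)) hK.isClosed
        (Metric.self_subset_thickening (hu n).1 K)
      exact ⟨b, b3, b1.contDiff, b2, fun x hx => (b4 x).1 hx⟩
    choose b b1 b2 b3 b4 using hbump
    have hb0 : ∀ n x, 0 ≤ b n x := fun n x => (b3 n (mem_range_self x)).1
    have hb1 : ∀ n x, b n x ≤ 1 := fun n x => (b3 n (mem_range_self x)).2
    have hts : ∀ n, tsupport (b n) ⊆ Metric.cthickening δ K := fun n => by
      rw [tsupport, b1]
      exact closure_minimal (Metric.thickening_subset_cthickening_of_le (hu n).2.le K)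
        Metric.isClosed_cthickening
    have htest : ∀ n, IsTest Ω (b n) := fun n =>
      ⟨b2 n, (hK.cthickening (r := δ)).of_isClosed_subset (isClosed_tsupport _) (hts n),
        (hts n).trans hδΩ⟩
    have hlim : Tendsto (fun n => ∫ x in Ω, F x * b n x) atTop
        (𝓝 (∫ x in Ω, K.indicator F x)) := by
      refine tendsto_integral_of_dominated_convergence (fun x => |F x|) (fun n => ?_) hF.abs
        (fun n => ?_) ?_
      · exact hF.1.mul (b2 n).continuous.aestronglyMeasurable
      · filter_upwards with x
        rw [norm_mul, Real.norm_eq_abs, Real.norm_eq_abs, abs_of_nonneg (hb0 n x)]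
        exact mul_le_of_le_one_right (abs_nonneg _) (hb1 n x)
      · filter_upwards with x
        by_cases hx : x ∈ K
        · simp [indicator_of_mem hx, b4 _ x hx]
        · rw [indicator_of_notMem hx]
          apply tendsto_const_nhds.congr'
          obtain ⟨ε, hε, hxε⟩ : ∃ ε, 0 < ε ∧ x ∉ Metric.thickening ε K := by
            rw [← hK.isClosed.closure_eq, Metric.closure_eq_iInter_thickening] at hx
            simpa using hx
          filter_upwards [(tendsto_order.1 hul).2 _ hε] with n hn
          have : b n x = 0 := by
            rw [← Function.notMem_support, b1]
            exact fun hc => hxε (Metric.thickening_mono hn.le K hc)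
          rw [this, mul_zero]
    have := ge_of_tendsto' hlim fun n => h _ (htest n) (hb0 n)
    rwa [integral_indicator hK.measurableSet, Measure.restrict_restrict hK.measurableSet,
      inter_eq_left.2 hKΩ] at this
  refine ae_nonneg_of_forall_setIntegral_nonneg hF fun A hA _ => ?_
  rw [Measure.restrict_restrict hA]
  have hAΩ : MeasurableSet (A ∩ Ω) := hA.inter hΩ.measurableSet
  have hfin : volume (A ∩ Ω) ≠ ⊤ :=
    ((measure_mono inter_subset_right).trans_lt hΩb.measure_lt_top).ne
  have hex : ∀ n : ℕ, ∃ K ⊆ A ∩ Ω, IsCompact K ∧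
      volume ((A ∩ Ω) \ K) < ENNReal.ofReal (1 / ((n : ℝ) + 1)) := fun n =>
    hAΩ.exists_isCompact_sdiff_lt hfin (by
      rw [ENNReal.ofReal_ne_zero_iff]; positivity)
  choose K hKs hKc hKm using hex
  have h0 : Tendsto (fun n => volume.restrict Ω ((A ∩ Ω) \ K n)) atTop (𝓝 0) := by
    have h1 : Tendsto (fun n : ℕ => ENNReal.ofReal (1 / ((n : ℝ) + 1))) atTop (𝓝 0) := by
      rw [← ENNReal.ofReal_zero]
      exact ENNReal.tendsto_ofReal tendsto_one_div_add_atTop_nhds_zero_nat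
    refine tendsto_of_tendsto_of_tendsto_of_le_of_le tendsto_const_nhds h1 (fun _ => zero_le)
      fun n => (Measure.restrict_apply_le _ _).trans (hKm n).le
  have h1 := hF.tendsto_setIntegral_nhds_zero h0
  have h2 : ∀ n, ∫ x in (A ∩ Ω) \ K n, F x ∂(volume.restrict Ω) ≤ ∫ x in A ∩ Ω, F x := by
    intro n
    have hsub : (A ∩ Ω) \ K n ⊆ Ω := fun x hx => hx.1.2
    have hF' : IntegrableOn F (A ∩ Ω) := IntegrableOn.mono_set hF inter_subset_right
    rw [Measure.restrict_restrict (hAΩ.diff (hKc n).measurableSet), inter_eq_left.2 hsub,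
      setIntegral_sdiff (hKc n).measurableSet hF' (hKs n)]
    have := hK (K n) (hKc n) ((hKs n).trans inter_subset_right)
    linarith
  exact le_of_tendsto' h1 h2

/-- The vector space of test functions in `Ω`. -/
def testSpace (Ω : Set (E d)) : Submodule ℝ (E d → ℝ) where
  carrier := {v | IsTest Ω v}
  add_mem' h1 h2 := h1.add h2
  zero_mem' := ⟨contDiff_const, HasCompactSupport.zero, by simp [tsupport]⟩
  smul_mem' c _ h := h.const_mul c

/-- A functional on test functions lying between `0` and `v ↦ ∫ ζ v` is given by a function
between `0` and `ζ`: the Riesz representation in `L²(ζ dx)`. -/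
theorem exists_density_of_order_bounded (hΩ : IsOpen Ω) (hΩb : Bornology.IsBounded Ω)
    {ζ : E d → ℝ} (hζ : Integrable ζ (volume.restrict Ω))
    (hζ0 : ∀ᵐ x ∂(volume.restrict Ω), 0 ≤ ζ x) (F : testSpace Ω →ₗ[ℝ] ℝ)
    (hF : ∀ v, |F v| ≤ ∫ x in Ω, ζ x * |v.1 x|)
    (hF0 : ∀ v : testSpace Ω, (∀ x, 0 ≤ v.1 x) → 0 ≤ F v ∧ F v ≤ ∫ x in Ω, ζ x * v.1 x) :
    ∃ h : E d → ℝ, Integrable h (volume.restrict Ω) ∧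
      (∀ᵐ x ∂(volume.restrict Ω), 0 ≤ h x ∧ h x ≤ ζ x) ∧
      ∀ v : testSpace Ω, F v = ∫ x in Ω, h x * v.1 x := by
  set m : E d → ℝ≥0 := fun x => (ζ x).toNNReal with hm
  have hmm : AEMeasurable m (volume.restrict Ω) := hζ.1.aemeasurable.real_toNNReal
  set μ := (volume.restrict Ω).withDensity (fun x => (m x : ℝ≥0∞)) with hμ
  have hμf : IsFiniteMeasure μ := by
    refine isFiniteMeasure_withDensity ?_
    exact hζ.lintegral_lt_top.ne
  have hint : ∀ k : E d → ℝ, ∫ x, k x ∂μ = ∫ x in Ω, ζ x * k x := by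
    intro k
    rw [hμ, integral_withDensity_eq_integral_smul₀ hmm]
    refine integral_congr_ae (hζ0.mono fun x hx => ?_)
    simp only [hm, NNReal.smul_def, Real.coe_toNNReal _ hx, smul_eq_mul]
  obtain ⟨h, hh, hrep⟩ := exists_density_of_le_integral (μ := μ) (testSpace Ω)
    (fun v hv => hv.1.continuous.memLp_of_hasCompactSupport hv.2.1) F
    (fun v => (hF v).trans_eq (hint fun x => |v.1 x|).symm)
  have hh1 : Integrable h μ := hh.integrable one_le_two
  have hhi : Integrable (fun x => ζ x * h x) (volume.restrict Ω) := by
    have := (integrable_withDensity_iff_integrable_smul₀ hmm).1 hh1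
    refine this.congr (hζ0.mono fun x hx => ?_)
    simp only [hm, NNReal.smul_def, Real.coe_toNNReal _ hx, smul_eq_mul]
  have hrep' : ∀ v : testSpace Ω, F v = ∫ x in Ω, (ζ x * h x) * v.1 x := fun v => by
    rw [hrep, hint]
    congr 1; ext x; ring
  have hbv : ∀ (k : E d → ℝ), Integrable k (volume.restrict Ω) → ∀ v, IsTest Ω v →
      Integrable (fun x => k x * v x) (volume.restrict Ω) := by
    intro k hk v hv
    obtain ⟨B, hB⟩ := hv.2.1.exists_bound_of_continuous hv.1.continuous
    exact hk.mul_bdd (c := B) hv.1.continuous.aestronglyMeasurable (Eventually.of_forall hB)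
  have h0 := ae_nonneg_of_forall_test hΩ hΩb hhi fun v hv hv0 => by
    have := (hF0 ⟨v, hv⟩ hv0).1
    rwa [hrep'] at this
  have h1 := ae_nonneg_of_forall_test hΩ hΩb (hζ.sub hhi) fun v hv hv0 => by
    have := (hF0 ⟨v, hv⟩ hv0).2
    rw [hrep'] at this
    simp only [Pi.sub_apply, sub_mul]
    rw [integral_sub (hbv _ hζ v hv) (hbv _ hhi v hv)]
    linarith
  refine ⟨_, hhi, ?_, hrep'⟩
  filter_upwards [h0, h1] with x h2 h3
  exact ⟨h2, by simpa using h3⟩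

/-! ### Minimisation of convex energies -/

/-- Fatou's lemma for modulars. -/
theorem YoungFamily.modular_le_of_tendsto {X : Type*} [MeasurableSpace X] {μ : Measure X}
    {p q : ℝ} {Φ φ : X → ℝ → ℝ} (F : YoungFamily μ p q Φ φ) {z : ℕ → X → ℝ} {w : X → ℝ}
    (hz : ∀ n, AEMeasurable (z n) μ) (hlim : ∀ᵐ x ∂μ, Tendsto (fun n => z n x) atTop (𝓝 (w x)))
    {c : ℝ≥0∞} (hc : ∀ᶠ n in atTop, modular μ Φ (z n) ≤ c) : modular μ Φ w ≤ c := by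
  have h1 : modular μ Φ w = ∫⁻ x, liminf (fun n => ENNReal.ofReal (Φ x (z n x))) atTop ∂μ := by
    refine lintegral_congr_ae ?_
    filter_upwards [hlim, F.young] with x hx hY
    exact (ENNReal.tendsto_ofReal ((hY.cont.tendsto _).comp hx)).liminf_eq.symm
  rw [h1]
  refine (lintegral_liminf_le' fun n => (F.aemeasurable_comp (hz n)).ennreal_ofReal).trans ?_
  exact liminf_le_of_frequently_le' hc.frequently

section Minimise

variable (hd : 0 < d) (hg : IsAdmissible gl gu kl ku g)
include hd hg

/-- Functions that vanish off a bounded set and are Cauchy for the Gagliardo modular converge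
almost everywhere along a subsequence. -/
theorem exists_subseq_tendsto (hΩb : Bornology.IsBounded Ω) {w : ℕ → E d → ℝ}
    (hw : ∀ n, AEMeasurable (w n)) (hw0 : ∀ n, ∀ᵐ x, x ∉ Ω → w n x = 0)
    (hC : ∀ ε : ℝ≥0∞, 0 < ε → ∃ N, ∀ n m, N ≤ n → N ≤ m →
      modS g s (fun x => w n x - w m x) ≤ ε) :
    ∃ ns : ℕ → ℕ, StrictMono ns ∧ ∃ v : E d → ℝ, AEMeasurable v ∧
      ∀ᵐ x, Tendsto (fun k => w (ns k) x) atTop (𝓝 (v x)) := by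
  have hev : ∀ k : ℕ, ∀ᶠ n in atTop, ∀ m, n ≤ m →
      modS g s (fun x => w n x - w m x) ≤ ENNReal.ofReal (YoungFamily.rate gu k) := by
    intro k
    obtain ⟨N, hN⟩ := hC _ (ENNReal.ofReal_pos.2 (YoungFamily.rate_pos gu k))
    filter_upwards [eventually_ge_atTop N] with n hn m hm
    exact hN n m hn (hn.trans hm)
  obtain ⟨ns, hns, hrate⟩ := extraction_forall_of_eventually hev
  -- Along the subsequence the difference quotients are Cauchy almost everywhere, and so is the
  -- sequence itself, relative to a base point at which it vanishes.
  have h1 := (hg.famS hd).ae_eventually_le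
    (z := fun k => quot s (fun x => w (ns k) x - w (ns (k + 1)) x))
    (fun k => aemeasurable_quot ((hw _).sub (hw _)))
    (fun k => hrate k _ (hns (Nat.lt_succ_self k)).le)
  have h2 : ∀ᵐ z : E d × E d, (∃ l, Tendsto (fun k => quot s (w (ns k)) z) atTop (𝓝 l)) ∧
      z.1 ≠ z.2 := by
    filter_upwards [h1, ae_ne hd] with z hz hne
    refine ⟨cauchySeq_tendsto_of_complete (cauchySeq_of_summable_dist ?_), hne⟩
    refine Summable.of_norm_bounded_eventually_nat summable_geometric_two ?_
    filter_upwards [hz] with k hk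
    rw [quot_sub] at hk
    rwa [Real.norm_eq_abs, abs_of_nonneg dist_nonneg, Real.dist_eq]
  obtain ⟨y, hy, hwy, hlim⟩ := exists_notMem_of_ae hd hΩb h2 (ae_all_iff.2 hw0)
  have h3 : ∀ᵐ x, ∃ l, Tendsto (fun k => w (ns k) x) atTop (𝓝 l) := by
    filter_upwards [hlim] with x hx
    obtain ⟨⟨l, hl⟩, hne⟩ := hx
    have hpos : 0 < ‖x - y‖ ^ s := Real.rpow_pos_of_pos (norm_pos_iff.2 (sub_ne_zero.2 hne)) s
    refine ⟨l * ‖x - y‖ ^ s, (hl.mul_const _).congr fun k => ?_⟩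
    simp only [quot, delta, hwy (ns k) hy, sub_zero]
    field_simp
  obtain ⟨v, hv, hvl⟩ := measurable_limit_of_tendsto_metrizable_ae (fun k => hw (ns k)) h3
  exact ⟨ns, hns, v, hv.aemeasurable, hvl⟩

/-- If a sequence is Cauchy for the Gagliardo modular and converges almost everywhere, then it
converges in the modular. -/
theorem tendsto_modS_of_cauchy {w : ℕ → E d → ℝ} {v : E d → ℝ} (hw : ∀ n, AEMeasurable (w n))
    (hC : ∀ ε : ℝ≥0∞, 0 < ε → ∃ N, ∀ n m, N ≤ n → N ≤ m →
      modS g s (fun x => w n x - w m x) ≤ ε)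
    (hlim : ∀ᵐ x, Tendsto (fun k => w k x) atTop (𝓝 (v x))) :
    Tendsto (fun n => modS g s (fun x => w n x - v x)) atTop (𝓝 0) := by
  rw [ENNReal.tendsto_nhds_zero]
  intro ε hε
  obtain ⟨N, hN⟩ := hC ε hε
  filter_upwards [eventually_ge_atTop N] with n hn
  refine (hg.famS hd).modular_le_of_tendsto (z := fun m => quot s (fun x => w n x - w m x))
    (fun m => aemeasurable_quot ((hw n).sub (hw m))) ?_
    ((eventually_ge_atTop N).mono fun m hm => hN n m hn hm)
  filter_upwards [ae_pair hlim] with z hz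
  have h1 := (tendsto_const_nhds (x := w n z.1)).sub hz.1
  have h2 := (tendsto_const_nhds (x := w n z.2)).sub hz.2
  exact (h1.sub h2).div_const _

/-- The direct method by uniform convexity: minimising sequences are Cauchy for the Gagliardo
modular. The lower order term `V` only has to be midpoint convex and continuous along such
sequences. The factor `2` in `hcoer` leaves half of the modular to absorb `V`. -/
theorem exists_minimiser (hΩb : Bornology.IsBounded Ω) (hΩ : MeasurableSet Ω)
    {K : Set (E d → ℝ)} (hne : K.Nonempty)
    (hK : ∀ w ∈ K, MemW0 g s Ω w)
    (hmid : ∀ a ∈ K, ∀ b ∈ K, (fun x => (a x + b x) / 2) ∈ K) {V : (E d → ℝ) → ℝ}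
    (hV : ∀ a ∈ K, ∀ b ∈ K, 2 * V (fun x => (a x + b x) / 2) ≤ V a + V b) {C : ℝ}
    (hcoer : ∀ w ∈ K, (modS g s w).toReal ≤ 2 * ((modS g s w).toReal + V w) + C)
    (hcomp : ∀ (w : ℕ → E d → ℝ) (v : E d → ℝ), (∀ n, w n ∈ K) → AEMeasurable v →
      (∀ ε : ℝ≥0∞, 0 < ε → ∃ N, ∀ n m, N ≤ n → N ≤ m →
        modS g s (fun x => w n x - w m x) ≤ ε) →
      (∀ᵐ x, Tendsto (fun k => w k x) atTop (𝓝 (v x))) →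
      v ∈ K ∧ Tendsto (fun n => V (w n)) atTop (𝓝 (V v))) :
    ∃ w ∈ K, ∀ z ∈ K, (modS g s w).toReal + V w ≤ (modS g s z).toReal + V z := by
  set En : (E d → ℝ) → ℝ := fun w => (modS g s w).toReal + V w with hEn
  set I := sInf (En '' K) with hI
  have hbdd : BddBelow (En '' K) := by
    refine ⟨-C / 2, ?_⟩
    rintro _ ⟨w, hw, rfl⟩
    have h1 := hcoer w hw
    have h2 : 0 ≤ (modS g s w).toReal := ENNReal.toReal_nonneg
    simp only [hEn]
    linarith
  have hIle : ∀ w ∈ K, I ≤ En w := fun w hw => csInf_le hbdd ⟨w, hw, rfl⟩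
  have hex : ∀ n : ℕ, ∃ w ∈ K, En w ≤ I + 1 / ((n : ℝ) + 1) := by
    intro n
    obtain ⟨_, ⟨w, hw, rfl⟩, hlt⟩ := exists_lt_of_csInf_lt (hne.image En)
      (lt_add_of_pos_right I (by positivity : 0 < 1 / ((n : ℝ) + 1)))
    exact ⟨w, hw, hlt.le⟩
  choose w hwK hwE using hex
  have hinv : ∀ n : ℕ, 1 / ((n : ℝ) + 1) ≤ 1 := fun n => by
    rw [div_le_one (by positivity)]
    have : (0 : ℝ) ≤ n := Nat.cast_nonneg n
    linarith
  set B : ℝ := max 1 (2 * (I + 1) + C) with hB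
  have hB1 : 1 ≤ B := le_max_left _ _
  have hJB : ∀ n, (modS g s (w n)).toReal ≤ B := by
    intro n
    have h1 := hcoer _ (hwK n)
    have h2 := hwE n
    have h3 := hinv n
    simp only [hEn] at h2
    have h4 := le_max_right 1 (2 * (I + 1) + C)
    linarith
  have hwW : ∀ n, MemW g s (w n) := fun n => (hK _ (hwK n)).1
  have hgap : ∀ n m, (modS g s (w n)).toReal + (modS g s (w m)).toReal
      - 2 * (modS g s (fun x => (w n x + w m x) / 2)).toReal ≤
        1 / ((n : ℝ) + 1) + 1 / ((m : ℝ) + 1) := by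
    intro n m
    have h1 := hV _ (hwK n) _ (hwK m)
    have h2 := hIle _ (hmid _ (hwK n) _ (hwK m))
    have h3 := hwE n
    have h4 := hwE m
    simp only [hEn] at h2 h3 h4
    linarith
  have hC : ∀ ε : ℝ≥0∞, 0 < ε → ∃ N, ∀ n m, N ≤ n → N ≤ m →
      modS g s (fun x => w n x - w m x) ≤ ε := by
    intro ε hε
    obtain ⟨t, ht, -, hte⟩ := exists_real_small hε
    set D : ℝ := 4 ^ (gu + 1) with hD
    have hD0 : 0 < D := by positivity
    set η : ℝ := min 1 (t / (4 * D * B)) with hη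
    have hη0 : 0 < η := by positivity
    -- `η` makes the error term of uniform convexity small; the convexity gap is then made small by
    -- going far out in the sequence.
    have hη1 : η ≤ 1 := min_le_left _ _
    have hηle : D * (4 * η * B) ≤ t := by
      have : η ≤ t / (4 * D * B) := min_le_right _ _
      rw [le_div_iff₀ (by positivity)] at this
      linarith
    set c := IsYoung.gapConst gl gu η with hc
    have hc0 : 0 ≤ c := IsYoung.gapConst_nonneg gl gu hg.gl_pos hη0 hη1
    have hlim : Tendsto (fun n : ℕ => D * c * (2 * (1 / ((n : ℝ) + 1)))) atTop (𝓝 0) := by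
      have := ((tendsto_one_div_add_atTop_nhds_zero_nat (𝕜 := ℝ)).const_mul 2).const_mul (D * c)
      simpa using this
    obtain ⟨N, hN⟩ := ((tendsto_order.1 hlim).2 t ht).exists
    refine ⟨N, fun n m hn hm => ?_⟩
    have h1 := (hg.famS hd).modular_sub_le_midpoint_gap hη0 hη1
      (aemeasurable_quot (s := s) (hwW n).1) (aemeasurable_quot (hwW m).1) (hwW n).2.2 (hwW m).2.2
    have hq : (fun z => (quot s (w n) z + quot s (w m) z) / 2) =
        quot s (fun x => (w n x + w m x) / 2) := by
      ext z; simp only [quot, delta]; ring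
    rw [hq, ← quot_sub] at h1
    simp only [← modS_eq] at h1
    have hmono : ∀ k : ℕ, N ≤ k → 1 / ((k : ℝ) + 1) ≤ 1 / ((N : ℝ) + 1) := fun k hk => by
      gcongr
    have h2 : (modS g s (fun x => w n x - w m x)).toReal ≤ 2 * t := by
      refine h1.trans ?_
      have h3 := hgap n m
      have h4 := hmono n hn
      have h5 := hmono m hm
      have h6 := hJB n
      have h7 := hJB m
      calc _ ≤ D * (c * (2 * (1 / ((N : ℝ) + 1))) + 2 * η * (B + B)) := by
            gcongr
            linarith
        _ = D * c * (2 * (1 / ((N : ℝ) + 1))) + D * (4 * η * B) := by ring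
        _ ≤ 2 * t := by linarith
    have hfin : modS g s (fun x => w n x - w m x) ≠ ⊤ :=
      (((hwW n).sub hd hg (hwW m)).2.2).ne
    exact ((ENNReal.le_ofReal_iff_toReal_le hfin (by positivity)).2 h2).trans hte
  obtain ⟨ns, hns, v, hv, hvl⟩ := exists_subseq_tendsto hd hg hΩb (fun n => (hwW n).1)
    (fun n => (hK _ (hwK n)).ae_eq_zero hd hg hΩ) hC
  have hC' : ∀ ε : ℝ≥0∞, 0 < ε → ∃ N, ∀ n m, N ≤ n → N ≤ m →
      modS g s (fun x => w (ns n) x - w (ns m) x) ≤ ε := by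
    intro ε hε
    obtain ⟨N, hN⟩ := hC ε hε
    exact ⟨N, fun n m hn hm => hN _ _ (hn.trans (hns.id_le n)) (hm.trans (hns.id_le m))⟩
  obtain ⟨hvK, hVv⟩ := hcomp _ v (fun n => hwK (ns n)) hv hC' hvl
  refine ⟨v, hvK, fun z hz => le_trans ?_ (hIle z hz)⟩
  refine le_of_forall_pos_le_add fun ε hε => ?_
  have hinv0 : Tendsto (fun n : ℕ => 1 / (((ns n : ℕ) : ℝ) + 1)) atTop (𝓝 0) :=
    (tendsto_one_div_add_atTop_nhds_zero_nat (𝕜 := ℝ)).comp hns.tendsto_atTop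
  have hev : ∀ᶠ n in atTop, (modS g s (w (ns n))).toReal ≤ I - V v + ε := by
    filter_upwards [(tendsto_order.1 hinv0).2 (ε / 2) (by positivity),
      (tendsto_order.1 hVv).1 (V v - ε / 2) (by linarith)] with n h1 h2
    have h3 := hwE (ns n)
    simp only [hEn] at h3
    linarith
  obtain ⟨n0, hn0⟩ := hev.exists
  have hnn : 0 ≤ I - V v + ε := ENNReal.toReal_nonneg.trans hn0
  have hF := (hg.famS hd).modular_le_of_tendsto (z := fun n => quot s (w (ns n))) (w := quot s v)
    (c := ENNReal.ofReal (I - V v + ε)) (fun n => aemeasurable_quot (hwW _).1)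
    (by
      filter_upwards [ae_pair hvl] with z hz
      exact (hz.1.sub hz.2).div_const _)
    (hev.mono fun n hn => (ENNReal.le_ofReal_iff_toReal_le (hwW (ns n)).2.2.ne hnn).2 hn)
  have hJv := ENNReal.toReal_mono ENNReal.ofReal_ne_top hF
  rw [ENNReal.toReal_ofReal hnn, ← modS_eq] at hJv
  linarith

end Minimise

/-! ### Variational inequalities with a penalisation term -/

/-- The part of the properties of a penalisation profile that the zero function shares. For the
latter the penalised variational inequality is the ordinary one. -/
structure IsRamp (θ : ℝ → ℝ) : Prop where
  cont : Continuous θ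
  mono : Monotone θ
  mem_Icc : ∀ t, θ t ∈ Icc (0 : ℝ) 1
  eq_zero : ∀ t, t ≤ 0 → θ t = 0

theorem IsPenalisation.isRamp {θ : ℝ → ℝ} (h : IsPenalisation θ) : IsRamp θ :=
  ⟨h.lipschitz.choose_spec.continuous, h.mono, h.mem_Icc, h.eq_zero⟩

theorem isRamp_zero : IsRamp (fun _ => 0) :=
  ⟨continuous_const, monotone_const, fun _ => ⟨le_rfl, zero_le_one⟩, fun _ _ => rfl⟩

/-- The primitive of `θ`. -/
def rampInt (θ : ℝ → ℝ) (t : ℝ) : ℝ := ∫ r in (0 : ℝ)..t, θ r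

namespace IsRamp

variable {θ : ℝ → ℝ}

theorem rampInt_sub (h : IsRamp θ) (a b : ℝ) : rampInt θ a - rampInt θ b = ∫ r in b..a, θ r :=
  intervalIntegral.integral_interval_sub_left (h.cont.intervalIntegrable _ _)
    (h.cont.intervalIntegrable _ _)

theorem tangent (h : IsRamp θ) (a b : ℝ) : θ b * (a - b) ≤ rampInt θ a - rampInt θ b := by
  rw [h.rampInt_sub]
  rcases le_total b a with hab | hab
  · have := intervalIntegral.integral_mono_on hab
      (continuous_const.intervalIntegrable _ _ : IntervalIntegrable (fun _ => θ b) volume b a)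
      (h.cont.intervalIntegrable _ _) fun r hr => h.mono hr.1
    simpa [mul_comm] using this
  · have := intervalIntegral.integral_mono_on hab (h.cont.intervalIntegrable _ _)
      (continuous_const.intervalIntegrable _ _ : IntervalIntegrable (fun _ => θ b) volume a b)
      fun r hr => h.mono hr.2
    rw [intervalIntegral.integral_symm]
    simp only [intervalIntegral.integral_const, smul_eq_mul] at this
    linarith

theorem continuous_rampInt (h : IsRamp θ) : Continuous (rampInt θ) :=
  intervalIntegral.continuous_primitive (fun _ _ => h.cont.intervalIntegrable _ _) 0

theorem abs_rampInt_sub_le (h : IsRamp θ) (a b : ℝ) : |rampInt θ a - rampInt θ b| ≤ |a - b| := by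
  have h1 := h.tangent a b
  have h2 := h.tangent b a
  have ha := h.mem_Icc a
  have hb := h.mem_Icc b
  rcases le_total a b with hab | hab
  · rw [abs_of_nonpos (by linarith : a - b ≤ 0), abs_le]
    constructor <;> nlinarith [ha.1, ha.2, hb.1, hb.2]
  · rw [abs_of_nonneg (by linarith : 0 ≤ a - b), abs_le]
    constructor <;> nlinarith [ha.1, ha.2, hb.1, hb.2]

theorem rampInt_nonneg (h : IsRamp θ) (a : ℝ) : 0 ≤ rampInt θ a := by
  have h1 := h.tangent a 0
  have h2 : rampInt θ 0 = 0 := by simp [rampInt]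
  rw [h.eq_zero 0 le_rfl, h2] at h1
  linarith

end IsRamp

/-- The penalisation energy, with derivative `ζ θ((w - ψ)/ε)`. -/
def penalEnergy (Ω : Set (E d)) (ζ ψ : E d → ℝ) (θ : ℝ → ℝ) (ε : ℝ) (w : E d → ℝ) : ℝ :=
  ∫ x in Ω, ζ x * (ε * rampInt θ ((w x - ψ x) / ε))

/-- The penalisation term `ζ θ((w - ψ)/ε)`. -/
def penalTerm (ζ ψ : E d → ℝ) (θ : ℝ → ℝ) (ε : ℝ) (w : E d → ℝ) (x : E d) : ℝ :=
  ζ x * θ ((w x - ψ x) / ε)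

section Penal

variable (hg : IsAdmissible gl gu kl ku g) {ζ ψ : E d → ℝ} {θ : ℝ → ℝ} {ε : ℝ}
  (hζ : MemLstar g Ω ζ) (hζ0 : ∀ᵐ x ∂(volume.restrict Ω), 0 ≤ ζ x) (hθ : IsRamp θ)

theorem memLstar_penalTerm (hζ : MemLstar g Ω ζ) (hθ : IsRamp θ) (hψ : AEMeasurable ψ)
    {w : E d → ℝ} (hw : AEMeasurable w) : MemLstar g Ω (penalTerm ζ ψ θ ε w) := by
  refine hζ.mono (hζ.1.mul ?_) (Eventually.of_forall fun x => ?_)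
  · exact hθ.cont.measurable.comp_aemeasurable ((hw.sub hψ).div_const ε).restrict
  · have h1 := hθ.mem_Icc ((w x - ψ x) / ε)
    rw [penalTerm, abs_mul, abs_of_nonneg h1.1]
    exact mul_le_of_le_one_right (abs_nonneg _) h1.2

include hg hζ hθ

theorem integrable_penalEnergy (hε : 0 < ε) (hψ : MemW g s ψ) {w : E d → ℝ} (hw : MemW g s w) :
    Integrable (fun x => ζ x * (ε * rampInt θ ((w x - ψ x) / ε))) (volume.restrict Ω) := by
  have h1 := (integrable_pairing hg hζ hw.1 hw.2.1).norm.add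
    (integrable_pairing hg hζ hψ.1 hψ.2.1).norm
  refine h1.mono' (hζ.1.mul ?_).aestronglyMeasurable (Eventually.of_forall fun x => ?_)
  · exact (hθ.continuous_rampInt.measurable.comp_aemeasurable
      ((hw.1.sub hψ.1).div_const ε).restrict).const_mul ε
  · have h2 := hθ.abs_rampInt_sub_le ((w x - ψ x) / ε) 0
    have h3 : rampInt θ 0 = 0 := by simp [rampInt]
    rw [h3, sub_zero, sub_zero, abs_div, abs_of_pos hε, le_div_iff₀ hε] at h2
    simp only [Pi.add_apply, norm_mul, Real.norm_eq_abs, abs_of_pos hε]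
    rw [← mul_add]
    have := abs_sub (w x) (ψ x)
    gcongr
    linarith

include hζ0

theorem penalEnergy_tangent (hε : 0 < ε) (hψ : MemW g s ψ) {a b : E d → ℝ} (ha : MemW g s a)
    (hb : MemW g s b) (hab : MemW g s (fun x => a x - b x)) :
    pairing Ω (penalTerm ζ ψ θ ε b) (fun x => a x - b x) ≤
      penalEnergy Ω ζ ψ θ ε a - penalEnergy Ω ζ ψ θ ε b := by
  unfold penalEnergy
  rw [← integral_sub (integrable_penalEnergy hg hζ hθ hε hψ ha)
    (integrable_penalEnergy hg hζ hθ hε hψ hb)]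
  refine integral_mono_ae
    (integrable_pairing hg (memLstar_penalTerm hζ hθ hψ.1 hb.1) hab.1 hab.2.1)
    ((integrable_penalEnergy hg hζ hθ hε hψ ha).sub (integrable_penalEnergy hg hζ hθ hε hψ hb)) ?_
  filter_upwards [hζ0] with x hx
  have h1 := hθ.tangent ((a x - ψ x) / ε) ((b x - ψ x) / ε)
  have h2 : (a x - ψ x) / ε - (b x - ψ x) / ε = (a x - b x) / ε := by ring
  rw [h2, ← mul_div_assoc, div_le_iff₀ hε] at h1
  simp only [penalTerm]
  have h3 := mul_le_mul_of_nonneg_left h1 hx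
  linarith

theorem abs_penalEnergy_sub_le (hε : 0 < ε) (hψ : MemW g s ψ) {a b : E d → ℝ} (ha : MemW g s a)
    (hb : MemW g s b) (hab : MemW g s (fun x => |a x - b x|)) :
    |penalEnergy Ω ζ ψ θ ε a - penalEnergy Ω ζ ψ θ ε b| ≤ pairing Ω ζ (fun x => |a x - b x|) := by
  unfold penalEnergy
  rw [← integral_sub (integrable_penalEnergy hg hζ hθ hε hψ ha)
    (integrable_penalEnergy hg hζ hθ hε hψ hb), ← Real.norm_eq_abs]
  refine norm_integral_le_of_norm_le (integrable_pairing hg hζ hab.1 hab.2.1) ?_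
  filter_upwards [hζ0] with x hx
  have h1 := hθ.abs_rampInt_sub_le ((a x - ψ x) / ε) ((b x - ψ x) / ε)
  have h2 : (a x - ψ x) / ε - (b x - ψ x) / ε = (a x - b x) / ε := by ring
  rw [h2, abs_div, abs_of_pos hε, le_div_iff₀ hε] at h1
  rw [← mul_sub, ← mul_sub, Real.norm_eq_abs, abs_mul, abs_mul, abs_of_nonneg hx, abs_of_pos hε]
  gcongr
  linarith

omit hg hζ in
theorem penalEnergy_nonneg (hε : 0 < ε) (w : E d → ℝ) : 0 ≤ penalEnergy Ω ζ ψ θ ε w := by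
  refine integral_nonneg_of_ae (hζ0.mono fun x hx => ?_)
  have := hθ.rampInt_nonneg ((w x - ψ x) / ε)
  simp only [Pi.zero_apply]
  positivity

end Penal

section Variational

variable (hd : 0 < d) (hg : IsAdmissible gl gu kl ku g)
include hd hg

/-- A minimiser of the penalised energy over a convex set solves the variational inequality. -/
theorem variational_of_minimiser {K : Set (E d → ℝ)} (hK : ∀ w ∈ K, MemW g s w)
    (hconv : ∀ a ∈ K, ∀ b ∈ K, ∀ t : ℝ, 0 < t → t ≤ 1 → (fun x => a x + t * (b x - a x)) ∈ K)
    {ζ ψ F : E d → ℝ} {θ : ℝ → ℝ} {ε : ℝ} (hζ : MemLstar g Ω ζ)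
    (hζ0 : ∀ᵐ x ∂(volume.restrict Ω), 0 ≤ ζ x) (hθ : IsRamp θ) (hε : 0 < ε) (hψ : MemW g s ψ)
    (hF : MemLstar g Ω F) {w : E d → ℝ} (hw : w ∈ K)
    (hmin : ∀ z ∈ K, (modS g s w).toReal + (penalEnergy Ω ζ ψ θ ε w - pairing Ω F w) ≤
      (modS g s z).toReal + (penalEnergy Ω ζ ψ θ ε z - pairing Ω F z)) {z : E d → ℝ} (hz : z ∈ K) :
    0 ≤ opL g s w (fun x => z x - w x) + pairing Ω (penalTerm ζ ψ θ ε w) (fun x => z x - w x)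
      - pairing Ω F (fun x => z x - w x) := by
  set v : E d → ℝ := fun x => z x - w x with hv
  have hwW := hK w hw
  have hvW : MemW g s v := (hK z hz).sub hd hg hwW
  set wt : ℝ → E d → ℝ := fun t x => w x + t * v x with hwt
  have hwtW : ∀ t, MemW g s (wt t) := fun t => hwW.add hd hg (hvW.const_mul hd hg t)
  have hpos : ∀ t ∈ Ioo (0 : ℝ) 1, 0 ≤ opL g s (wt t) v
      + pairing Ω (penalTerm ζ ψ θ ε (wt t)) v - pairing Ω F v := by
    intro t ht
    have hE := hmin (wt t) (hconv w hw z hz t ht.1 ht.2.le)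
    have hneg : (fun x => w x - wt t x) = fun x => (-t) * v x := by
      ext x; simp only [hwt]; ring
    have h1 := (hg.famS hd).tangent (aemeasurable_quot (s := s) hwW.1)
      (aemeasurable_quot (hwtW t).1) hwW.2.2 (hwtW t).2.2
    have h1' : opL g s (wt t) (fun x => w x - wt t x) ≤
        (modS g s w).toReal - (modS g s (wt t)).toReal := by
      rw [opL_eq, quot_sub]; exact h1
    have h2 := penalEnergy_tangent hg hζ hζ0 hθ hε hψ hwW (hwtW t) (hwW.sub hd hg (hwtW t))
    rw [hneg, opL_const_mul] at h1'
    rw [hneg, pairing_const_mul] at h2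
    have h3 : pairing Ω F (wt t) = pairing Ω F w + t * pairing Ω F v := by
      rw [← pairing_const_mul, ← pairing_add hg hF hwW (hvW.const_mul hd hg t)]
    have h4 : 0 ≤ t * (opL g s (wt t) v + pairing Ω (penalTerm ζ ψ θ ε (wt t)) v
        - pairing Ω F v) := by linarith
    exact nonneg_of_mul_nonneg_right h4 ht.1
  have hlim1 : Tendsto (fun t => opL g s (wt t) v) (𝓝[>] 0) (𝓝 (opL g s w v)) := by
    have h1 := (hg.famS hd).tendsto_integral_deriv (aemeasurable_quot (s := s) hwW.1)
      (aemeasurable_quot hvW.1) hwW.2.2 hvW.2.2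
    simp only [opL_eq, hwt, quot_add, quot_mul]
    exact h1
  have hlim2 : Tendsto (fun t => pairing Ω (penalTerm ζ ψ θ ε (wt t)) v) (𝓝[>] 0)
      (𝓝 (pairing Ω (penalTerm ζ ψ θ ε w) v)) := by
    refine tendsto_integral_filter_of_dominated_convergence (fun x => |ζ x * v x|)
      (Eventually.of_forall fun t => ?_) (Eventually.of_forall fun t => ?_)
      (integrable_pairing hg hζ hvW.1 hvW.2.1).abs (Eventually.of_forall fun x => ?_)
    · exact ((memLstar_penalTerm hζ hθ hψ.1 (hwtW t).1).1.mul hvW.1.restrict).aestronglyMeasurable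
    · filter_upwards with x
      have h1 := hθ.mem_Icc ((wt t x - ψ x) / ε)
      simp only [penalTerm, norm_mul, Real.norm_eq_abs, abs_mul, abs_of_nonneg h1.1]
      gcongr
      exact mul_le_of_le_one_right (abs_nonneg _) h1.2
    · have hc : Continuous fun t : ℝ => penalTerm ζ ψ θ ε (wt t) x * v x := by
        have := hθ.cont
        simp only [penalTerm, hwt]
        fun_prop
      have h1 := hc.tendsto 0
      have h2 : wt 0 = w := by ext x; simp [hwt]
      rw [h2] at h1
      exact h1.mono_left nhdsWithin_le_nhds
  refine ge_of_tendsto ((hlim1.add hlim2).sub_const _) ?_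
  filter_upwards [Ioo_mem_nhdsGT (zero_lt_one' ℝ)] with t ht
  exact hpos t ht

/-- Existence for the variational inequality over a convex set of `W^{s,G}_0(Ω)`. Besides
closedness, the set has to supply the bound `hcoer` on the linear term and the passage from
Gagliardo-Cauchy sequences to convergence in `L^Ĝ`. -/
theorem exists_variational (hΩb : Bornology.IsBounded Ω) (hΩ : MeasurableSet Ω)
    {K : Set (E d → ℝ)} (hne : K.Nonempty) (hK : ∀ w ∈ K, MemW0 g s Ω w)
    (hconv : ∀ a ∈ K, ∀ b ∈ K, ∀ t : ℝ, 0 < t → t ≤ 1 → (fun x => a x + t * (b x - a x)) ∈ K)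
    {ζ ψ F : E d → ℝ} {θ : ℝ → ℝ} {ε : ℝ} (hζ : MemLstar g Ω ζ)
    (hζ0 : ∀ᵐ x ∂(volume.restrict Ω), 0 ≤ ζ x) (hθ : IsRamp θ) (hε : 0 < ε) (hψ : MemW g s ψ)
    (hF : MemLstar g Ω F) {C : ℝ}
    (hcoer : ∀ w ∈ K, 2 * pairing Ω F w ≤ (modS g s w).toReal + C)
    (hclosed : ∀ (w : ℕ → E d → ℝ) (v : E d → ℝ), (∀ n, w n ∈ K) → MemW0 g s Ω v →
      (∀ᵐ x, Tendsto (fun k => w k x) atTop (𝓝 (v x))) → v ∈ K)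
    (hcomp : ∀ (w : ℕ → E d → ℝ) (v : E d → ℝ), (∀ n, w n ∈ K) → AEMeasurable v →
      (∀ ε : ℝ≥0∞, 0 < ε → ∃ N, ∀ n m, N ≤ n → N ≤ m →
        modS g s (fun x => w n x - w m x) ≤ ε) →
      (∀ᵐ x, Tendsto (fun k => w k x) atTop (𝓝 (v x))) →
      Tendsto (fun n => modG g (fun x => w n x - v x)) atTop (𝓝 0)) :
    ∃ w ∈ K, ∀ z ∈ K, 0 ≤ opL g s w (fun x => z x - w x)
      + pairing Ω (penalTerm ζ ψ θ ε w) (fun x => z x - w x)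
      - pairing Ω F (fun x => z x - w x) := by
  have hKW : ∀ w ∈ K, MemW g s w := fun w hw => (hK w hw).1
  have hmid : ∀ a ∈ K, ∀ b ∈ K, (fun x => (a x + b x) / 2) ∈ K := by
    intro a ha b hb
    have := hconv a ha b hb (1 / 2) (by norm_num) (by norm_num)
    have h2 : (fun x => (a x + b x) / 2) = fun x => a x + 1 / 2 * (b x - a x) := by
      ext x; ring
    rwa [h2]
  suffices h : ∃ w ∈ K, ∀ z ∈ K,
      (modS g s w).toReal + (penalEnergy Ω ζ ψ θ ε w - pairing Ω F w) ≤
        (modS g s z).toReal + (penalEnergy Ω ζ ψ θ ε z - pairing Ω F z) by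
    obtain ⟨w, hw, hmin⟩ := h
    exact ⟨w, hw, fun z hz =>
      variational_of_minimiser hd hg hKW hconv hζ hζ0 hθ hε hψ hF hw hmin hz⟩
  refine exists_minimiser (s := s) hd hg hΩb hΩ hne hK hmid
    (V := fun w => penalEnergy Ω ζ ψ θ ε w - pairing Ω F w) (C := C) ?_ ?_ ?_
  · intro a ha b hb
    have haW := hKW a ha
    have hbW := hKW b hb
    set m : E d → ℝ := fun x => (a x + b x) / 2 with hm
    have hmW : MemW g s m := hKW m (hmid a ha b hb)
    have h1 := penalEnergy_tangent hg hζ hζ0 hθ hε hψ haW hmW (haW.sub hd hg hmW)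
    have h2 := penalEnergy_tangent hg hζ hζ0 hθ hε hψ hbW hmW (hbW.sub hd hg hmW)
    have h3 : (fun x => b x - m x) = fun x => (-1) * (a x - m x) := by
      ext x; simp only [hm]; ring
    rw [h3, pairing_const_mul] at h2
    have h4 : pairing Ω F a + pairing Ω F b = 2 * pairing Ω F m := by
      rw [← pairing_const_mul, ← pairing_add hg hF haW hbW]
      congr 1; ext x; simp only [hm]; ring
    linarith
  · intro w hw
    have h1 := hcoer w hw
    have h2 := penalEnergy_nonneg (ψ := ψ) hζ0 hθ hε w
    have h3 : 0 ≤ (modS g s w).toReal := ENNReal.toReal_nonneg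
    linarith
  · intro w v hw hv hC hlim
    have hwW : ∀ n, MemW g s (w n) := fun n => hKW _ (hw n)
    have hS := tendsto_modS_of_cauchy hd hg (fun n => (hwW n).1) hC hlim
    have hG := hcomp w v hw hv hC hlim
    have hT : Tendsto (fun n => modW g s (fun x => w n x - v x)) atTop (𝓝 0) := by
      have := hG.add hS
      rwa [add_zero] at this
    have hsymm : ∀ n, modW g s (fun x => v x - w n x) = modW g s (fun x => w n x - v x) := by
      intro n
      refine le_antisymm ?_ ?_ <;>
      exact modW_le_of_contraction hd hg (fun x => by rw [abs_sub_comm]) (fun x y => by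
        rw [← abs_neg]; apply le_of_eq; congr 1; ring)
    have hvW : MemW g s v := by
      obtain ⟨n, hn⟩ := ((ENNReal.tendsto_nhds_zero.1 hT) 1 one_pos).exists
      have h1 := (hwW n).sub hd hg
        (memW_iff.2 ⟨(hwW n).1.sub hv, hn.trans_lt ENNReal.one_lt_top⟩)
      simpa using h1
    have hv0 : MemW0 g s Ω v := by
      refine memW0_of_approx hd hg hvW fun η hη => ?_
      obtain ⟨n, hn⟩ := ((ENNReal.tendsto_nhds_zero.1 hT) η hη).exists
      exact ⟨w n, hK _ (hw n), (hsymm n).trans_le hn⟩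
    refine ⟨hclosed w v hw hv0 hlim, ?_⟩
    have hdW : ∀ n, MemW g s (fun x => w n x - v x) := fun n => (hwW n).sub hd hg hvW
    have h1 : Tendsto (fun n => pairing Ω F (w n)) atTop (𝓝 (pairing Ω F v)) := by
      rw [tendsto_iff_dist_tendsto_zero]
      have h2 := (tendsto_pairing_zero hg hF (fun n => (hdW n).1) hG).abs
      rw [abs_zero] at h2
      refine h2.congr fun n => ?_
      rw [pairing_sub hg hF (hwW n) hvW, Real.dist_eq]
    have h3 : Tendsto (fun n => penalEnergy Ω ζ ψ θ ε (w n)) atTop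
        (𝓝 (penalEnergy Ω ζ ψ θ ε v)) := by
      rw [tendsto_iff_dist_tendsto_zero]
      have habs : ∀ n, MemW g s (fun x => |w n x - v x|) := fun n => (hdW n).abs hd hg
      have hG' : Tendsto (fun n => modG g (fun x => |w n x - v x|)) atTop (𝓝 0) :=
        hG.congr fun n => (hg.famG.modular_abs _).symm
      refine squeeze_zero (fun _ => dist_nonneg) (fun n => ?_)
        (tendsto_pairing_zero hg hζ (fun n => (habs n).1) hG')
      rw [Real.dist_eq]
      exact abs_penalEnergy_sub_le hg hζ hζ0 hθ hε hψ (hwW n) hvW (habs n)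
    exact h3.sub h1

end Variational

/-! ### Existence -/

section Existence

variable (hd : 0 < d) (hg : IsAdmissible gl gu kl ku g)
include hd hg

/-- The variational inequality on an order interval of `W^{s,G}_0(Ω)` is solvable: the interval
bounds the linear term and dominates minimising sequences, so that no Poincaré inequality is
needed. -/
theorem exists_variational_between (hΩb : Bornology.IsBounded Ω) (hΩ : MeasurableSet Ω)
    {a b F : E d → ℝ} (ha : MemW0 g s Ω a) (hb : MemW0 g s Ω b) (hab : ∀ᵐ x, a x ≤ b x)
    (hF : MemLstar g Ω F) :
    ∃ w, MemW0 g s Ω w ∧ (∀ᵐ x, a x ≤ w x ∧ w x ≤ b x) ∧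
      ∀ z, MemW0 g s Ω z → (∀ᵐ x, a x ≤ z x ∧ z x ≤ b x) →
        0 ≤ opL g s w (fun x => z x - w x) - pairing Ω F (fun x => z x - w x) := by
  set K : Set (E d → ℝ) := {w | MemW0 g s Ω w ∧ ∀ᵐ x, a x ≤ w x ∧ w x ≤ b x} with hK
  have hζ : MemLstar g Ω (fun x => |F x|) :=
    hF.mono (by simpa only [Real.norm_eq_abs] using hF.1.norm)
      (Eventually.of_forall fun x => by rw [abs_abs])
  have habs : MemW g s (fun x => |a x| + |b x|) :=
    (ha.1.abs hd hg).add hd hg (hb.1.abs hd hg)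
  obtain ⟨w, hw, hvar⟩ := exists_variational (s := s) (ψ := a) (θ := fun _ => 0) (ε := 1) (F := F)
    (C := 2 * pairing Ω (fun x => |F x|) (fun x => |a x| + |b x|)) hd hg hΩb hΩ (K := K)
    ⟨a, ha, hab.mono fun x hx => ⟨le_rfl, hx⟩⟩ (fun w hw => hw.1)
    (by
      intro w₁ h₁ w₂ h₂ t ht ht1
      refine ⟨h₁.1.add hd hg ((h₂.1.sub hd hg h₁.1).const_mul hd hg t), ?_⟩
      filter_upwards [h₁.2, h₂.2] with x hx₁ hx₂
      constructor <;> nlinarith [hx₁.1, hx₁.2, hx₂.1, hx₂.2])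
    hζ (Eventually.of_forall fun x => abs_nonneg _) isRamp_zero one_pos ha.1 hF
    (by
      intro w hw
      have h1 : pairing Ω F w ≤ pairing Ω (fun x => |F x|) (fun x => |a x| + |b x|) := by
        refine integral_mono_ae (integrable_pairing hg hF hw.1.1.1 hw.1.1.2.1)
          (integrable_pairing hg hζ habs.1 habs.2.1) ?_
        filter_upwards [ae_restrict_of_ae hw.2] with x hx
        have h2 : |w x| ≤ |a x| + |b x| := by
          rw [abs_le]
          constructor
          · linarith [neg_abs_le (a x), abs_nonneg (b x)]
          · linarith [le_abs_self (b x), abs_nonneg (a x)]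
        calc F x * w x ≤ |F x| * |w x| := by rw [← abs_mul]; exact le_abs_self _
          _ ≤ |F x| * (|a x| + |b x|) := by gcongr
      have h3 : 0 ≤ (modS g s w).toReal := ENNReal.toReal_nonneg
      linarith)
    (by
      intro w v hw hv hlim
      refine ⟨hv, ?_⟩
      filter_upwards [hlim, ae_all_iff.2 fun n => (hw n).2] with x hx h
      exact ⟨ge_of_tendsto' hx fun n => (h n).1, le_of_tendsto' hx fun n => (h n).2⟩)
    (by
      intro w v hw hv _ hlim
      refine hg.famG.tendsto_modular_zero (w := fun n x => w n x - v x) (y := fun _ _ => 0)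
        (Y := fun x => b x - a x)
        (fun n => (hw n).1.1.1.sub hv) (fun _ => aemeasurable_const) ?_ (fun n => ?_) ?_
        (hb.1.sub hd hg ha.1).2.1
      · filter_upwards [hlim] with x hx
        simpa using hx.sub_const (v x)
      · filter_upwards [hlim, ae_all_iff.2 fun n => (hw n).2] with x hx h
        have h1 := ge_of_tendsto' hx fun n => (h n).1
        have h2 := le_of_tendsto' hx fun n => (h n).2
        rw [abs_zero, zero_add]
        refine le_trans ?_ (le_abs_self _)
        rw [abs_le]
        constructor <;> linarith [(h n).1, (h n).2]
      · simp [modular, youngG, primG])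
  refine ⟨w, hw.1, hw.2, fun z hz hz' => ?_⟩
  have h1 := hvar z ⟨hz, hz'⟩
  have h2 : pairing Ω (penalTerm (fun x => |F x|) a (fun _ => 0) 1 w) (fun x => z x - w x) = 0 := by
    simp [pairing, penalTerm]
  linarith

/-- Under the Poincaré inequality, smallness of the Gagliardo modular on `W^{s,G}_0(Ω)` implies
smallness of the modular of `L^Ĝ`. -/
theorem HasPoincare.exists_modG_le (hP : HasPoincare g s Ω) {ε : ℝ≥0∞} (hε : 0 < ε) :
    ∃ δ : ℝ≥0∞, 0 < δ ∧ ∀ v, MemW0 g s Ω v → modS g s v ≤ δ → modG g v ≤ ε := by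
  obtain ⟨C, hC⟩ := hP
  obtain ⟨t, ht, ht1, htε⟩ := exists_real_small hε
  have hC0 : (0 : ℝ) ≤ C := C.2
  set t' : ℝ := t / (C + 1) with ht'
  have ht'0 : 0 < t' := by positivity
  have ht'1 : t' ≤ 1 := by
    rw [ht', div_le_one (by positivity)]; linarith
  refine ⟨ENNReal.ofReal (t' ^ (gu + 1)), by positivity, fun v hv h => ?_⟩
  have h1 := (hg.scalingS (s := s) hd).luxemburg_le_of_le ht'0 ht'1 h
  have h2 : normG g v < ENNReal.ofReal t := by
    calc normG g v ≤ C * seminormS g s v := hC v hv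
      _ ≤ C * ENNReal.ofReal t' := by gcongr; exact h1
      _ = ENNReal.ofReal (C * t') := by
          rw [ENNReal.ofReal_mul hC0, ENNReal.ofReal_coe_nnreal]
      _ < ENNReal.ofReal t := by
          rw [ENNReal.ofReal_lt_ofReal_iff ht, ht', mul_div_assoc', div_lt_iff₀ (by positivity)]
          nlinarith
  refine (hg.scalingG.le_of_luxemburg_lt ht1 h2).trans (le_trans ?_ htε)
  exact ENNReal.ofReal_le_ofReal (by linarith)

/-- Under the Poincaré inequality the linear term is controlled by the energy, since the modular is
superlinear in the norm. -/
theorem HasPoincare.exists_coercive (hP : HasPoincare g s Ω) {F : E d → ℝ}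
    (hF : MemLstar g Ω F) :
    ∃ C : ℝ, ∀ w, MemW0 g s Ω w → 2 * pairing Ω F w ≤ (modS g s w).toReal + C := by
  obtain ⟨C, hC⟩ := hP
  set M : ℝ := 2 * ((modStar g Ω F).toReal + 1) * C with hM
  have hMF : 0 ≤ (modStar g Ω F).toReal + 1 := by positivity
  have hM0 : 0 ≤ M := by positivity
  have h0 : Tendsto (fun K : ℝ => M * K ^ (-gl)) atTop (𝓝 (M * 0)) :=
    (tendsto_rpow_neg_atTop hg.gl_pos).const_mul M
  rw [mul_zero] at h0
  -- `K` is so large that `M K ^ (-gl) ≤ 1`.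
  obtain ⟨K, hK1, hKM⟩ :=
    ((eventually_ge_atTop (1 : ℝ)).and (h0.eventually_le_const one_pos)).exists
  refine ⟨M * K, fun w hw => ?_⟩
  have h1 := ofReal_abs_pairing_le hg hF hw.1.1
  have h2 := (hg.scalingS (s := s) hd).luxemburg_le_add hw.1.2.2 hK1
  set S := (modS g s w).toReal with hS
  have hS0 : 0 ≤ S := ENNReal.toReal_nonneg
  have hK0 : 0 ≤ K ^ (-gl) := by positivity
  have h3 : ENNReal.ofReal |pairing Ω F w| ≤
      ENNReal.ofReal (((modStar g Ω F).toReal + 1) * (C * (K + K ^ (-gl) * S))) := by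
    rw [ENNReal.ofReal_mul hMF, ENNReal.ofReal_mul (NNReal.coe_nonneg C), ENNReal.ofReal_coe_nnreal]
    refine h1.trans ?_
    gcongr
    exact (hC w hw).trans (by gcongr; exact h2)
  rw [ENNReal.ofReal_le_ofReal_iff (by positivity)] at h3
  have h4 := le_abs_self (pairing Ω F w)
  have h5 : M * K ^ (-gl) * S ≤ 1 * S := by gcongr
  have h6 : 2 * (((modStar g Ω F).toReal + 1) * (C * (K + K ^ (-gl) * S))) =
      M * K + M * K ^ (-gl) * S := by rw [hM]; ring
  linarith

/-- Existence for the penalised problem. The function `w₀` only witnesses that `W^{s,G}_0(Ω)` is not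
empty. -/
theorem exists_isPenalSol (hΩb : Bornology.IsBounded Ω) (hΩ : MeasurableSet Ω)
    (hP : HasPoincare g s Ω) {f ψ ζ : E d → ℝ} (hf : MemLstar g Ω f) (hζ : MemLstar g Ω ζ)
    (hζ0 : ∀ᵐ x ∂(volume.restrict Ω), 0 ≤ ζ x) (hψ : MemW g s ψ) {w₀ : E d → ℝ}
    (hw₀ : MemW0 g s Ω w₀) {θ : ℝ → ℝ} (hθ : IsRamp θ) {ε : ℝ} (hε : 0 < ε) :
    ∃ w, IsPenalSol g s Ω f ψ ζ θ ε w := by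
  have hF := hf.add hg hζ
  obtain ⟨C, hC⟩ := HasPoincare.exists_coercive hd hg hP hF
  obtain ⟨w, hw, hvar⟩ := exists_variational (s := s) hd hg hΩb hΩ (K := {w | MemW0 g s Ω w})
    ⟨w₀, hw₀⟩ (fun w hw => hw)
    (fun a ha b hb t _ _ => MemW0.add hd hg ha
      (MemW0.const_mul hd hg t (MemW0.sub hd hg hb ha))) hζ hζ0 hθ hε hψ hF hC
    (fun _ _ _ hv _ => hv)
    (by
      intro w v hw hv hCau hlim
      rw [ENNReal.tendsto_nhds_zero]
      intro η hη
      obtain ⟨δ, hδ, hδη⟩ := HasPoincare.exists_modG_le hd hg hP hη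
      obtain ⟨N, hN⟩ := hCau δ hδ
      filter_upwards [eventually_ge_atTop N] with n hn
      refine hg.famG.modular_le_of_tendsto (z := fun m x => w n x - w m x)
        (w := fun x => w n x - v x)
        (fun m => (hw n).1.1.sub (hw m).1.1) ?_ ?_
      · filter_upwards [hlim] with x hx
        exact hx.const_sub _
      · filter_upwards [eventually_ge_atTop N] with m hm
        exact hδη _ ((hw n).sub hd hg (hw m)) (hN n m hn hm))
  refine ⟨w, hw, fun v hv => ?_⟩
  have h1 := hvar (fun x => w x + v x) (MemW0.add hd hg hw hv)
  have h2 := hvar (fun x => w x - v x) (MemW0.sub hd hg hw hv)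
  have e1 : (fun x => w x + v x - w x) = v := by ext x; ring
  have e2 : (fun x => w x - v x - w x) = fun x => (-1) * v x := by ext x; ring
  rw [e1] at h1
  rw [e2, opL_const_mul, pairing_const_mul, pairing_const_mul] at h2
  change opL g s w v + pairing Ω (penalTerm ζ ψ θ ε w) v = _
  linarith

end Existence

/-! ### The Lewy-Stampacchia inequality -/

theorem opL_congr_left {u v : E d → ℝ} (h : ∀ᵐ x, u x = v x) (w : E d → ℝ) :
    opL g s u w = opL g s v w := by
  rw [opL_eq, opL_eq]
  refine integral_congr_ae ?_
  filter_upwards [ae_pair h] with z hz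
  simp only [quot, delta, hz.1, hz.2]

theorem IsDual.sub {F H : (E d → ℝ) → ℝ} (hF : IsDual g s Ω F) (hH : IsDual g s Ω H) :
    IsDual g s Ω (fun v => F v - H v) where
  add v w hv hw := by rw [hF.add v w hv hw, hH.add v w hv hw]; ring
  smul c v hv := by rw [hF.smul c v hv, hH.smul c v hv]; ring
  bounded := by
    obtain ⟨A, hA⟩ := hF.bounded
    obtain ⟨B, hB⟩ := hH.bounded
    refine ⟨A + B, fun v hv => ?_⟩
    calc ENNReal.ofReal |F v - H v| ≤ ENNReal.ofReal (|F v| + |H v|) :=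
          ENNReal.ofReal_le_ofReal (abs_sub _ _)
      _ = ENNReal.ofReal |F v| + ENNReal.ofReal |H v| :=
          ENNReal.ofReal_add (abs_nonneg _) (abs_nonneg _)
      _ ≤ A * normW g s v + B * normW g s v := add_le_add (hA v hv) (hB v hv)
      _ = _ := by rw [ENNReal.coe_add, add_mul]

section Obstacle

variable (hd : 0 < d) (hg : IsAdmissible gl gu kl ku g)

include hd hg in
/-- A function in `L^{Ĝ^*}(Ω)` that is nonnegative as a functional is nonnegative. -/
theorem ae_nonneg_of_dualLE (hs0 : 0 < s) (hs1 : s < 1) (hΩ : IsOpen Ω)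
    (hΩb : Bornology.IsBounded Ω) {ζ : E d → ℝ}
    (hζ : MemLstar g Ω ζ) (h : DualLE g s Ω (fun _ => 0) (pairing Ω ζ)) :
    ∀ᵐ x ∂(volume.restrict Ω), 0 ≤ ζ x :=
  ae_nonneg_of_forall_test hΩ hΩb (hζ.integrable hg hΩb) fun v hv h0 =>
    h v (hv.memW0 hd hg hs0 hs1) (Eventually.of_forall h0)

include hd hg in
/-- An element of the obstacle set lies above the obstacle on the whole space. -/
theorem MemK.ae_le (hΩ : MeasurableSet Ω) {ψ u : E d → ℝ} (hu : MemK g s Ω ψ u)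
    (hψ0 : ∀ᵐ x ∂(volume.restrict Ωᶜ), ψ x ≤ 0) : ∀ᵐ x, ψ x ≤ u x := by
  have h1 := (ae_restrict_iff' hΩ).1 hu.2
  have h2 := (ae_restrict_iff' hΩ.compl).1 hψ0
  filter_upwards [h1, h2, hu.1.ae_eq_zero hd hg hΩ] with x h1 h2 h3
  by_cases hx : x ∈ Ω
  · exact h1 hx
  · rw [h3 hx]; exact h2 hx

include hd hg in
/-- The excess of the obstacle over a function of `W^{s,G}_0(Ω)` is in `W^{s,G}_0(Ω)` again,
although the obstacle need not be. -/
theorem memW0_excess {ψ u w : E d → ℝ} (hψ : MemW0 g s univ ψ) (hu : MemW0 g s Ω u)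
    (hψu : ∀ᵐ x, ψ x ≤ u x) (hw : MemW0 g s Ω w) :
    MemW0 g s Ω (fun x => max (ψ x - w x) 0) := by
  refine MemW0.of_le hd hg ((hψ.sub hd hg (hw.mono (subset_univ _))).posPart hd hg)
    ((hu.sub hd hg hw).posPart hd hg) (Eventually.of_forall fun x => le_max_right _ _) ?_
  filter_upwards [hψu] with x hx
  exact max_le_max_right _ (by linarith)

include hd hg in
/-- The lower Lewy-Stampacchia bound: `u + v` is admissible for `v ≥ 0`. -/
theorem IsObstacleSol.pairing_le_opL {f ψ u : E d → ℝ} (hu : IsObstacleSol g s Ω f ψ u)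
    {v : E d → ℝ} (hv : MemW0 g s Ω v) (hv0 : ∀ᵐ x, 0 ≤ v x) :
    pairing Ω f v ≤ opL g s u v := by
  have h1 := hu.2 (fun x => u x + v x) ⟨hu.1.1.add hd hg hv, by
    filter_upwards [hu.1.2, ae_restrict_of_ae hv0] with x h1 h2
    linarith⟩
  have e1 : (fun x => u x + v x - u x) = v := by ext x; ring
  rw [e1] at h1
  linarith

include hd hg in
/-- The upper Lewy-Stampacchia bound, tested with `φ ≥ 0`: the solution of the variational
inequality with the larger datum `F` on the order interval `[u - φ, u]` lies above the obstacle,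
hence solves the same problem as `u` and equals `u`. -/
theorem IsObstacleSol.opL_le_pairing (hΩb : Bornology.IsBounded Ω) (hΩ : MeasurableSet Ω)
    {f F ψ u : E d → ℝ} (hu : IsObstacleSol g s Ω f ψ u) (hψ : MemW0 g s univ ψ)
    (hψu : ∀ᵐ x, ψ x ≤ u x) (hf : MemLstar g Ω f) (hF : MemLstar g Ω F)
    (hfF : ∀ᵐ x ∂(volume.restrict Ω), f x ≤ F x)
    (hψF : ∀ v, MemW0 g s Ω v → (∀ᵐ x, 0 ≤ v x) → opL g s ψ v ≤ pairing Ω F v)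
    {φ : E d → ℝ} (hφ : MemW0 g s Ω φ) (hφ0 : ∀ᵐ x, 0 ≤ φ x) :
    opL g s u φ ≤ pairing Ω F φ := by
  have huW := hu.1.1
  obtain ⟨w, hw, hwb, hvar⟩ := exists_variational_between (s := s) hd hg hΩb hΩ
    (a := fun x => u x - φ x) (huW.sub hd hg hφ) huW (hφ0.mono fun x hx => by linarith) hF
  have hk := memW0_excess hd hg hψ huW hψu hw
  have hψw : ∀ᵐ x, ψ x ≤ w x := by
    refine ae_le_of_opL_le hd hg hΩb hψ.1 hw.1 (hk.ae_eq_zero hd hg hΩ) ?_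
    refine (hψF _ hk (Eventually.of_forall fun x => le_max_right _ _)).trans ?_
    have h1 := hvar (fun x => w x + max (ψ x - w x) 0) (hw.add hd hg hk) (by
      filter_upwards [hwb, hψu] with x h1 h2
      refine ⟨by linarith [le_max_right (ψ x - w x) 0], ?_⟩
      rcases max_cases (ψ x - w x) 0 with h | h <;> linarith)
    have e1 : (fun x => w x + max (ψ x - w x) 0 - w x) = fun x => max (ψ x - w x) 0 := by
      ext x; ring
    rw [e1] at h1
    linarith
  have hpos : ∀ᵐ x, max (u x - w x) 0 = u x - w x := by
    filter_upwards [hwb] with x hx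
    exact max_eq_left (by linarith)
  have hd' : MemW0 g s Ω (fun x => u x - w x) := huW.sub hd hg hw
  have huw : ∀ᵐ x, u x ≤ w x := by
    refine ae_le_of_opL_le hd hg hΩb huW.1 hw.1 ?_ ?_
    · filter_upwards [hpos, hd'.ae_eq_zero hd hg hΩ] with x h1 h2 hx
      rw [h1, h2 hx]
    · rw [opL_congr _ hpos, opL_congr _ hpos]
      have h1 := hvar u huW (by
        filter_upwards [hwb, hφ0] with x h1 h2
        exact ⟨by linarith, le_rfl⟩)
      have h2 := hu.2 w ⟨hw, ae_restrict_of_ae hψw⟩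
      have e1 : (fun x => w x - u x) = fun x => (-1) * (u x - w x) := by ext x; ring
      rw [e1, opL_const_mul, pairing_const_mul] at h2
      have h3 : pairing Ω f (fun x => u x - w x) ≤ pairing Ω F (fun x => u x - w x) := by
        refine pairing_mono_left hg hf hF hd'.1 ?_
        filter_upwards [hfF, ae_restrict_of_ae hwb] with x h3 h4
        exact mul_le_mul_of_nonneg_right h3 (by linarith)
      linarith
  have heq : ∀ᵐ x, w x = u x := by
    filter_upwards [hwb, huw] with x h1 h2
    exact le_antisymm h1.2 h2
  have h1 := hvar (fun x => u x - φ x) (huW.sub hd hg hφ) (by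
    filter_upwards [hφ0] with x hx
    exact ⟨le_rfl, by linarith⟩)
  have h2 : ∀ᵐ x, u x - φ x - w x = (-1) * φ x := by
    filter_upwards [heq] with x hx
    rw [hx]; ring
  rw [opL_congr_left heq, opL_congr _ h2, pairing_congr _ h2, opL_const_mul,
    pairing_const_mul] at h1
  linarith

include hd hg in
/-- A functional `L u` between two functions of `L^{Ĝ^*}(Ω)` is itself such a function. -/
theorem exists_density_opL (hs0 : 0 < s) (hs1 : s < 1) (hΩ : IsOpen Ω)
    (hΩb : Bornology.IsBounded Ω) {f ζ u : E d → ℝ} (hu : MemW g s u)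
    (hf : MemLstar g Ω f) (hζ : MemLstar g Ω ζ) (hζ0 : ∀ᵐ x ∂(volume.restrict Ω), 0 ≤ ζ x)
    (hlow : ∀ v, MemW0 g s Ω v → (∀ᵐ x, 0 ≤ v x) → pairing Ω f v ≤ opL g s u v)
    (hup : ∀ v, MemW0 g s Ω v → (∀ᵐ x, 0 ≤ v x) →
      opL g s u v ≤ pairing Ω (fun x => f x + ζ x) v) :
    ∃ h : E d → ℝ, MemLstar g Ω h ∧ (∀ v, MemW0 g s Ω v → opL g s u v = pairing Ω h v) ∧
      ∀ᵐ x ∂(volume.restrict Ω), f x ≤ h x ∧ h x ≤ f x + ζ x := by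
  have htest : ∀ v, IsTest Ω v → MemW0 g s Ω v := fun v hv => hv.memW0 hd hg hs0 hs1
  let F : testSpace Ω →ₗ[ℝ] ℝ :=
    { toFun := fun v => opL g s u v.1 - pairing Ω f v.1
      map_add' := fun v w => by
        have h1 := opL_add hd hg hu (htest _ v.2).1 (htest _ w.2).1
        have h2 := pairing_add hg hf (htest _ v.2).1 (htest _ w.2).1
        change opL g s u (fun x => v.1 x + w.1 x) - pairing Ω f (fun x => v.1 x + w.1 x) = _
        rw [h1, h2]; ring
      map_smul' := fun c v => by
        change opL g s u (fun x => c * v.1 x) - pairing Ω f (fun x => c * v.1 x) = _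
        rw [opL_const_mul, pairing_const_mul]
        simp only [RingHom.id_apply, smul_eq_mul]
        ring }
  have hF0 : ∀ v, MemW0 g s Ω v → (∀ᵐ x, 0 ≤ v x) → 0 ≤ opL g s u v - pairing Ω f v ∧
      opL g s u v - pairing Ω f v ≤ pairing Ω ζ v := by
    intro v hv h0
    have h1 := hlow v hv h0
    have h2 := hup v hv h0
    rw [pairing_add_left hg hf hζ hv.1] at h2
    constructor <;> linarith
  obtain ⟨η, hηi, hη, hFη⟩ := exists_density_of_order_bounded hΩ hΩb (hζ.integrable hg hΩb) hζ0 F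
    (fun v => by
      change |opL g s u v.1 - pairing Ω f v.1| ≤ pairing Ω ζ (fun x => |v.1 x|)
      have hv := htest _ v.2
      have hav := hv.abs hd hg
      have h0 := (hF0 _ hav (Eventually.of_forall fun x => abs_nonneg _)).2
      have h1 := (hF0 _ (hav.sub hd hg hv)
        (Eventually.of_forall fun x => by linarith [le_abs_self (v.1 x)])).1
      have h2 := (hF0 _ (hav.add hd hg hv)
        (Eventually.of_forall fun x => by linarith [neg_abs_le (v.1 x)])).1
      rw [opL_sub hd hg hu hav.1 hv.1, pairing_sub hg hf hav.1 hv.1] at h1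
      rw [opL_add hd hg hu hav.1 hv.1, pairing_add hg hf hav.1 hv.1] at h2
      rw [abs_le]
      constructor <;> linarith)
    (fun v h0 => hF0 _ (htest _ v.2) (Eventually.of_forall h0))
  have hηL : MemLstar g Ω η := hζ.mono hηi.aemeasurable (hη.mono fun x hx => by
    rw [abs_of_nonneg hx.1]; exact hx.2.trans (le_abs_self _))
  have hh : MemLstar g Ω (fun x => f x + η x) := hf.add hg hηL
  refine ⟨fun x => f x + η x, hh, fun v hv => ?_, hη.mono fun x hx => ⟨by linarith, by linarith⟩⟩
  obtain ⟨φ, hφ, hφv⟩ := hv.exists_seq hd hg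
  have hW : Tendsto (fun n => modW g s (fun x => v x - φ n x)) atTop (𝓝 0) :=
    tendsto_of_tendsto_of_tendsto_of_le_of_le tendsto_const_nhds
      (tendsto_rate (hg.gl_pos.trans_le hg.gl_le)) (fun _ => zero_le) hφv
  have hm : ∀ n, AEMeasurable (fun x => v x - φ n x) := fun n => hv.1.1.sub (htest _ (hφ n)).1.1
  have hG : Tendsto (fun n => modG g (fun x => v x - φ n x)) atTop (𝓝 0) :=
    tendsto_of_tendsto_of_tendsto_of_le_of_le tendsto_const_nhds hW (fun _ => zero_le)
      (fun n => le_self_add)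
  have hS : Tendsto (fun n => modS g s (fun x => v x - φ n x)) atTop (𝓝 0) :=
    tendsto_of_tendsto_of_tendsto_of_le_of_le tendsto_const_nhds hW (fun _ => zero_le)
      (fun n => le_add_self)
  have h1 := (tendsto_opL_zero hg hd hu hm hS).sub (tendsto_pairing_zero hg hh hm hG)
  have h2 : ∀ n, opL g s u (fun x => v x - φ n x) - pairing Ω (fun x => f x + η x)
      (fun x => v x - φ n x) = opL g s u v - pairing Ω (fun x => f x + η x) v := by
    intro n
    have hφW := (htest _ (hφ n)).1
    have h3 : opL g s u (φ n) - pairing Ω f (φ n) = pairing Ω η (φ n) := hFη ⟨φ n, hφ n⟩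
    rw [opL_sub hd hg hu hv.1 hφW, pairing_sub hg hh hv.1 hφW,
      pairing_add_left hg hf hηL hφW]
    linarith
  simp only [h2, sub_zero] at h1
  have := tendsto_nhds_unique h1 tendsto_const_nhds
  linarith

include hg in
/-- Translation of a supremum in the dual by a function. -/
theorem isDualSup_add {f ψ ζ : E d → ℝ} (hf : MemLstar g Ω f)
    (hζ : MemLstar g Ω ζ)
    (h : IsDualSup g s Ω (fun v => opL g s ψ v - pairing Ω f v) (fun _ => 0) (pairing Ω ζ)) :
    IsDualSup g s Ω (pairing Ω f) (opL g s ψ) (pairing Ω (fun x => f x + ζ x)) := by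
  obtain ⟨-, h1, h2, h3⟩ := h
  refine ⟨isDual_pairing hg (hf.add hg hζ), fun v hv h0 => ?_, fun v hv h0 => ?_,
    fun T hT hT1 hT2 v hv h0 => ?_⟩
  · have := h2 v hv h0
    rw [pairing_add_left hg hf hζ hv.1]
    linarith
  · have := h1 v hv h0
    rw [pairing_add_left hg hf hζ hv.1]
    linarith
  · have := h3 (fun v => T v - pairing Ω f v) (hT.sub (isDual_pairing hg hf))
      (fun v hv h0 => sub_le_sub_right (hT2 v hv h0) _)
      (fun v hv h0 => sub_nonneg.2 (hT1 v hv h0)) v hv h0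
    rw [pairing_add_left hg hf hζ hv.1]
    linarith

end Obstacle

/-! ### Comparison for the penalised problem -/

section Penalised

variable {f ψ ζ u : E d → ℝ} {θ : ℝ → ℝ} {ε ε' : ℝ} {w w' : E d → ℝ}
  (hd : 0 < d) (hg : IsAdmissible gl gu kl ku g) (hΩ : MeasurableSet Ω)
  (hΩb : Bornology.IsBounded Ω) (hf : MemLstar g Ω f) (hζ : MemLstar g Ω ζ)
  (hζ0 : ∀ᵐ x ∂(volume.restrict Ω), 0 ≤ ζ x) (hθ : IsRamp θ)
  (hψ : MemW0 g s univ ψ) (hu : MemW0 g s Ω u) (hψu : ∀ᵐ x, ψ x ≤ u x)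
  (hψF : ∀ v, MemW0 g s Ω v → (∀ᵐ x, 0 ≤ v x) → opL g s ψ v ≤ pairing Ω (fun x => f x + ζ x) v)

theorem IsPenalSol.opL_add_pairing (hw : IsPenalSol g s Ω f ψ ζ θ ε w) {v : E d → ℝ}
    (hv : MemW0 g s Ω v) : opL g s w v + pairing Ω (penalTerm ζ ψ θ ε w) v =
      pairing Ω (fun x => f x + ζ x) v :=
  hw.2 v hv

include hd hg hΩ hΩb hθ hψ hu hψu hψF

/-- Solutions of the penalised problem lie above the obstacle: where `w < ψ` the penalisation is not
active, and `L w = f + ζ` there. -/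
theorem IsPenalSol.obstacle_le (hε : 0 < ε) (hw : IsPenalSol g s Ω f ψ ζ θ ε w) :
    ∀ᵐ x, ψ x ≤ w x := by
  have hk := memW0_excess hd hg hψ hu hψu hw.1
  refine ae_le_of_opL_le hd hg hΩb hψ.1 hw.1.1 (hk.ae_eq_zero hd hg hΩ) ?_
  have h1 := hw.opL_add_pairing hk
  have h2 : pairing Ω (penalTerm ζ ψ θ ε w) (fun x => max (ψ x - w x) 0) = 0 := by
    have h3 : ∀ x, penalTerm ζ ψ θ ε w x * max (ψ x - w x) 0 = 0 := by
      intro x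
      rcases le_total (ψ x) (w x) with h | h
      · rw [max_eq_right (by linarith), mul_zero]
      · rw [penalTerm, hθ.eq_zero _ (div_nonpos_of_nonpos_of_nonneg (by linarith) hε.le), mul_zero,
          zero_mul]
    simp [pairing, h3]
  have h4 := hψF _ hk (Eventually.of_forall fun x => le_max_right _ _)
  linarith

include hζ hζ0

/-- Solutions of the penalised problem increase with `ε`. As they lie above the obstacle, where
`w > w'` the argument of `θ` is larger for `w` and the smaller parameter. -/
theorem IsPenalSol.mono (hε : 0 < ε) (hεε : ε ≤ ε') (hw : IsPenalSol g s Ω f ψ ζ θ ε w)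
    (hw' : IsPenalSol g s Ω f ψ ζ θ ε' w') : ∀ᵐ x, w x ≤ w' x := by
  have hk := (hw.1.sub hd hg hw'.1).posPart hd hg
  refine ae_le_of_opL_le hd hg hΩb hw.1.1 hw'.1.1 (hk.ae_eq_zero hd hg hΩ) ?_
  have h1 := hw.opL_add_pairing hk
  have h2 := hw'.opL_add_pairing hk
  have h3 : pairing Ω (penalTerm ζ ψ θ ε' w') (fun x => max (w x - w' x) 0) ≤
      pairing Ω (penalTerm ζ ψ θ ε w) (fun x => max (w x - w' x) 0) := by
    refine pairing_mono_left hg (memLstar_penalTerm hζ hθ hψ.1.1 hw'.1.1.1)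
      (memLstar_penalTerm hζ hθ hψ.1.1 hw.1.1.1) hk.1 ?_
    have h4 := hw'.obstacle_le hd hg hΩ hΩb hθ hψ hu hψu hψF (hε.trans_le hεε)
    filter_upwards [hζ0, ae_restrict_of_ae h4] with x hx h4
    rcases le_total (w x) (w' x) with h | h
    · rw [max_eq_right (by linarith), mul_zero, mul_zero]
    · refine mul_le_mul_of_nonneg_right (mul_le_mul_of_nonneg_left (hθ.mono ?_) hx)
        (le_max_right _ _)
      exact div_le_div₀ (by linarith) (by linarith) hε hεε
  linarith

theorem IsPenalSol.ae_eq (hε : 0 < ε) (hw : IsPenalSol g s Ω f ψ ζ θ ε w)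
    (hw' : IsPenalSol g s Ω f ψ ζ θ ε w') : w =ᵐ[volume] w' := by
  filter_upwards [hw.mono hd hg hΩ hΩb hζ hζ0 hθ hψ hu hψu hψF hε le_rfl hw',
    hw'.mono hd hg hΩ hΩb hζ hζ0 hθ hψ hu hψu hψF hε le_rfl hw] with x h1 h2
  exact le_antisymm h1 h2

omit hu
include hf

/-- The solution of the obstacle problem lies below those of the penalised problems. -/
theorem IsObstacleSol.le_penalSol (hobs : IsObstacleSol g s Ω f ψ u) (hε : 0 < ε)
    (hw : IsPenalSol g s Ω f ψ ζ θ ε w) : ∀ᵐ x, u x ≤ w x := by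
  have hk := (hobs.1.1.sub hd hg hw.1).posPart hd hg
  have hψw := hw.obstacle_le hd hg hΩ hΩb hθ hψ hobs.1.1 hψu hψF hε
  refine ae_le_of_opL_le hd hg hΩb hobs.1.1.1 hw.1.1 (hk.ae_eq_zero hd hg hΩ) ?_
  have h1 := hw.opL_add_pairing hk
  have h2 := hobs.2 (fun x => u x - max (u x - w x) 0) ⟨hobs.1.1.sub hd hg hk, by
    filter_upwards [ae_restrict_of_ae hψu, ae_restrict_of_ae hψw] with x h1 h2
    rcases max_cases (u x - w x) 0 with h | h <;> linarith⟩
  have e1 : (fun x => u x - max (u x - w x) 0 - u x) = fun x => (-1) * max (u x - w x) 0 := by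
    ext x; ring
  rw [e1, opL_const_mul, pairing_const_mul] at h2
  have h3 : pairing Ω (penalTerm ζ ψ θ ε w) (fun x => max (u x - w x) 0) ≤
      pairing Ω ζ (fun x => max (u x - w x) 0) := by
    refine pairing_mono_left hg (memLstar_penalTerm hζ hθ hψ.1.1 hw.1.1.1) hζ hk.1 ?_
    filter_upwards [hζ0] with x hx
    exact mul_le_mul_of_nonneg_right (mul_le_of_le_one_right hx (hθ.mem_Icc _).2)
      (le_max_right _ _)
  rw [pairing_add_left hg hf hζ hk.1] at h1
  linarith

/-- The monotonicity gap between the penalised and the obstacle problem is of order `ε`: its density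
is at most `ζ (1 - θ(t)) ε t` with `t = (w - ψ) / ε`, because `ψ ≤ u ≤ w`. -/
theorem opL_gap_le (hobs : IsObstacleSol g s Ω f ψ u) (hε : 0 < ε)
    (hw : IsPenalSol g s Ω f ψ ζ θ ε w) {C : ℝ} (hC0 : 0 < C)
    (hC : ∀ t, 0 < t → (1 - θ t) * t ≤ C) :
    opL g s w (fun x => w x - u x) - opL g s u (fun x => w x - u x) ≤
      ε * C * ∫ x in Ω, ζ x := by
  have hv := hw.1.sub hd hg hobs.1.1
  have huw := hobs.le_penalSol hd hg hΩ hΩb hf hζ hζ0 hθ hψ hψu hψF hε hw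
  have hψw := hw.obstacle_le hd hg hΩ hΩb hθ hψ hobs.1.1 hψu hψF hε
  have h1 := hw.opL_add_pairing hv
  have h2 := hobs.pairing_le_opL hd hg hv (huw.mono fun x hx => by linarith)
  rw [pairing_add_left hg hf hζ hv.1] at h1
  have hpen := memLstar_penalTerm (ε := ε) hζ hθ hψ.1.1 hw.1.1.1
  have h3 : pairing Ω ζ (fun x => w x - u x) - pairing Ω (penalTerm ζ ψ θ ε w)
      (fun x => w x - u x) ≤ ε * C * ∫ x in Ω, ζ x := by
    unfold pairing
    rw [← integral_sub (integrable_pairing hg hζ hv.1.1 hv.1.2.1)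
      (integrable_pairing hg hpen hv.1.1 hv.1.2.1), ← integral_const_mul]
    refine integral_mono_ae ((integrable_pairing hg hζ hv.1.1 hv.1.2.1).sub
      (integrable_pairing hg hpen hv.1.1 hv.1.2.1)) ((hζ.integrable hg hΩb).const_mul _) ?_
    filter_upwards [hζ0, ae_restrict_of_ae hψu, ae_restrict_of_ae huw, ae_restrict_of_ae hψw]
      with x h0 h4 h5 h6
    set t := (w x - ψ x) / ε with ht
    have hθ1 : 0 ≤ 1 - θ t := by linarith [(hθ.mem_Icc t).2]
    have ht0 : 0 ≤ t := div_nonneg (by linarith) hε.le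
    have ht' : w x - ψ x = ε * t := by rw [ht]; field_simp
    have h7 : (1 - θ t) * t ≤ C := by
      rcases ht0.eq_or_lt with h | h
      · rw [← h, mul_zero]; exact hC0.le
      · exact hC t h
    have h8 : (1 - θ t) * (w x - u x) ≤ ε * C := by
      calc (1 - θ t) * (w x - u x) ≤ (1 - θ t) * (ε * t) := by
            gcongr; linarith
        _ = ε * ((1 - θ t) * t) := by ring
        _ ≤ ε * C := by gcongr
    have h9 := mul_le_mul_of_nonneg_left h8 h0
    simp only [penalTerm, ← ht]
    linarith
  linarith

/-- A bound on the Gagliardo modulars of the penalised solutions, uniform in `ε ≤ ε'`. -/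
theorem modS_penalSol_le (hobs : IsObstacleSol g s Ω f ψ u) (hε : 0 < ε) (hεε : ε ≤ ε')
    (hw : IsPenalSol g s Ω f ψ ζ θ ε w) (hw' : IsPenalSol g s Ω f ψ ζ θ ε' w') :
    (modS g s w).toReal ≤ (modS g s u).toReal +
      pairing Ω (fun x => |f x + ζ x|) (fun x => w' x - u x) := by
  have hv := hw.1.sub hd hg hobs.1.1
  have hv' := hw'.1.sub hd hg hobs.1.1
  have huw := hobs.le_penalSol hd hg hΩ hΩb hf hζ hζ0 hθ hψ hψu hψF hε hw
  have hww := hw.mono hd hg hΩ hΩb hζ hζ0 hθ hψ hobs.1.1 hψu hψF hε hεε hw'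
  have hF := hf.add hg hζ
  have hFa : MemLstar g Ω (fun x => |f x + ζ x|) :=
    hF.mono (by simpa only [Real.norm_eq_abs] using hF.1.norm)
      (Eventually.of_forall fun x => by rw [abs_abs])
  have h1 := hw.opL_add_pairing hv
  have h2 := (hg.famS hd).tangent (aemeasurable_quot (s := s) hobs.1.1.1.1)
    (aemeasurable_quot hw.1.1.1) hobs.1.1.1.2.2 hw.1.1.2.2
  have h3 : opL g s w (fun x => u x - w x) ≤ (modS g s u).toReal - (modS g s w).toReal := by
    rw [opL_eq, quot_sub]; exact h2
  have e1 : (fun x => u x - w x) = fun x => (-1) * (w x - u x) := by ext x; ring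
  rw [e1, opL_const_mul] at h3
  have h4 : 0 ≤ pairing Ω (penalTerm ζ ψ θ ε w) (fun x => w x - u x) := by
    refine integral_nonneg_of_ae ?_
    filter_upwards [hζ0, ae_restrict_of_ae huw] with x h5 h6
    exact mul_nonneg (mul_nonneg h5 (hθ.mem_Icc _).1) (by linarith)
  have h5 : pairing Ω (fun x => f x + ζ x) (fun x => w x - u x) ≤
      pairing Ω (fun x => |f x + ζ x|) (fun x => w' x - u x) := by
    refine integral_mono_ae (integrable_pairing hg hF hv.1.1 hv.1.2.1)
      (integrable_pairing hg hFa hv'.1.1 hv'.1.2.1) ?_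
    filter_upwards [ae_restrict_of_ae huw, ae_restrict_of_ae hww] with x h6 h7
    calc (f x + ζ x) * (w x - u x) ≤ |f x + ζ x| * (w x - u x) :=
          mul_le_mul_of_nonneg_right (le_abs_self _) (by linarith)
      _ ≤ |f x + ζ x| * (w' x - u x) := by gcongr
  linarith

/-- The gap bound, of order `ε`, is weighed against the error term of quantitative monotonicity,
of order `η` uniformly in `ε`. -/
theorem tendsto_modS_penalSol (hobs : IsObstacleSol g s Ω f ψ u) {C : ℝ} (hC0 : 0 < C)
    (hC : ∀ t, 0 < t → (1 - θ t) * t ≤ C) {U : ℝ → E d → ℝ}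
    (hU : ∀ ε, 0 < ε → IsPenalSol g s Ω f ψ ζ θ ε (U ε)) :
    Tendsto (fun ε => modS g s (fun x => U ε x - u x)) (𝓝[>] 0) (𝓝 0) := by
  set D : ℝ := (modS g s u).toReal +
    pairing Ω (fun x => |f x + ζ x|) (fun x => U 1 x - u x) with hD
  set M : ℝ := C * ∫ x in Ω, ζ x with hM
  have huW := hobs.1.1.1
  have hfin : ∀ ε, 0 < ε → modS g s (fun x => U ε x - u x) ≠ ⊤ := fun ε hε =>
    ((hU ε hε).1.sub hd hg hobs.1.1).1.2.2.ne
  have hbound : ∀ η : ℝ, 0 < η → η ≤ 1 → ∀ ε : ℝ, 0 < ε → ε ≤ 1 →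
      (modS g s (fun x => U ε x - u x)).toReal ≤
        IsYoung.gapConst gl gu η * (ε * M) + η * (D + (modS g s u).toReal) := by
    intro η hη hη1 ε hε hε1
    have hw := hU ε hε
    have h1 := (hg.famS hd).modular_sub_le_gap hη hη1 (aemeasurable_quot (s := s) hw.1.1.1)
      (aemeasurable_quot huW.1) hw.1.1.2.2 huW.2.2
    have hv := (hw.1.sub hd hg hobs.1.1).1
    have h2 : ∫ z, (derivS g z (quot s (U ε) z) - derivS g z (quot s u z)) *
        (quot s (U ε) z - quot s u z) = opL g s (U ε) (fun x => U ε x - u x) -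
          opL g s u (fun x => U ε x - u x) := by
      rw [opL_eq, opL_eq, ← integral_sub (integrable_opL hd hg hw.1.1 hv)
        (integrable_opL hd hg huW hv), quot_sub]
      simp only [sub_mul]
    rw [h2] at h1
    have h3 := opL_gap_le hd hg hΩ hΩb hf hζ hζ0 hθ hψ hψu hψF hobs hε hw hC0 hC
    have h4 := modS_penalSol_le hd hg hΩ hΩb hf hζ hζ0 hθ hψ hψu hψF hobs hε hε1 hw
      (hU 1 one_pos)
    have h5 := IsYoung.gapConst_nonneg gl gu hg.gl_pos hη hη1
    rw [← modS_eq, ← modS_eq] at h1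
    rw [modS_eq, quot_sub]
    refine h1.trans ?_
    rw [mul_assoc, ← hM] at h3
    have h6 := mul_le_mul_of_nonneg_left h3 h5
    have h7 := mul_le_mul_of_nonneg_left h4 hη.le
    rw [hD]
    linarith
  have hreal : Tendsto (fun ε => (modS g s (fun x => U ε x - u x)).toReal) (𝓝[>] 0) (𝓝 0) := by
    rw [Metric.tendsto_nhds]
    intro r hr
    set B : ℝ := |D + (modS g s u).toReal| + 1 with hB
    have hB0 : 0 < B := by positivity
    set η : ℝ := min 1 (r / (2 * B)) with hη
    have hη0 : 0 < η := by positivity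
    have h1 : η * (D + (modS g s u).toReal) < r / 2 := by
      have h2 : η ≤ r / (2 * B) := min_le_right _ _
      calc η * (D + (modS g s u).toReal) < η * B := by
            gcongr
            rw [hB]; linarith [le_abs_self (D + (modS g s u).toReal)]
        _ ≤ r / (2 * B) * B := by gcongr
        _ = r / 2 := by field_simp
    have h2 : Tendsto (fun ε : ℝ => IsYoung.gapConst gl gu η * (ε * M)) (𝓝[>] 0) (𝓝 0) := by
      have hc : Continuous fun ε : ℝ => IsYoung.gapConst gl gu η * (ε * M) := by fun_prop
      have := (hc.tendsto 0).mono_left (nhdsWithin_le_nhds (s := Ioi 0))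
      simpa using this
    filter_upwards [h2.eventually_lt_const (half_pos hr), Ioc_mem_nhdsGT (zero_lt_one' ℝ)]
      with ε h3 h4
    rw [dist_zero_right, Real.norm_eq_abs, abs_of_nonneg ENNReal.toReal_nonneg]
    have := hbound η hη0 (min_le_left _ _) ε h4.1 h4.2
    linarith
  have h1 := (ENNReal.continuous_ofReal.tendsto 0).comp hreal
  rw [ENNReal.ofReal_zero] at h1
  refine h1.congr' ?_
  filter_upwards [self_mem_nhdsWithin] with ε hε
  exact ENNReal.ofReal_toReal (hfin ε hε)

end Penalised

/-! ### Convergence of the penalised solutions -/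

/-- Functions that vanish off a bounded set and whose Gagliardo modulars tend to zero fast enough
tend to zero almost everywhere. -/
theorem ae_tendsto_of_modS_le (hd : 0 < d) (hg : IsAdmissible gl gu kl ku g)
    (hΩb : Bornology.IsBounded Ω) {w : ℕ → E d → ℝ} (hw : ∀ n, AEMeasurable (w n))
    (hw0 : ∀ n, ∀ᵐ x, x ∉ Ω → w n x = 0)
    (h : ∀ n, modS g s (w n) ≤ ENNReal.ofReal (YoungFamily.rate gu n)) :
    ∀ᵐ x, Tendsto (fun n => w n x) atTop (𝓝 0) := by
  have h1 := (hg.famS hd).ae_tendsto_zero (fun n => aemeasurable_quot (s := s) (hw n)) h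
  obtain ⟨y, hy, hR, hQ⟩ := exists_notMem_of_ae hd hΩb (h1.and (ae_ne hd)) (ae_all_iff.2 hw0)
  filter_upwards [hQ] with x hx
  have h2 : 0 < ‖x - y‖ ^ s := Real.rpow_pos_of_pos (norm_pos_iff.2 (sub_ne_zero.2 hx.2)) s
  have h3 := hx.1.mul_const (‖x - y‖ ^ s)
  rw [zero_mul] at h3
  refine h3.congr fun n => ?_
  simp only [quot, delta, hR n hy, sub_zero]
  field_simp

/-- A family decreasing to `u` as `ε → 0` whose Gagliardo modular distance to `u` tends to zero
converges almost everywhere along a sequence. -/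
theorem exists_seq_ae_tendsto (hd : 0 < d) (hg : IsAdmissible gl gu kl ku g)
    (hΩb : Bornology.IsBounded Ω) {U : ℝ → E d → ℝ} {u : E d → ℝ}
    (hm : ∀ ε, 0 < ε → AEMeasurable (fun x => U ε x - u x))
    (h0 : ∀ ε, 0 < ε → ∀ᵐ x, x ∉ Ω → U ε x - u x = 0)
    (h : Tendsto (fun ε => modS g s (fun x => U ε x - u x)) (𝓝[>] 0) (𝓝 0)) :
    ∃ e : ℕ → ℝ, (∀ n, 0 < e n ∧ e n ≤ 1) ∧
      ∀ᵐ x, Tendsto (fun n => U (e n) x - u x) atTop (𝓝 0) := by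
  have h1 : ∀ n : ℕ, ∃ e : ℝ, (0 < e ∧ e ≤ 1) ∧
      modS g s (fun x => U e x - u x) ≤ ENNReal.ofReal (YoungFamily.rate gu n) := by
    intro n
    have h2 := (ENNReal.tendsto_nhds_zero.1 h) _
      (ENNReal.ofReal_pos.2 (YoungFamily.rate_pos gu n))
    obtain ⟨e, he, he'⟩ := (h2.and (Ioc_mem_nhdsGT (zero_lt_one' ℝ))).exists
    exact ⟨e, he', he⟩
  choose e he hr using h1
  exact ⟨e, he, ae_tendsto_of_modS_le hd hg hΩb (fun n => hm _ (he n).1)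
    (fun n => h0 _ (he n).1) hr⟩

/-- A quantity monotone in `ε` that tends to zero along one sequence tends to zero. -/
theorem tendsto_zero_of_seq {m : ℝ → ℝ≥0∞} (hm : ∀ ε ε', 0 < ε → ε ≤ ε' → m ε ≤ m ε')
    {e : ℕ → ℝ} (he : ∀ n, 0 < e n) (h : Tendsto (fun n => m (e n)) atTop (𝓝 0)) :
    Tendsto m (𝓝[>] 0) (𝓝 0) := by
  rw [ENNReal.tendsto_nhds_zero]
  intro η hη
  obtain ⟨n, hn⟩ := ((ENNReal.tendsto_nhds_zero.1 h) η hη).exists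
  filter_upwards [Ioc_mem_nhdsGT (he n)] with ε hε
  exact (hm _ _ hε.1 hε.2).trans hn

/-! ### Higher integrability -/

/-- A weak-type bound with exponent `α` gives integrability with every exponent below `α`. -/
theorem memLp_of_meas_lt_le {X : Type*} [MeasurableSpace X] {μ : Measure X} [IsFiniteMeasure μ]
    {w : X → ℝ} (hw : AEMeasurable w μ) {q α C : ℝ} (hq : 0 < q) (hqα : q < α)
    (h : ∀ t, 1 ≤ t → μ {x | t < |w x|} ≤ ENNReal.ofReal (C * t ^ (-α))) :
    MemLp w (ENNReal.ofReal q) μ := by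
  refine ⟨hw.aestronglyMeasurable, ?_⟩
  rw [eLpNorm_lt_top_iff_lintegral_rpow_enorm_lt_top (by simpa using hq) ENNReal.ofReal_ne_top,
    ENNReal.toReal_ofReal hq.le]
  have h1 : ∀ x, ‖w x‖ₑ ^ q = ENNReal.ofReal (|w x| ^ q) := by
    intro x
    rw [← ofReal_norm, Real.norm_eq_abs, ENNReal.ofReal_rpow_of_nonneg (abs_nonneg _) hq.le]
  simp only [h1]
  rw [lintegral_rpow_eq_lintegral_meas_lt_mul μ (Eventually.of_forall fun x => abs_nonneg _)
    (by simpa only [Real.norm_eq_abs] using hw.norm) hq]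
  refine ENNReal.mul_lt_top ENNReal.ofReal_lt_top ?_
  rw [← Ioc_union_Ioi_eq_Ioi (zero_le_one' ℝ)]
  refine (lintegral_union_le _ _ _).trans_lt (ENNReal.add_lt_top.2 ⟨?_, ?_⟩)
  · calc ∫⁻ t in Ioc (0 : ℝ) 1, μ {x | t < |w x|} * ENNReal.ofReal (t ^ (q - 1))
        ≤ ∫⁻ t in Ioc (0 : ℝ) 1, μ univ * ENNReal.ofReal (t ^ (q - 1)) :=
          lintegral_mono fun t => mul_le_mul_left (measure_mono (subset_univ _)) _
      _ = μ univ * ∫⁻ t in Ioc (0 : ℝ) 1, ENNReal.ofReal (t ^ (q - 1)) :=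
          lintegral_const_mul' _ _ (measure_ne_top _ _)
      _ < ⊤ := by
          refine ENNReal.mul_lt_top (measure_lt_top _ _) ?_
          have hi : IntegrableOn (fun t : ℝ => t ^ (q - 1)) (Ioc 0 1) :=
            (intervalIntegrable_iff_integrableOn_Ioc_of_le zero_le_one).1
              (intervalIntegral.intervalIntegrable_rpow' (by linarith))
          exact hi.lintegral_lt_top
  · have hi : IntegrableOn (fun t : ℝ => C * t ^ (q - 1 - α)) (Ioi 1) :=
      (integrableOn_Ioi_rpow_of_lt (by linarith) one_pos).const_mul C
    refine lt_of_le_of_lt (setLIntegral_mono_ae' measurableSet_Ioi ?_) hi.lintegral_lt_top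
    refine Eventually.of_forall fun t ht => ?_
    have ht0 : (0 : ℝ) < t := one_pos.trans ht
    calc μ {x | t < |w x|} * ENNReal.ofReal (t ^ (q - 1))
        ≤ ENNReal.ofReal (C * t ^ (-α)) * ENNReal.ofReal (t ^ (q - 1)) :=
          mul_le_mul_left (h t (le_of_lt ht)) _
      _ = ENNReal.ofReal (C * t ^ (q - 1 - α)) := by
          rw [← ENNReal.ofReal_mul' (by positivity), mul_assoc, ← Real.rpow_add ht0]
          congr 3; ring

/-- Bootstrapping the decay of a distribution function: each use of the recursive bound improves
a decay exponent `α` to `p + κ α`, and these exponents tend to `p / (1 - κ)`. -/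
theorem exists_decay_of_recursive {m : ℝ → ℝ} {V C p κ t₀ : ℝ} (hp : 0 < p) (hκ : 0 < κ)
    (hκ1 : κ < 1) (ht₀ : 1 ≤ t₀) (hC : 0 ≤ C) (hm0 : ∀ t, 0 ≤ m t) (hmV : ∀ t, m t ≤ V)
    (h : ∀ t, t₀ ≤ t → m (2 * t) ≤ C * t ^ (-p) * m t ^ κ) {q : ℝ} (hq : q < p / (1 - κ)) :
    ∃ α D : ℝ, q < α ∧ ∀ t, 1 ≤ t → m t ≤ D * t ^ (-α) := by
  have hV : 0 ≤ V := (hm0 0).trans (hmV 0)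
  have hstep : ∀ α : ℝ, 0 ≤ α → (∃ D : ℝ, 0 ≤ D ∧ ∀ t, 1 ≤ t → m t ≤ D * t ^ (-α)) →
      ∃ D : ℝ, 0 ≤ D ∧ ∀ t, 1 ≤ t → m t ≤ D * t ^ (-(p + κ * α)) := by
    rintro α hα ⟨D, hD, hDm⟩
    set β := p + κ * α with hβ
    have hβ0 : 0 ≤ β := by positivity
    refine ⟨max (C * D ^ κ * 2 ^ β) (V * (2 * t₀) ^ β), le_max_of_le_left (by positivity),
      fun t ht => ?_⟩
    have ht0 : 0 < t := by linarith
    rcases le_total (2 * t₀) t with htt | htt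
    · have h1 := h (t / 2) (by linarith)
      rw [mul_div_cancel₀ t two_ne_zero] at h1
      have h2 : m (t / 2) ^ κ ≤ (D * (t / 2) ^ (-α)) ^ κ :=
        Real.rpow_le_rpow (hm0 _) (hDm _ (by linarith)) hκ.le
      have h3 : (D * (t / 2) ^ (-α)) ^ κ = D ^ κ * (t / 2) ^ (-(κ * α)) := by
        rw [Real.mul_rpow hD (by positivity), ← Real.rpow_mul (by positivity)]
        congr 2; ring
      have h4 : (t / 2) ^ (-β) = 2 ^ β * t ^ (-β) := by
        rw [Real.div_rpow ht0.le zero_le_two, Real.rpow_neg zero_le_two, div_inv_eq_mul, mul_comm]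
      calc m t ≤ C * (t / 2) ^ (-p) * m (t / 2) ^ κ := h1
        _ ≤ C * (t / 2) ^ (-p) * (D ^ κ * (t / 2) ^ (-(κ * α))) := by
            rw [← h3]; gcongr
        _ = C * D ^ κ * ((t / 2) ^ (-p) * (t / 2) ^ (-(κ * α))) := by ring
        _ = C * D ^ κ * (t / 2) ^ (-β) := by
            rw [← Real.rpow_add (by positivity)]; congr 2; rw [hβ]; ring
        _ = C * D ^ κ * 2 ^ β * t ^ (-β) := by rw [h4]; ring
        _ ≤ _ := by gcongr; exact le_max_left _ _
    · have h1 : 1 ≤ (2 * t₀) ^ β * t ^ (-β) := by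
        rw [Real.rpow_neg ht0.le, ← div_eq_mul_inv, one_le_div (by positivity)]
        exact Real.rpow_le_rpow ht0.le htt hβ0
      calc m t ≤ V * 1 := by rw [mul_one]; exact hmV t
        _ ≤ V * ((2 * t₀) ^ β * t ^ (-β)) := by gcongr
        _ = V * (2 * t₀) ^ β * t ^ (-β) := by ring
        _ ≤ _ := by gcongr; exact le_max_right _ _
  have hiter : ∀ n : ℕ, ∃ D : ℝ, 0 ≤ D ∧
      ∀ t, 1 ≤ t → m t ≤ D * t ^ (-(p * ∑ i ∈ Finset.range n, κ ^ i)) := by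
    intro n
    induction n with
    | zero => exact ⟨V, hV, fun t _ => by simpa using hmV t⟩
    | succ n ih =>
      have := hstep _ (by positivity) ih
      have e : ∀ S : ℝ, p * (κ * S + 1) = p + κ * (p * S) := fun S => by ring
      rw [geom_sum_succ, e]
      exact this
  have hlim : Tendsto (fun n : ℕ => p * ∑ i ∈ Finset.range n, κ ^ i) atTop
      (𝓝 (p * (1 - κ)⁻¹)) :=
    ((hasSum_geometric_of_lt_one hκ.le hκ1).tendsto_sum_nat).const_mul p
  obtain ⟨n, hn⟩ := (hlim.eventually_const_lt (by rwa [← div_eq_mul_inv])).exists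
  obtain ⟨D, -, hD⟩ := hiter n
  exact ⟨_, D, hn, hD⟩

/-- The Young functions grow at least like the power `g_* + 1`. -/
theorem IsProfile.rpow_le {h : ℝ → ℝ} (hh : IsProfile gl gu kl ku h) (hgl : 0 < gl)
    (hgu : gl ≤ gu) {t : ℝ} (ht : 1 ≤ t) :
    kl / (gu + 1) * t ^ (gl + 1) ≤ ∫ ρ in (0 : ℝ)..|t|, h ρ * ρ := by
  have hY := hh.isYoung hgl hgu
  have h1 := hY.deriv_mul_le 1
  have h2 := hY.le_scale t 1 ht
  rw [mul_one] at h2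
  simp only [abs_one, mul_one] at h1 h2
  have h3 : kl / (gu + 1) ≤ ∫ ρ in (0 : ℝ)..1, h ρ * ρ := by
    rw [div_le_iff₀ (by linarith), mul_comm]
    exact hh.lower.trans h1
  have h4 : 0 ≤ t ^ (gl + 1) := by positivity
  calc kl / (gu + 1) * t ^ (gl + 1) ≤ (∫ ρ in (0 : ℝ)..1, h ρ * ρ) * t ^ (gl + 1) := by gcongr
    _ ≤ _ := by rw [mul_comm]; exact h2

theorem measurableSet_pairs {w : E d → ℝ} (hw : Measurable w) (t r : ℝ) :
    MeasurableSet {z : E d × E d | 2 * t < |w z.1| ∧ |w z.2| ≤ t ∧ ‖z.1 - z.2‖ < r} :=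
  (measurableSet_lt measurable_const (hw.comp measurable_fst).norm).inter
    ((measurableSet_le (hw.comp measurable_snd).norm measurable_const).inter
      (measurableSet_lt (measurable_fst.sub measurable_snd).norm measurable_const))

/-- The set of pairs at distance less than `r` across which `|w|` falls from above `2 t` to at
most `t` is large when `r` is so. -/
theorem mul_le_volume_pairs {w : E d → ℝ} (hw : Measurable w) {t r : ℝ} {b : ℝ≥0∞}
    (hb : ∀ x : E d, b ≤ volume (Metric.ball x r) - volume {y | t < |w y|}) :
    volume {x | 2 * t < |w x|} * b ≤
      volume {z : E d × E d | 2 * t < |w z.1| ∧ |w z.2| ≤ t ∧ ‖z.1 - z.2‖ < r} := by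
  have hS := measurableSet_pairs hw t r
  have hA : MeasurableSet {x | 2 * t < |w x|} := measurableSet_lt measurable_const hw.norm
  rw [Measure.volume_eq_prod, Measure.prod_apply hS]
  calc volume {x | 2 * t < |w x|} * b = ∫⁻ _ in {x | 2 * t < |w x|}, b := by
        rw [setLIntegral_const, mul_comm]
    _ ≤ ∫⁻ x in {x | 2 * t < |w x|}, volume
        (Prod.mk x ⁻¹' {z : E d × E d | 2 * t < |w z.1| ∧ |w z.2| ≤ t ∧ ‖z.1 - z.2‖ < r}) := by
        refine setLIntegral_mono_ae' hA (Eventually.of_forall fun x hx => ?_)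
        refine ((hb x).trans le_measure_sdiff).trans (measure_mono ?_)
        rintro y ⟨hy, hy'⟩
        refine ⟨hx, not_lt.1 hy', ?_⟩
        rw [← dist_eq_norm, dist_comm]
        exact hy
    _ ≤ _ := setLIntegral_le_lintegral _ _

/-- The recursive estimate behind the Sobolev embedding: the Gagliardo modular of `w` controls the
pairs of points from `{|w| > 2 t}` and `{|w| ≤ t}` in a ball of twice the volume of
`{|w| > t}`. -/
theorem exists_meas_lt_le (hd : 0 < d) (hs0 : 0 < s) (hg : IsAdmissible gl gu kl ku g)
    {w : E d → ℝ} (hw : Measurable w) (hwS : modS g s w < ⊤) {V : ℝ} (hV : 0 ≤ V)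
    (hwV : ∀ t, 0 ≤ t → volume {x | t < |w x|} ≤ ENNReal.ofReal V) :
    ∃ C t₀ : ℝ, 0 ≤ C ∧ 1 ≤ t₀ ∧ ∀ t, t₀ ≤ t → (volume {x | 2 * t < |w x|}).toReal ≤
      C * t ^ (-(gl + 1)) * (volume {x | t < |w x|}).toReal ^ (s * (gl + 1) / d) := by
  have : Nonempty (Fin d) := ⟨⟨0, hd⟩⟩
  have hgl := hg.gl_pos
  have hgu := hg.gl_pos.trans_le hg.gl_le
  have hkl := hg.kl_pos
  have hd0 : (0 : ℝ) < d := by exact_mod_cast hd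
  set β : ℝ := (volume (Metric.ball (0 : E d) 1)).toReal with hβ
  have hβtop : volume (Metric.ball (0 : E d) 1) ≠ ⊤ := measure_ball_lt_top.ne
  have hβ0 : 0 < β := ENNReal.toReal_pos (Metric.measure_ball_pos volume _ one_pos).ne' hβtop
  have hball : ∀ (x : E d) (r : ℝ), 0 ≤ r →
      volume (Metric.ball x r) = ENNReal.ofReal (r ^ d * β) := by
    intro x r hr
    rw [Measure.addHaar_ball volume x hr, finrank_euclideanSpace_fin,
      ENNReal.ofReal_mul (by positivity), ENNReal.ofReal_toReal hβtop]
  set c : ℝ := kl / (gu + 1) with hc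
  have hc0 : 0 < c := by positivity
  set M : ℝ := (modS g s w).toReal with hM
  have hM0 : 0 ≤ M := ENNReal.toReal_nonneg
  -- `R` bounds the radii of all balls that occur; for `t ≥ R ^ s` the difference quotients in
  -- question are at least `1`, where the lower power growth of the Young function applies.
  set R : ℝ := (2 * V / β) ^ (1 / d : ℝ) with hR
  refine ⟨2 * M / (c * β) * (2 / β) ^ (s * (gl + 1) / d), max 1 (R ^ s), by positivity,
    le_max_left _ _, fun t ht => ?_⟩
  have ht1 : 1 ≤ t := (le_max_left _ _).trans ht
  have htR : R ^ s ≤ t := (le_max_right _ _).trans ht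
  have ht0 : 0 < t := by linarith
  set A := {x | t < |w x|} with hA
  set m := (volume A).toReal with hm
  have hAtop : volume A ≠ ⊤ := ((hwV t ht0.le).trans_lt ENNReal.ofReal_lt_top).ne
  have hm0 : 0 ≤ m := ENNReal.toReal_nonneg
  have hBA : volume {x | 2 * t < |w x|} ≤ volume A :=
    measure_mono fun x (hx : 2 * t < |w x|) => show t < |w x| by linarith
  have hBtop := (hBA.trans_lt hAtop.lt_top).ne
  rcases hm0.eq_or_lt with hm00 | hmpos
  · have h1 : (volume {x | 2 * t < |w x|}).toReal ≤ m := ENNReal.toReal_mono hAtop hBA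
    refine (h1.trans hm00.symm.le).trans ?_
    positivity
  have hmV : m ≤ V := ENNReal.toReal_le_of_le_ofReal hV (hwV t ht0.le)
  -- A ball of radius `r` has volume `2 m`, and so at least half of it lies in `{|w| ≤ t}`.
  set r : ℝ := (2 * m / β) ^ (1 / d : ℝ) with hr
  have hr0 : 0 < r := by positivity
  have hrd : r ^ d = 2 * m / β := by
    rw [hr, ← Real.rpow_natCast, ← Real.rpow_mul (by positivity), one_div,
      inv_mul_cancel₀ hd0.ne', Real.rpow_one]
  have hrR : r ≤ R := Real.rpow_le_rpow (by positivity) (by gcongr) (by positivity)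
  have hrs : r ^ s ≤ t := (Real.rpow_le_rpow hr0.le hrR hs0.le).trans htR
  have hrs0 : 0 < r ^ s := by positivity
  set S := {z : E d × E d | 2 * t < |w z.1| ∧ |w z.2| ≤ t ∧ ‖z.1 - z.2‖ < r} with hS
  have hSm : MeasurableSet S := measurableSet_pairs hw t r
  have h1 : volume {x | 2 * t < |w x|} * ENNReal.ofReal m ≤ volume S := by
    refine mul_le_volume_pairs hw fun x => ?_
    rw [hball x r hr0.le, ← ENNReal.ofReal_toReal hAtop, ← ENNReal.ofReal_sub _ hm0, hrd]
    refine ENNReal.ofReal_le_ofReal ?_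
    rw [div_mul_cancel₀ _ hβ0.ne']
    linarith
  set b : ℝ := c * (t / r ^ s) ^ (gl + 1) / r ^ d with hb
  have hb0 : 0 < b := by positivity
  have h2 : ENNReal.ofReal b * volume S ≤ modS g s w := by
    rw [← setLIntegral_const, modS]
    refine le_trans (setLIntegral_mono_ae' hSm ?_) (setLIntegral_le_lintegral S _)
    filter_upwards [hg.profile] with z hz hzS
    obtain ⟨hz1, hz2, hz3⟩ := hzS
    have hdiff : t ≤ |w z.1 - w z.2| := by
      have := abs_sub_abs_le_abs_sub (w z.1) (w z.2)
      linarith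
    have hne : 0 < ‖z.1 - z.2‖ := by
      rw [norm_pos_iff, sub_ne_zero]
      intro h
      rw [h] at hz1
      linarith
    have hne' : 0 < ‖z.1 - z.2‖ ^ s := Real.rpow_pos_of_pos hne s
    have hquot : t / r ^ s ≤ |delta s w z.1 z.2| := by
      rw [delta, abs_div, abs_of_pos hne']
      exact div_le_div₀ (abs_nonneg _) hdiff hne' (Real.rpow_le_rpow hne.le hz3.le hs0.le)
    have hone : 1 ≤ t / r ^ s := (one_le_div hrs0).2 hrs
    have h3 := hz.rpow_le hgl hg.gl_le (hone.trans hquot)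
    rw [abs_abs] at h3
    refine ENNReal.ofReal_le_ofReal ?_
    have h4 : c * (t / r ^ s) ^ (gl + 1) ≤ primG g z.1 z.2 |delta s w z.1 z.2| := by
      refine le_trans ?_ h3
      gcongr
    exact div_le_div₀ ((by positivity : (0 : ℝ) ≤ _).trans h4) h4 (by positivity) (by gcongr)
  have h3 : b * ((volume {x | 2 * t < |w x|}).toReal * m) ≤ M := by
    have h4 := ENNReal.toReal_mono hwS.ne ((mul_le_mul_right h1 _).trans h2)
    rwa [ENNReal.toReal_mul, ENNReal.toReal_mul, ENNReal.toReal_ofReal hb0.le,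
      ENNReal.toReal_ofReal hm0] at h4
  set n := (volume {x | 2 * t < |w x|}).toReal with hn
  have hsr : (r ^ s) ^ (gl + 1) = (2 / β) ^ (s * (gl + 1) / d) * m ^ (s * (gl + 1) / d) := by
    rw [← Real.mul_rpow (by positivity) hm0, ← Real.rpow_mul hr0.le, hr,
      ← Real.rpow_mul (by positivity)]
    congr 1 <;> ring
  have hbm : b * (n * m) = n * (c * β / 2) * (t ^ (gl + 1) / (r ^ s) ^ (gl + 1)) := by
    rw [hb, hrd, Real.div_rpow ht0.le hrs0.le]
    field_simp
  rw [hbm] at h3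
  have hP0 : 0 < (r ^ s) ^ (gl + 1) := by positivity
  have hT0 : 0 < t ^ (gl + 1) := by positivity
  have h5 : n ≤ 2 * M / (c * β) * ((r ^ s) ^ (gl + 1) / t ^ (gl + 1)) := by
    calc n = n * (c * β / 2) * (t ^ (gl + 1) / (r ^ s) ^ (gl + 1)) *
          (2 / (c * β) * ((r ^ s) ^ (gl + 1) / t ^ (gl + 1))) := by field_simp
      _ ≤ M * (2 / (c * β) * ((r ^ s) ^ (gl + 1) / t ^ (gl + 1))) := by gcongr
      _ = _ := by ring
  rw [hsr] at h5
  rw [Real.rpow_neg ht0.le]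
  refine h5.trans (le_of_eq ?_)
  rw [div_eq_mul_inv (_ * _) (t ^ (gl + 1))]
  ring

/-- Functions of `W^{s,G}` that vanish off a bounded set are in `L^q` below the Sobolev
exponent. -/
theorem memLp_of_memW (hd : 0 < d) (hs0 : 0 < s) (hg : IsAdmissible gl gu kl ku g)
    (hΩb : Bornology.IsBounded Ω) {w : E d → ℝ} (hw : MemW g s w)
    (hw0 : ∀ᵐ x, x ∉ Ω → w x = 0) (hsd : s * (gl + 1) < d) {q : ℝ} (hq : 0 < q)
    (hqd : q < d * (gl + 1) / (d - s * (gl + 1))) :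
    MemLp w (ENNReal.ofReal q) (volume.restrict Ω) := by
  have hgl := hg.gl_pos
  have hd0 : (0 : ℝ) < d := by exact_mod_cast hd
  have hΩtop : volume Ω ≠ ⊤ := hΩb.measure_lt_top.ne
  have : IsFiniteMeasure (volume.restrict Ω) := ⟨by simpa using hΩb.measure_lt_top⟩
  set w' := hw.1.mk w with hw'
  have hae : ∀ᵐ x, w x = w' x := hw.1.ae_eq_mk
  have hS : modS g s w' < ⊤ := by
    have h1 := modW_congr (s := s) hd hg hae
    have h2 := (memW_iff.1 hw).2
    rw [h1] at h2
    exact lt_of_le_of_lt le_add_self h2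
  have hV : ∀ t, 0 ≤ t → volume {x | t < |w' x|} ≤ ENNReal.ofReal (volume Ω).toReal := by
    intro t ht
    rw [ENNReal.ofReal_toReal hΩtop]
    refine measure_mono_ae ?_
    filter_upwards [hae, hw0] with x h1 h2 (h3 : t < |w' x|)
    by_contra hx
    rw [← h1, h2 hx, abs_zero] at h3
    linarith
  obtain ⟨C, t₀, hC, ht₀, hrec⟩ :=
    exists_meas_lt_le hd hs0 hg hw.1.measurable_mk hS ENNReal.toReal_nonneg hV
  have hκ : s * (gl + 1) / d < 1 := (div_lt_one hd0).2 hsd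
  -- `max t 0` makes the bound by `|Ω|` hold for negative `t` too.
  obtain ⟨α, D, hα, hD⟩ := exists_decay_of_recursive
    (m := fun t => (volume {x | max t 0 < |w' x|}).toReal) (V := (volume Ω).toReal)
    (p := gl + 1) (κ := s * (gl + 1) / d) (by linarith) (by positivity) hκ ht₀ hC
    (fun t => ENNReal.toReal_nonneg)
    (fun t => ENNReal.toReal_le_of_le_ofReal ENNReal.toReal_nonneg (hV _ (le_max_right _ _)))
    (fun t ht => by
      rw [max_eq_left (by linarith), max_eq_left (by linarith)]
      exact hrec t ht)
    (q := q) (by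
      have h1 : (gl + 1) / (1 - s * (gl + 1) / d) = d * (gl + 1) / (d - s * (gl + 1)) := by
        have : (d : ℝ) - s * (gl + 1) ≠ 0 := by linarith
        have h2 : 1 - s * (gl + 1) / d = (d - s * (gl + 1)) / d := by field_simp
        rw [h2, div_div_eq_mul_div, mul_comm]
      rwa [h1])
  have h1 : MemLp w' (ENNReal.ofReal q) (volume.restrict Ω) := by
    refine memLp_of_meas_lt_le hw.1.measurable_mk.aemeasurable hq hα (C := D) fun t ht => ?_
    refine (Measure.restrict_apply_le _ _).trans ?_
    have h2 := hD t ht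
    rw [max_eq_left (by linarith)] at h2
    rw [← ENNReal.ofReal_toReal ((hV t (by linarith)).trans_lt ENNReal.ofReal_lt_top).ne]
    exact ENNReal.ofReal_le_ofReal h2
  exact h1.ae_eq (ae_restrict_of_ae (hae.mono fun x hx => hx.symm))

/-- Dominated convergence in `L^q`. -/
theorem tendsto_eLpNorm_zero {X : Type*} [MeasurableSpace X] {μ : Measure X} {q : ℝ} (hq : 0 < q)
    {w : ℕ → X → ℝ} {Y : X → ℝ} (hw : ∀ n, AEMeasurable (w n) μ)
    (hY : MemLp Y (ENNReal.ofReal q) μ) (hle : ∀ n, ∀ᵐ x ∂μ, |w n x| ≤ |Y x|)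
    (hlim : ∀ᵐ x ∂μ, Tendsto (fun n => w n x) atTop (𝓝 0)) :
    Tendsto (fun n => eLpNorm (w n) (ENNReal.ofReal q) μ) atTop (𝓝 0) := by
  have hq0 : ENNReal.ofReal q ≠ 0 := by simpa using hq
  simp only [eLpNorm_eq_lintegral_rpow_enorm_toReal hq0 ENNReal.ofReal_ne_top,
    ENNReal.toReal_ofReal hq.le]
  have h1 : Tendsto (fun n => ∫⁻ x, ‖w n x‖ₑ ^ q ∂μ) atTop (𝓝 (∫⁻ _, 0 ∂μ)) := by
    refine tendsto_lintegral_of_dominated_convergence' (fun x => ‖Y x‖ₑ ^ q)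
      (fun n => (hw n).enorm.pow_const q) (fun n => ?_) ?_ ?_
    · filter_upwards [hle n] with x hx
      gcongr
      rw [← ofReal_norm, ← ofReal_norm]
      exact ENNReal.ofReal_le_ofReal hx
    · have := (eLpNorm_lt_top_iff_lintegral_rpow_enorm_lt_top hq0 ENNReal.ofReal_ne_top).1 hY.2
      rw [ENNReal.toReal_ofReal hq.le] at this
      exact this.ne
    · filter_upwards [hlim] with x hx
      have h2 := (hx.enorm).ennrpow_const q
      rwa [enorm_zero, ENNReal.zero_rpow_of_pos hq] at h2
  rw [lintegral_zero] at h1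
  have h2 := h1.ennrpow_const (1 / q)
  rwa [ENNReal.zero_rpow_of_pos (by positivity)] at h2

end FracOrlicz

end

open FracOrlicz

theorem mainTheorem3 {d : ℕ} (hd : 0 < d) {s : ℝ} (hs0 : 0 < s) (hs1 : s < 1)
    {Ω : Set (E d)} (hΩ : IsOpen Ω) (hΩb : Bornology.IsBounded Ω)
    {gl gu kl ku : ℝ} {g : E d → E d → ℝ → ℝ} (hg : IsAdmissible gl gu kl ku g)
    {f ψ ζ u : E d → ℝ}
    (hψ : MemW0 g s univ ψ) (hψ0 : ∀ᵐ x ∂(volume.restrict Ωᶜ), ψ x ≤ 0)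
    (hf : MemLstar g Ω f) (hζ : MemLstar g Ω ζ)
    -- `ζ = (L_g^s ψ - f)^+` in the ordered dual space
    (hζψ : IsDualSup g s Ω (fun v => opL g s ψ v - pairing Ω f v) (fun _ => 0) (pairing Ω ζ))
    (hu : IsObstacleSol g s Ω f ψ u) :
    -- `L_g^s u` is a function `h`, and `f ≤ h ≤ f ∨ L_g^s ψ = m` a.e. in `Ω`
    (∃ h m : E d → ℝ, MemLstar g Ω h ∧ MemLstar g Ω m ∧
      (∀ v, MemW0 g s Ω v → opL g s u v = pairing Ω h v) ∧
      IsDualSup g s Ω (pairing Ω f) (opL g s ψ) (pairing Ω m) ∧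
      ∀ᵐ x ∂(volume.restrict Ω), f x ≤ h x ∧ h x ≤ m x) ∧
    ∀ θ : ℝ → ℝ, IsPenalisation θ →
      -- the penalised problem has at most one solution
      (∀ ε : ℝ, 0 < ε → ∀ w w' : E d → ℝ, IsPenalSol g s Ω f ψ ζ θ ε w →
        IsPenalSol g s Ω f ψ ζ θ ε w' → w =ᵐ[volume] w') ∧
      -- and it has one, whenever `[·]_{s,G}` controls the norm of `W^{s,G}_0(Ω)`
      (HasPoincare g s Ω → ∀ ε : ℝ, 0 < ε → ∃ w, IsPenalSol g s Ω f ψ ζ θ ε w) ∧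
      -- the solutions converge to `u`
      ∀ uε : ℝ → E d → ℝ, (∀ ε : ℝ, 0 < ε → IsPenalSol g s Ω f ψ ζ θ ε (uε ε)) →
        Tendsto (fun ε => normW g s (fun x => uε ε x - u x)) (𝓝[>] 0) (𝓝 0) ∧
        (s * (gl + 1) < d → ∀ q : ℝ, 1 ≤ q → q < d * (gl + 1) / (d - s * (gl + 1)) →
          MemLp u (ENNReal.ofReal q) (volume.restrict Ω) ∧
          (∀ ε : ℝ, 0 < ε → MemLp (uε ε) (ENNReal.ofReal q) (volume.restrict Ω)) ∧
          Tendsto (fun ε => eLpNorm (fun x => uε ε x - u x) (ENNReal.ofReal q)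
            (volume.restrict Ω)) (𝓝[>] 0) (𝓝 0)) := by
  have hΩm := hΩ.measurableSet
  have hζ0 := ae_nonneg_of_dualLE hd hg hs0 hs1 hΩ hΩb hζ hζψ.2.2.1
  have hψu := hu.1.ae_le hd hg hΩm hψ0
  have hψF : ∀ v, MemW0 g s Ω v → (∀ᵐ x, 0 ≤ v x) →
      opL g s ψ v ≤ pairing Ω (fun x => f x + ζ x) v := by
    intro v hv h0
    have h1 := hζψ.2.1 v hv h0
    rw [pairing_add_left hg hf hζ hv.1]
    linarith
  have hF := hf.add hg hζ
  refine ⟨?_, fun θ hθ => ?_⟩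
  · obtain ⟨h, hh, hrep, hle⟩ := exists_density_opL hd hg hs0 hs1 hΩ hΩb hu.1.1.1 hf hζ hζ0
      (fun v hv h0 => hu.pairing_le_opL hd hg hv h0)
      (fun v hv h0 => hu.opL_le_pairing hd hg hΩb hΩm hψ hψu hf hF
        (hζ0.mono fun x hx => by linarith) hψF hv h0)
    exact ⟨h, fun x => f x + ζ x, hh, hF, hrep, isDualSup_add hg hf hζ hζψ, hle⟩
  have hR := hθ.isRamp
  refine ⟨fun ε hε w w' hw hw' =>
      hw.ae_eq hd hg hΩm hΩb hζ hζ0 hR hψ hu.1.1 hψu hψF hε hw',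
    fun hP ε hε => exists_isPenalSol hd hg hΩb hΩm hP hf hζ hζ0 hψ.1 hu.1.1 hR hε,
    fun U hU => ?_⟩
  obtain ⟨C, hC0, hC⟩ := hθ.decay
  have hdiff : ∀ ε, 0 < ε → MemW0 g s Ω (fun x => U ε x - u x) := fun ε hε =>
    (hU ε hε).1.sub hd hg hu.1.1
  have hS := tendsto_modS_penalSol hd hg hΩm hΩb hf hζ hζ0 hR hψ hψu hψF hu hC0 hC hU
  have hle : ∀ ε ε', 0 < ε → ε ≤ ε' → ∀ᵐ x, |U ε x - u x| ≤ |U ε' x - u x| := by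
    intro ε ε' hε hεε
    filter_upwards [hu.le_penalSol hd hg hΩm hΩb hf hζ hζ0 hR hψ hψu hψF hε (hU ε hε),
      (hU ε hε).mono hd hg hΩm hΩb hζ hζ0 hR hψ hu.1.1 hψu hψF hε hεε
        (hU ε' (hε.trans_le hεε))] with x h1 h2
    rw [abs_of_nonneg (by linarith), abs_of_nonneg (by linarith)]
    linarith
  obtain ⟨e, he, hlim⟩ := exists_seq_ae_tendsto hd hg hΩb (fun ε hε => (hdiff ε hε).1.1)
    (fun ε hε => (hdiff ε hε).ae_eq_zero hd hg hΩm) hS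
  refine ⟨?_, fun hsd q hq1 hq => ?_⟩
  · have hG : Tendsto (fun n => modG g (fun x => U (e n) x - u x)) atTop (𝓝 0) := by
      refine hg.famG.tendsto_modular_zero (w := fun n x => U (e n) x - u x) (y := fun _ _ => 0)
        (Y := fun x => U 1 x - u x) (fun n => (hdiff _ (he n).1).1.1)
        (fun _ => aemeasurable_const) hlim (fun n => ?_) ?_ (hdiff 1 one_pos).1.2.1
      · filter_upwards [hle _ _ (he n).1 (he n).2] with x hx
        rwa [abs_zero, zero_add]
      · simp [modular, youngG, primG]
    -- `modG` decreases with `ε`, so that convergence along one sequence suffices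
    have hG' : Tendsto (fun ε => modG g (fun x => U ε x - u x)) (𝓝[>] 0) (𝓝 0) :=
      tendsto_zero_of_seq (fun ε ε' hε hεε => hg.famG.modular_mono (hle ε ε' hε hεε))
        (fun n => (he n).1) hG
    refine tendsto_normW_of_modW hd hg ?_
    have := hG'.add hS
    rwa [add_zero] at this
  · have hq0 : 0 < q := one_pos.trans_le hq1
    have hLp : ∀ w, MemW0 g s Ω w → MemLp w (ENNReal.ofReal q) (volume.restrict Ω) :=
      fun w hw => memLp_of_memW hd hs0 hg hΩb hw.1 (hw.ae_eq_zero hd hg hΩm) hsd hq0 hq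
    refine ⟨hLp u hu.1.1, fun ε hε => hLp _ (hU ε hε).1, ?_⟩
    refine tendsto_zero_of_seq (fun ε ε' hε hεε => ?_) (fun n => (he n).1)
      (tendsto_eLpNorm_zero hq0 (fun n => (hdiff _ (he n).1).1.1.restrict) (hLp _ (hdiff 1 one_pos))
        (fun n => ae_restrict_of_ae (hle _ _ (he n).1 (he n).2)) (ae_restrict_of_ae hlim))
    exact eLpNorm_mono_ae (ae_restrict_of_ae (hle ε ε' hε hεε))
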